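/- **Setting.** Let $M$ be a smooth, Hausdorff, $\sigma$-compact $n$-dimensional manifold without boundary, with a smooth measure $\mathrm{d}x$ (smooth and strictly positive density with respect to Lebesgue measure in every chart), and let $\mathscr E,\mathscr F$ be smooth complex vector bundles of finite rank on $M$, with continuous fibre norms $|\cdot|$ and smooth hermitean fibre inner products $\langle\cdot,\cdot\rangle$ (linear in the first variable); write $\langle\!\langle f,g\rangle\!\rangle=\int_M\langle f,g\rangle\,\mathrm{d}x$. Let $1\le p\le\infty$. $L^p_{\mathrm{loc}}(\mathscr E)$ is the space of (classes of) measurable sections $f$ with $|f|$ in $L^p$ on every compact set; $L^\infty_{\mathrm{loc}}$ denotes the measurable, locally essentially bounded functions $\zeta:M\to\mathbb C$, and $L^\infty_{\mathrm c}$ those that moreover vanish a.e. off a compact set. For $\zeta\in L^\infty_{\mathrm{loc}}$ and a section $f$, $\|\zeta f\|_p\in[0,\infty]$ is the $L^p$ norm of $|\zeta|\,|f|$. $C$ and $C^\infty$ denote continuous and smooth sections, and $C^\infty_{\mathrm c}$ smooth compactly-supported sections. Let $D:C^\infty(\mathscr E)\to C^\infty(\mathscr F)$ be a smooth linear differential operator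 of order at most one, that is, in local coordinates and trivialisations $Df=bf+\sum_j a_j\partial_jf$ with smooth matrix-valued $a_j,b$. Let $D^+$ be its formal adjoint, determined by $\langle\!\langle Dg,\phi\rangle\!\rangle=\langle\!\langle g,D^+\phi\rangle\!\rangle$ for $g\in C^\infty_{\mathrm c}(\mathscr E)$, $\phi\in C^\infty_{\mathrm c}(\mathscr F)$. For $f\in L^1_{\mathrm{loc}}(\mathscr E)$, $Df$ is the distribution $\phi\mapsto\langle\!\langle f,D^+\phi\rangle\!\rangle$, and $Df=g\in L^1_{\mathrm{loc}}(\mathscr F)$ means that this equals $\langle\!\langle g,\phi\rangle\!\rangle$ for all $\phi\in C^\infty_{\mathrm c}(\mathscr F)$. Let $W^p_{D,\mathrm{loc}}(\mathscr E)=\{f\in L^p_{\mathrm{loc}}(\mathscr E): Df\in L^p_{\mathrm{loc}}(\mathscr F)\}$. **Mollifiers.** Fix a countable, locally finite atlas of diffeomorphisms $\phi_\alpha:U_\alpha\to\mathbb R^n$ ($\alpha\in A$) and a smooth partition of unity $(\eta_\alpha)$ with $\operatorname{supp}\eta_\alpha\subseteq\phi_\alpha^{-1}(B(0,1))$. For each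 $\alpha$ fix smooth trivialisations of $\mathscr E$ and $\mathscr F$ over $U_\alpha$; with $\phi_\alpha$ they identify sections over $U_\alpha$ with vector-valued functions on $\mathbb R^n$, by a map $\tau_\alpha$, and $\tau_\alpha^{-1}g$ denotes the corresponding section extended by $0$ off $U_\alpha$. Fix a smooth $\varphi\ge0$ on $\mathbb R^n$, supported in the closed unit ball, with $\int\varphi=1$; for $t\in(0,1]$ let $\varphi_t(x)=t^{-n}\varphi(x/t)$ and $J_tg=\varphi_t*g$. Let $E=(0,1]^A$, ordered componentwise, and for $\boldsymbol\epsilon\in E$ put $$J_{\boldsymbol\epsilon}f=\sum_{\alpha}\tau_\alpha^{-1}J_{\epsilon_\alpha}\tau_\alpha(\eta_\alpha f).$$ The same formula, with $\tau_\alpha(\eta_\alpha\,\cdot)$ extended by duality and with convolution of distributions, defines $J_{\boldsymbol\epsilon}$ on distributions. For $f\in L^1_{\mathrm{loc}}(\mathscr E)$ let $[D,J_{\boldsymbol\epsilon}]f=DJ_{\boldsymbol\epsilon}f-J_{\boldsymbol\epsilon}Df$, where $Df$ is a distribution. For $G:E\to[0,\infty]$ write $\limsup_{\boldsymbol\epsilon\to\boldsymbol0}G(\boldsymbol\epsilon)=\inf_{\bar{\boldsymbol\epsilon}\in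 E}\sup_{\boldsymbol\epsilon\le\bar{\boldsymbol\epsilon}}G(\boldsymbol\epsilon)$. **Theorem.** The $J_{\boldsymbol\epsilon}$ are well-defined linear operators on $L^1_{\mathrm{loc}}(\mathscr E)$, with the following properties. 1. (Smoothing) If $f\in L^1_{\mathrm{loc}}(\mathscr E)$, then $J_{\boldsymbol\epsilon}f\in C^\infty(\mathscr E)$ for all $\boldsymbol\epsilon\in E$. 2. (Supports) If $C\subseteq M$ is closed and $W\supseteq C$ is open, there is $\bar{\boldsymbol\epsilon}\in E$ such that $\operatorname{supp}J_{\boldsymbol\epsilon}f\subseteq W$ for all $f\in L^1_{\mathrm{loc}}(\mathscr E)$ with $\operatorname{supp}f\subseteq C$ and all $\boldsymbol\epsilon\le\bar{\boldsymbol\epsilon}$. 3. (Equicontinuity) For each $\zeta\in L^\infty_{\mathrm{loc}}$ there is $\xi\in L^\infty_{\mathrm{loc}}$ such that $\|\zeta J_{\boldsymbol\epsilon}f\|_p\le\|\xi f\|_p$ for all $f\in L^p_{\mathrm{loc}}(\mathscr E)$ and $\boldsymbol\epsilon\in E$; if $\zeta\in L^\infty_{\mathrm c}$, we may choose $\xi\in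 L^\infty_{\mathrm c}$. 4. (Approximation) If $p<\infty$ and $f\in L^p_{\mathrm{loc}}(\mathscr E)$, or $p=\infty$ and $f\in C(\mathscr E)$, then $\limsup_{\boldsymbol\epsilon\to\boldsymbol0}\|\zeta(J_{\boldsymbol\epsilon}f-f)\|_p=0$ for all $\zeta\in L^\infty_{\mathrm{loc}}$. 5. (Upper bound) If $f\in L^\infty_{\mathrm{loc}}(\mathscr E)$, then for each continuous fibre seminorm $P$ on $\mathscr E$ and each closed $C\subseteq M$, $$\limsup_{\boldsymbol\epsilon\to\boldsymbol0}\sup_{x\in C}P(J_{\boldsymbol\epsilon}f)(x)\le\inf_{W\supseteq C,\ W\text{ open}}\operatorname*{ess\,sup}_{x\in W}P(f)(x)$$ (suprema and essential suprema over empty sets being $0$). 6. (Equicontinuity of commutators) For each $\zeta\in L^\infty_{\mathrm{loc}}$ there is $\xi\in L^\infty_{\mathrm{loc}}$ such that $\|\zeta[D,J_{\boldsymbol\epsilon}]f\|_p\le\|\xi f\|_p$ for all $f\in L^p_{\mathrm{loc}}(\mathscr E)$ and $\boldsymbol\epsilon\in E$; if $\zeta\in L^\infty_{\mathrm c}$,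 we may choose $\xi\in L^\infty_{\mathrm c}$. 7. (Vanishing) If $p<\infty$ and $f\in L^p_{\mathrm{loc}}(\mathscr E)$, or $p=\infty$ and $f\in C(\mathscr E)$, then $\limsup_{\boldsymbol\epsilon\to\boldsymbol0}\|\zeta[D,J_{\boldsymbol\epsilon}]f\|_p=0$ for all $\zeta\in L^\infty_{\mathrm{loc}}$. 8. (Equicontinuity on $W^p_{D,\mathrm{loc}}$) For each $\zeta\in L^\infty_{\mathrm{loc}}$ there is $\xi\in L^\infty_{\mathrm{loc}}$ such that $\|\zeta DJ_{\boldsymbol\epsilon}f\|_p\le\|\xi f\|_p+\|\xi Df\|_p$ for all $f\in W^p_{D,\mathrm{loc}}(\mathscr E)$ and $\boldsymbol\epsilon\in E$; if $\zeta\in L^\infty_{\mathrm c}$, we may choose $\xi\in L^\infty_{\mathrm c}$. 9. (Approximation on $W^p_{D,\mathrm{loc}}$) If $p<\infty$ and $f\in W^p_{D,\mathrm{loc}}(\mathscr E)$, or $p=\infty$, $f\in C(\mathscr E)$ and $Df\in C(\mathscr F)$, then $\limsup_{\boldsymbol\epsilon\to\boldsymbol0}\|\zeta(DJ_{\boldsymbol\epsilon}f-Df)\|_p=0$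 for all $\zeta\in L^\infty_{\mathrm{loc}}$. 10. (Upper bound) If $f\in C(\mathscr E)$ and $Df\in L^\infty_{\mathrm{loc}}(\mathscr F)$, then for each continuous fibre seminorm $P$ on $\mathscr F$ and each closed $C\subseteq M$, $$\limsup_{\boldsymbol\epsilon\to\boldsymbol0}\sup_{x\in C}P(DJ_{\boldsymbol\epsilon}f)(x)\le\inf_{W\supseteq C,\ W\text{ open}}\operatorname*{ess\,sup}_{x\in W}P(Df)(x).$$ -/

import Mathlib

open Bundle Set Filter Topology MeasureTheory
open scoped Manifold ContDiff ENNReal ComplexConjugate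

noncomputable section

namespace Friedrichs

/-- Euclidean `n`-space, the model space of an `n`-dimensional manifold. -/
abbrev Euc (n : ℕ) : Type := EuclideanSpace ℝ (Fin n)

/-! ### Measures, families of parameters, scalar multipliers -/

section Scalar

variable {n : ℕ} {M : Type*} [TopologicalSpace M] [ChartedSpace (Euc n) M] [MeasurableSpace M]

/-- A smooth measure on `M`: in each smooth chart it has a smooth strictly positive density with
respect to Lebesgue measure. -/
def IsSmoothMeasure (n : ℕ) {M : Type*} [TopologicalSpace M] [ChartedSpace (Euc n) M]
    [MeasurableSpace M] (μ : Measure M) : Prop :=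
  ∀ e ∈ IsManifold.maximalAtlas (𝓡 n) ∞ M, ∃ ρ : Euc n → ℝ,
    ContDiffOn ℝ ∞ ρ e.target ∧ (∀ y ∈ e.target, 0 < ρ y) ∧
    (μ.restrict e.source).map e =
      (volume.restrict e.target).withDensity (fun y => ENNReal.ofReal (ρ y))

/-- The scalar functions in `L^∞_loc`. -/
def IsLinfLoc (μ : Measure M) (ζ : M → ℂ) : Prop :=
  AEStronglyMeasurable ζ μ ∧ ∀ K : Set M, IsCompact K → eLpNorm ζ ⊤ (μ.restrict K) < ⊤

/-- The scalar functions in `L^∞_c`: those in `L^∞_loc` that vanish almost everywhere off a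
compact set. -/
def IsLinfComp (μ : Measure M) (ζ : M → ℂ) : Prop :=
  IsLinfLoc μ ζ ∧ ∃ K : Set M, IsCompact K ∧ ∀ᵐ x ∂μ, x ∉ K → ζ x = 0

end Scalar

/-- Families of parameters `(ε_α)` with each `ε_α ∈ ]0, 1]`, ordered componentwise. -/
abbrev Params (A : Type*) : Type _ := A → Ioc (0 : ℝ) 1

/-- The upper limit along families of parameters:
`limsup_{ε → 0} F(ε) = inf_{ε'} sup_{ε ≤ ε'} F(ε)`. -/
def limsupZero {A : Type*} (F : Params A → ℝ≥0∞) : ℝ≥0∞ :=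
  ⨅ εbar : Params A, ⨆ ε : Params A, ⨆ _ : ε ≤ εbar, F ε

/-! ### Mollifiers on Euclidean space -/

/-- A smooth nonnegative function on `ℝ^n`, supported in the unit ball and of unit mass. -/
structure Kernel (n : ℕ) where
  toFun : Euc n → ℝ
  smooth : ContDiff ℝ ∞ toFun
  nonneg : ∀ x, 0 ≤ toFun x
  tsupport_subset : tsupport toFun ⊆ Metric.closedBall 0 1
  integral_eq_one : ∫ x, toFun x = 1

/-- The rescaled kernel `φ_t(x) = t^{-n} φ(t^{-1} x)`. -/
def Kernel.scaled {n : ℕ} (φ : Kernel n) (t : ℝ) (x : Euc n) : ℝ :=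
  (t ^ n)⁻¹ * φ.toFun (t⁻¹ • x)

/-- `J_t g = φ_t * g` for a vector-valued function `g` on `ℝ^n`. -/
def Kernel.mollify {n : ℕ} (φ : Kernel n) {V : Type*} [NormedAddCommGroup V] [NormedSpace ℂ V]
    (t : ℝ) (g : Euc n → V) (x : Euc n) : V :=
  ∫ y, φ.scaled t (x - y) • g y

/-- `J_t u` for a `V`-valued distribution `u` on `ℝ^n`, which is given by its conjugate-linear
pairing `ψ ↦ ⟪u, ψ⟫` with test functions:
`J_t u (x) = ∑_k ⟪u, φ_t(x - ·) e_k⟫ e_k`, for an orthonormal basis `(e_k)` of `V`. -/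
def Kernel.mollifyDist {n : ℕ} (φ : Kernel n) {V : Type*} [NormedAddCommGroup V]
    [InnerProductSpace ℂ V] [FiniteDimensional ℂ V]
    (t : ℝ) (u : (Euc n → V) → ℂ) (x : Euc n) : V :=
  ∑ k, u (fun y => φ.scaled t (x - y) • stdOrthonormalBasis ℂ V k) • stdOrthonormalBasis ℂ V k

/-! ### Complex vector bundles

A smooth complex vector bundle over `M` is a bundle whose local trivialisations are fibrewise
complex linear, with transition functions that are smooth maps on the real manifold `M`. -/

section Bundles

variable {n : ℕ} {M : Type*} [TopologicalSpace M] [ChartedSpace (Euc n) M]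
variable {V : Type*} [NormedAddCommGroup V] [InnerProductSpace ℂ V]
  {E : M → Type*} [∀ x, AddCommGroup (E x)] [∀ x, Module ℂ (E x)]
  [∀ x, TopologicalSpace (E x)] [TopologicalSpace (TotalSpace V E)] [FiberBundle V E]

/-- A section is smooth. -/
def IsSmoothSection (n : ℕ) {M : Type*} [TopologicalSpace M] [ChartedSpace (Euc n) M]
    (V : Type*) [NormedAddCommGroup V] [InnerProductSpace ℂ V]
    {E : M → Type*} [∀ x, TopologicalSpace (E x)] [TopologicalSpace (TotalSpace V E)]
    [FiberBundle V E] (f : ∀ x, E x) : Prop :=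
  ContMDiff (𝓡 n) ((𝓡 n).prod 𝓘(ℝ, V)) ∞ (fun x => TotalSpace.mk' V x (f x))

/-- A section is continuous. -/
def IsContSection {M : Type*} (V : Type*) {E : M → Type*} [TopologicalSpace M]
    [TopologicalSpace (TotalSpace V E)] (f : ∀ x, E x) : Prop :=
  Continuous (fun x => TotalSpace.mk' V x (f x))

/-- The support of a section: the closure of the set where it is nonzero. -/
def secSupport {M : Type*} [TopologicalSpace M] {E : M → Type*} [∀ x, AddCommGroup (E x)]
    (f : ∀ x, E x) : Set M :=
  closure {x | f x ≠ 0}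

/-- Smooth compactly-supported sections. -/
def IsTestSection (n : ℕ) {M : Type*} [TopologicalSpace M] [ChartedSpace (Euc n) M]
    (V : Type*) [NormedAddCommGroup V] [InnerProductSpace ℂ V]
    {E : M → Type*} [∀ x, AddCommGroup (E x)] [∀ x, TopologicalSpace (E x)]
    [TopologicalSpace (TotalSpace V E)] [FiberBundle V E] (f : ∀ x, E x) : Prop :=
  IsSmoothSection n V f ∧ IsCompact (secSupport f)

/-- A section is measurable: it is almost everywhere (strongly) measurable when read in the
local trivialisations. -/
def IsMeasurableSection {M : Type*} [TopologicalSpace M] [MeasurableSpace M] (V : Type*)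
    [NormedAddCommGroup V] {E : M → Type*} [∀ x, TopologicalSpace (E x)]
    [TopologicalSpace (TotalSpace V E)] [FiberBundle V E] (μ : Measure M) (f : ∀ x, E x) : Prop :=
  ∀ x₀ : M, AEStronglyMeasurable (fun x => (trivializationAt V E x₀ ⟨x, f x⟩).2)
    (μ.restrict (trivializationAt V E x₀).baseSet)

/-- A smooth, fibrewise complex linear trivialisation over an open subset. -/
def IsSmoothTriv (n : ℕ) {M : Type*} [TopologicalSpace M] [ChartedSpace (Euc n) M]
    {V : Type*} [NormedAddCommGroup V] [InnerProductSpace ℂ V]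
    {E : M → Type*} [∀ x, AddCommGroup (E x)] [∀ x, Module ℂ (E x)]
    [∀ x, TopologicalSpace (E x)] [TopologicalSpace (TotalSpace V E)] [FiberBundle V E]
    (t : Trivialization V (π V E)) : Prop :=
  Trivialization.IsLinear ℂ t ∧
  ContMDiffOn ((𝓡 n).prod 𝓘(ℝ, V)) ((𝓡 n).prod 𝓘(ℝ, V)) ∞ t t.source ∧
  ContMDiffOn ((𝓡 n).prod 𝓘(ℝ, V)) ((𝓡 n).prod 𝓘(ℝ, V)) ∞
    t.toOpenPartialHomeomorph.symm t.target

/-- The expression `τ f` of a section `f` in a chart `e` and a trivialisation `t`. -/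
def localRep (e : OpenPartialHomeomorph M (Euc n)) (t : Trivialization V (π V E))
    (f : ∀ x, E x) (y : Euc n) : V :=
  (t ⟨e.symm y, f (e.symm y)⟩).2

open Classical in
/-- The section `τ^{-1} g` which is expressed by `g` in a chart `e` and a trivialisation `t`, and
vanishes off the domain of the chart. -/
def fromLocal (e : OpenPartialHomeomorph M (Euc n)) (t : Trivialization V (π V E))
    (g : Euc n → V) (x : M) : E x :=
  if x ∈ e.source then t.symm x (g (e x)) else 0

/-- A continuous fibre seminorm on a complex vector bundle. -/
structure FibreSeminorm {M : Type*} (V : Type*) (E : M → Type*) [∀ x, AddCommGroup (E x)]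
    [∀ x, Module ℂ (E x)] [TopologicalSpace (TotalSpace V E)] where
  seminorm : ∀ x, Seminorm ℂ (E x)
  continuous : Continuous (fun v : TotalSpace V E => seminorm v.proj v.2)

/-- A fibre seminorm is a fibre norm if it is positive on nonzero vectors. -/
def FibreSeminorm.IsNorm {M : Type*} {V : Type*} {E : M → Type*} [∀ x, AddCommGroup (E x)]
    [∀ x, Module ℂ (E x)] [TopologicalSpace (TotalSpace V E)] (N : FibreSeminorm V E) : Prop :=
  ∀ (x : M) (v : E x), N.seminorm x v = 0 → v = 0

/-- A smooth hermitean fibre inner product, linear in the first variable. -/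
structure HermitianMetric (n : ℕ) {M : Type*} [TopologicalSpace M] [ChartedSpace (Euc n) M]
    (V : Type*) [NormedAddCommGroup V] [InnerProductSpace ℂ V]
    (E : M → Type*) [∀ x, AddCommGroup (E x)] [∀ x, Module ℂ (E x)]
    [∀ x, TopologicalSpace (E x)] [TopologicalSpace (TotalSpace V E)] [FiberBundle V E] where
  form : ∀ x, E x →ₗ[ℂ] E x →ₗ⋆[ℂ] ℂ
  conj_symm : ∀ (x : M) (v w : E x), form x w v = conj (form x v w)
  pos : ∀ (x : M) (v : E x), v ≠ 0 → 0 < (form x v v).re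
  smooth : ∀ (x₀ : M) (v w : V), ContMDiffOn (𝓡 n) 𝓘(ℝ, ℂ) ∞
    (fun x => form x ((trivializationAt V E x₀).symm x v) ((trivializationAt V E x₀).symm x w))
    (trivializationAt V E x₀).baseSet

variable [MeasurableSpace M]

/-- The pairing `⟪f, g⟫ = ∫ ⟨f(x), g(x)⟩ dx` of sections. -/
def HermitianMetric.pairing (h : HermitianMetric n V E) (μ : Measure M) (f g : ∀ x, E x) : ℂ :=
  ∫ x, h.form x (f x) (g x) ∂μ

/-- The extended seminorm `‖ζ f‖_p` of a section `f`, for a scalar function `ζ`. -/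
def secNorm (N : FibreSeminorm V E) (μ : Measure M) (p : ℝ≥0∞) (ζ : M → ℂ) (f : ∀ x, E x) :
    ℝ≥0∞ :=
  eLpNorm (fun x => ‖ζ x‖ * N.seminorm x (f x)) p μ

/-- The sections in `L^p_loc`. -/
def IsLpLoc (N : FibreSeminorm V E) (μ : Measure M) (p : ℝ≥0∞) (f : ∀ x, E x) : Prop :=
  IsMeasurableSection V μ f ∧
  ∀ K : Set M, IsCompact K → eLpNorm (fun x => N.seminorm x (f x)) p (μ.restrict K) < ⊤

end Bundles

/-! ### First-order differential operators and their action on distributions -/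

section Operators

variable {n : ℕ} {M : Type*} [TopologicalSpace M] [ChartedSpace (Euc n) M]
variable {V : Type*} [NormedAddCommGroup V] [InnerProductSpace ℂ V]
  {E : M → Type*} [∀ x, AddCommGroup (E x)] [∀ x, Module ℂ (E x)]
  [∀ x, TopologicalSpace (E x)] [TopologicalSpace (TotalSpace V E)] [FiberBundle V E]
variable {W : Type*} [NormedAddCommGroup W] [InnerProductSpace ℂ W]
  {F : M → Type*} [∀ x, AddCommGroup (F x)] [∀ x, Module ℂ (F x)]
  [∀ x, TopologicalSpace (F x)] [TopologicalSpace (TotalSpace W F)] [FiberBundle W F]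

/-- A (smooth, linear) first-order differential operator from `C^∞(E)` to `C^∞(F)`: in local
coordinates and trivialisations, `D f = b f + ∑_j a_j ∂_j f`, where `a_j` and `b` are smooth
functions whose values are complex linear maps. -/
structure FirstOrderOp (n : ℕ) {M : Type*} [TopologicalSpace M] [ChartedSpace (Euc n) M]
    (V : Type*) [NormedAddCommGroup V] [InnerProductSpace ℂ V]
    (E : M → Type*) [∀ x, AddCommGroup (E x)] [∀ x, Module ℂ (E x)]
    [∀ x, TopologicalSpace (E x)] [TopologicalSpace (TotalSpace V E)] [FiberBundle V E]
    (W : Type*) [NormedAddCommGroup W] [InnerProductSpace ℂ W]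
    (F : M → Type*) [∀ x, AddCommGroup (F x)] [∀ x, Module ℂ (F x)]
    [∀ x, TopologicalSpace (F x)] [TopologicalSpace (TotalSpace W F)] [FiberBundle W F] where
  toFun : {f : ∀ x, E x // IsSmoothSection n V f} → {g : ∀ x, F x // IsSmoothSection n W g}
  local_form : ∀ e ∈ IsManifold.maximalAtlas (𝓡 n) ∞ M,
    ∀ (t : Trivialization V (π V E)) (t' : Trivialization W (π W F)),
      IsSmoothTriv n t → IsSmoothTriv n t' → e.source ⊆ t.baseSet → e.source ⊆ t'.baseSet →
      ∃ (a : Fin n → Euc n → (V →L[ℂ] W)) (b : Euc n → (V →L[ℂ] W)),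
        (∀ j, ContDiffOn ℝ ∞ (a j) e.target) ∧ ContDiffOn ℝ ∞ b e.target ∧
        ∀ (f : {f : ∀ x, E x // IsSmoothSection n V f}), ∀ y ∈ e.target,
          localRep e t' (toFun f).1 y =
            b y (localRep e t f.1 y) +
            ∑ j, a j y (fderiv ℝ (localRep e t f.1) y (EuclideanSpace.single j 1))

open Classical in
/-- `D f` for a smooth section `f`. (On sections that are not smooth, where it is never used, it
is `0`.) -/
def FirstOrderOp.app (D : FirstOrderOp n V E W F) (f : ∀ x, E x) : ∀ x, F x :=
  if hf : IsSmoothSection n V f then (D.toFun ⟨f, hf⟩).1 else 0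

variable [MeasurableSpace M]

/-- `ψ` is the value `D^+ φ` of the formal adjoint of `D` on the test section `φ`: it is a test
section, and `⟪D g, φ⟫ = ⟪g, ψ⟫` for all test sections `g`. This determines `ψ`. -/
def FirstOrderOp.IsAdjointAt (D : FirstOrderOp n V E W F) (μ : Measure M)
    (hE : HermitianMetric n V E) (hF : HermitianMetric n W F) (φ : ∀ x, F x) (ψ : ∀ x, E x) :
    Prop :=
  IsTestSection n V ψ ∧
  ∀ g : ∀ x, E x, IsTestSection n V g → hF.pairing μ (D.app g) φ = hE.pairing μ g ψ

open Classical in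
/-- The formal adjoint `D^+`, on test sections. -/
def FirstOrderOp.adjoint (D : FirstOrderOp n V E W F) (μ : Measure M)
    (hE : HermitianMetric n V E) (hF : HermitianMetric n W F) (φ : ∀ x, F x) : ∀ x, E x :=
  if h : ∃ ψ, D.IsAdjointAt μ hE hF φ ψ then h.choose else 0

/-- The distribution `D f`, for a locally integrable section `f`, as a functional on test
sections: `⟪D f, φ⟫ = ⟪f, D^+ φ⟫`. -/
def FirstOrderOp.distApp (D : FirstOrderOp n V E W F) (μ : Measure M)
    (hE : HermitianMetric n V E) (hF : HermitianMetric n W F) (f : ∀ x, E x) :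
    (∀ x, F x) → ℂ :=
  fun φ => hE.pairing μ f (D.adjoint μ hE hF φ)

/-- The section `g` represents the distribution `D f`. -/
def FirstOrderOp.IsWeakDeriv (D : FirstOrderOp n V E W F) (μ : Measure M)
    (hE : HermitianMetric n V E) (hF : HermitianMetric n W F) (f : ∀ x, E x) (g : ∀ x, F x) :
    Prop :=
  ∀ φ : ∀ x, F x, IsTestSection n W φ → D.distApp μ hE hF f φ = hF.pairing μ g φ

end Operators

/-! ### Mollifiers on manifolds -/

section Mollifiers

/-- A countable, locally finite atlas of charts `U_α → ℝ^n` that are onto, with a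
smooth partition of unity `(η_α)` such that `supp η_α ⊆ V_α`, where `V_α ⊆ U_α` is the inverse
image of the open unit ball. -/
structure GoodAtlas (n : ℕ) (M : Type*) [TopologicalSpace M] [ChartedSpace (Euc n) M]
    (A : Type*) where
  countable : Countable A
  chart : A → OpenPartialHomeomorph M (Euc n)
  mem_atlas : ∀ α, chart α ∈ IsManifold.maximalAtlas (𝓡 n) ∞ M
  target_eq : ∀ α, (chart α).target = univ
  locallyFinite : LocallyFinite (fun α => (chart α).source)
  η : SmoothPartitionOfUnity A (𝓡 n) M univ
  tsupport_subset : ∀ α, tsupport (η α) ⊆ (chart α).source ∩ chart α ⁻¹' Metric.ball 0 1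

variable {n : ℕ} {M : Type*} [TopologicalSpace M] [ChartedSpace (Euc n) M] {A : Type*}
variable {V : Type*} [NormedAddCommGroup V] [InnerProductSpace ℂ V]
  {E : M → Type*} [∀ x, AddCommGroup (E x)] [∀ x, Module ℂ (E x)]
  [∀ x, TopologicalSpace (E x)] [TopologicalSpace (TotalSpace V E)] [FiberBundle V E]
variable {W : Type*} [NormedAddCommGroup W] [InnerProductSpace ℂ W]
  {F : M → Type*} [∀ x, AddCommGroup (F x)] [∀ x, Module ℂ (F x)]
  [∀ x, TopologicalSpace (F x)] [TopologicalSpace (TotalSpace W F)] [FiberBundle W F]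

/-- Trivialisations of a bundle over the domains of the charts of the atlas. -/
structure GoodTriv (𝒜 : GoodAtlas n M A) (V : Type*) [NormedAddCommGroup V]
    [InnerProductSpace ℂ V] (E : M → Type*) [∀ x, AddCommGroup (E x)] [∀ x, Module ℂ (E x)]
    [∀ x, TopologicalSpace (E x)] [TopologicalSpace (TotalSpace V E)] [FiberBundle V E] where
  triv : A → Trivialization V (π V E)
  isSmooth : ∀ α, IsSmoothTriv n (triv α)
  baseSet_eq : ∀ α, (triv α).baseSet = (𝒜.chart α).source

/-- `τ_α(η_α f)`, for a section `f`. -/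
def GoodTriv.cutRep {𝒜 : GoodAtlas n M A} (τ : GoodTriv 𝒜 V E) (α : A) (f : ∀ x, E x) :
    Euc n → V :=
  localRep (𝒜.chart α) (τ.triv α) (fun x => ((𝒜.η α x : ℝ) : ℂ) • f x)

/-- The mollifier `J_ε f = ∑_α τ_α^{-1} J_{ε_α} τ_α(η_α f)`, for a locally integrable
section `f`. -/
def GoodTriv.mollify {𝒜 : GoodAtlas n M A} (τ : GoodTriv 𝒜 V E) (φ : Kernel n)
    (ε : Params A) (f : ∀ x, E x) : ∀ x, E x :=
  fun x => ∑ᶠ α, fromLocal (𝒜.chart α) (τ.triv α) (φ.mollify (ε α) (τ.cutRep α f)) x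

variable [MeasurableSpace M]

/-- `Ψ` is the test section that is obtained from the test function `ψ` on `ℝ^n` by transposing the
operator `g ↦ τ_α(η_α g)`: `∫ ⟨τ_α(η_α g)(y), ψ(y)⟩ dy = ⟪g, Ψ⟫` for all test
sections `g`. This determines `Ψ`. -/
def GoodTriv.IsTransposeAt {𝒜 : GoodAtlas n M A} (τ : GoodTriv 𝒜 V E) (μ : Measure M)
    (h : HermitianMetric n V E) (α : A) (ψ : Euc n → V) (Ψ : ∀ x, E x) : Prop :=
  IsTestSection n V Ψ ∧
  ∀ g : ∀ x, E x, IsTestSection n V g →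
    ∫ y, inner ℂ (ψ y) (τ.cutRep α g y) = h.pairing μ g Ψ

open Classical in
/-- The distribution `τ_α(η_α u)` on `ℝ^n`, for a distribution `u` on `M`, both considered as
functionals on test sections: the extension of `g ↦ τ_α(η_α g)` by duality. -/
def GoodTriv.cutRepDist {𝒜 : GoodAtlas n M A} (τ : GoodTriv 𝒜 V E) (μ : Measure M)
    (h : HermitianMetric n V E) (α : A) (u : (∀ x, E x) → ℂ) : (Euc n → V) → ℂ :=
  fun ψ => if hψ : ∃ Ψ, τ.IsTransposeAt μ h α ψ Ψ then u hψ.choose else 0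

/-- The mollifier `J_ε u = ∑_α τ_α^{-1} J_{ε_α} τ_α(η_α u)`, for a distribution `u`. -/
def GoodTriv.mollifyDist [FiniteDimensional ℂ V] {𝒜 : GoodAtlas n M A} (τ : GoodTriv 𝒜 V E)
    (φ : Kernel n) (μ : Measure M) (h : HermitianMetric n V E)
    (ε : Params A) (u : (∀ x, E x) → ℂ) : ∀ x, E x :=
  fun x => ∑ᶠ α,
    fromLocal (𝒜.chart α) (τ.triv α) (φ.mollifyDist (ε α) (τ.cutRepDist μ h α u)) x

/-- The commutator `[D, J_ε] f = D J_ε f - J_ε D f`, where `f` is a locally integrable section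
of `E`, so that `J_ε f` is smooth and `D f` is a distribution. -/
def commutator [FiniteDimensional ℂ W] {𝒜 : GoodAtlas n M A} (τE : GoodTriv 𝒜 V E)
    (τF : GoodTriv 𝒜 W F) (φ : Kernel n) (μ : Measure M) (hE : HermitianMetric n V E)
    (hF : HermitianMetric n W F) (D : FirstOrderOp n V E W F) (ε : Params A) (f : ∀ x, E x) :
    ∀ x, F x :=
  fun x => D.app (τE.mollify φ ε f) x - τF.mollifyDist φ μ hF ε (D.distApp μ hE hF f) x

end Mollifiers

end Friedrichs

end

noncomputable section

set_option linter.unusedSectionVars false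

namespace Friedrichs

/-! ### Integral operators on Euclidean space that are dominated by convolutions -/

section Young

variable {n : ℕ} {V W : Type*} [NormedAddCommGroup V] [NormedAddCommGroup W]

/-! Everything reduces to integral operators on `ℝ^n`. In a chart, `J_t` has the kernel `φ_t(x -
y)`. The commutator of `J_t` with `b + ∑_j a_j ∂_j` becomes, after integration by parts, an integral
operator whose kernel no longer differentiates its argument. A derivative that falls on `φ_t` costs
a factor `1/t`, but it is multiplied by `a_j(x) - a_j(y)`, which is `O(t)` where the kernel lives.
So both kernels are dominated by the rescalings `t^{-n} k((x - y)/t)` of one fixed function `k`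
(`ApproxKernel`), and Young's inequality gives bounds on `L^p` that are uniform in `t`. If the means
`∫ K_t(x, y) dy` also converge uniformly to a constant operator `m`, then `K_t g` tends to `m g`:
uniformly for continuous `g` of compact support, hence by density in `L^p` for `p < ∞`. Here `m` is
the identity for the mollifier and `0` for the commutator kernel, because the singular terms of the
latter form a divergence (`Kernel.integral_commKer`).

The cutoffs produce a second term in `Kernel.commutator_formula`, namely `J_t(σ_α f)` with `σ_α =
∑_j (∂_j η_α) a_j`, the symbol of `[D, η_α]`. It is bounded but does not vanish in the limit. The
limits over all charts add up to `∑_α [D, η_α] f`, which is zero because `∑_α η_α = 1`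
(`FirstOrderOp.finsum_symbol_eq_zero`).

The distribution `D f` and its mollification are defined through test sections that are chosen when
they exist. They do exist: a smooth compactly-supported family of linear forms in a chart is the
pairing with a test section, found by inverting the Gram endomorphism and the density
(`LocalFrame.exists_dual_section`). They are unique by `IsTestSection.eq_of_pairing`. This turns the
abstract duality into explicit integrals in charts.

Globally, all operators are locally finite sums over a countable atlas. For equicontinuity, the
chartwise constants are absorbed into one locally bounded multiplier
(`GoodAtlas.exists_dominating`). For limits, the parameters `ε_α` are independent of each other, so
each chart can be given its own share of a summable error budget (`GoodTriv.limsupZero_glue`).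

The upper bounds with constant exactly one come from convexity: a mollification is an average, so it
stays in a closed convex set that contains the nearby values (`Kernel.mollify_mem`). Moving the
seminorm from one fibre to a nearby one costs an arbitrarily small error, and the factors `η_α` add
up to one. For `D J_ε f`, the commutator is added; it tends to zero uniformly because `f` is
continuous. -/

lemma lintegral_comp_sub (k : Euc n → ℝ≥0∞) (x : Euc n) :
    ∫⁻ y, k (x - y) = ∫⁻ y, k y :=
  lintegral_sub_left_eq_self k x

/-- Hölder's inequality for the measure `k(x - y) dy`, of total mass `∫ k`, bounds the power
pointwise by a convolution of `k` with `‖u‖^q`; Tonelli's theorem then integrates it. Everything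
takes values in `[0, ∞]`, so no integrability is needed. -/
lemma lintegral_rpow_kernel_le {k : Euc n → ℝ≥0∞} (hk : Measurable k)
    {u : Euc n → V} (hu : AEStronglyMeasurable u volume) {q : ℝ} (hq : 1 ≤ q) :
    ∫⁻ x, (∫⁻ y, k (x - y) * ‖u y‖ₑ) ^ q ≤ (∫⁻ y, k y) ^ q * ∫⁻ y, ‖u y‖ₑ ^ q := by
  have hq0 : 0 < q := lt_of_lt_of_le one_pos hq
  have hm : ∀ x : Euc n, Measurable fun y => k (x - y) := fun x =>
    hk.comp (measurable_const.sub measurable_id)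
  have key : ∀ x : Euc n, (∫⁻ y, k (x - y) * ‖u y‖ₑ) ^ q ≤
      (∫⁻ y, k y) ^ (q - 1) * ∫⁻ y, k (x - y) * ‖u y‖ₑ ^ q := by
    intro x
    set ν : Measure (Euc n) := volume.withDensity (fun y => k (x - y)) with hν
    have huν : AEStronglyMeasurable u ν := hu.mono_ac (withDensity_absolutelyContinuous _ _)
    have h1 := eLpNorm'_le_eLpNorm'_mul_rpow_measure_univ one_pos hq huν
    have hu1 : ν univ = ∫⁻ y, k y := by
      rw [hν, withDensity_apply _ MeasurableSet.univ, Measure.restrict_univ, lintegral_comp_sub]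
    have e1 : eLpNorm' u 1 ν = ∫⁻ y, k (x - y) * ‖u y‖ₑ := by
      simp only [eLpNorm', ENNReal.rpow_one, div_one]
      rw [hν, lintegral_withDensity_eq_lintegral_mul₀ (hm x).aemeasurable hu.enorm]
      rfl
    have e2 : (eLpNorm' u q ν) ^ q = ∫⁻ y, k (x - y) * ‖u y‖ₑ ^ q := by
      simp only [eLpNorm']
      rw [← ENNReal.rpow_mul, one_div, inv_mul_cancel₀ hq0.ne', ENNReal.rpow_one, hν,
        lintegral_withDensity_eq_lintegral_mul₀ (hm x).aemeasurable (hu.enorm.pow_const q)]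
      rfl
    rw [← e1, ← e2]
    calc (eLpNorm' u 1 ν) ^ q ≤ (eLpNorm' u q ν * ν univ ^ (1 / 1 - 1 / q)) ^ q := by gcongr
      _ = _ := by
        rw [ENNReal.mul_rpow_of_nonneg _ _ hq0.le, ← ENNReal.rpow_mul, hu1, mul_comm]
        congr 2
        field_simp
  have hmeas : AEMeasurable (Function.uncurry fun x y : Euc n => k (x - y) * ‖u y‖ₑ ^ q)
      (volume.prod volume) := by
    refine AEMeasurable.mul ?_ ?_
    · exact (hk.comp (measurable_fst.sub measurable_snd)).aemeasurable
    · exact (hu.enorm.pow_const q).comp_quasiMeasurePreserving Measure.quasiMeasurePreserving_snd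
  have hmeas' : AEMeasurable (fun x : Euc n => ∫⁻ y, k (x - y) * ‖u y‖ₑ ^ q) volume :=
    hmeas.lintegral_prod_right'
  calc ∫⁻ x, (∫⁻ y, k (x - y) * ‖u y‖ₑ) ^ q
      ≤ ∫⁻ x, (∫⁻ y, k y) ^ (q - 1) * ∫⁻ y, k (x - y) * ‖u y‖ₑ ^ q := lintegral_mono key
    _ = (∫⁻ y, k y) ^ (q - 1) * ∫⁻ x, ∫⁻ y, k (x - y) * ‖u y‖ₑ ^ q := by
        rw [lintegral_const_mul'' _ hmeas']
    _ = (∫⁻ y, k y) ^ (q - 1) * ∫⁻ y, ∫⁻ x, k (x - y) * ‖u y‖ₑ ^ q := by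
        rw [lintegral_lintegral_swap hmeas]
    _ = (∫⁻ y, k y) ^ (q - 1) * ∫⁻ y, (∫⁻ x, k x) * ‖u y‖ₑ ^ q := by
        congr 1
        refine lintegral_congr fun y => ?_
        have hmy : Measurable fun x : Euc n => k (x - y) :=
          hk.comp (measurable_id.sub measurable_const)
        rw [lintegral_mul_const _ hmy, lintegral_sub_right_eq_self k y]
    _ = (∫⁻ y, k y) ^ q * ∫⁻ y, ‖u y‖ₑ ^ q := by
        rw [lintegral_const_mul'' _ (hu.enorm.pow_const q), ← mul_assoc]
        congr 1
        nth_rewrite 2 [← ENNReal.rpow_one (∫⁻ y, k y)]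
        rw [← ENNReal.rpow_add_of_nonneg _ _ (by linarith) zero_le_one]
        simp

/-- Young's inequality for a function that is dominated by a convolution with an integrable
kernel. -/
lemma eLpNorm_le_of_kernel {k : Euc n → ℝ≥0∞} (hk : Measurable k)
    {u : Euc n → V} (hu : AEStronglyMeasurable u volume) {v : Euc n → W}
    (hv : ∀ x, ‖v x‖ₑ ≤ ∫⁻ y, k (x - y) * ‖u y‖ₑ) {p : ℝ≥0∞} (hp : 1 ≤ p) :
    eLpNorm v p volume ≤ (∫⁻ y, k y) * eLpNorm u p volume := by
  have hp0 : p ≠ 0 := (zero_lt_one.trans_le hp).ne'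
  rcases eq_or_ne p ⊤ with rfl | hpt
  · rw [eLpNorm_exponent_top, eLpNorm_exponent_top]
    refine eLpNormEssSup_le_of_ae_enorm_bound (Eventually.of_forall fun x => (hv x).trans ?_)
    calc ∫⁻ y, k (x - y) * ‖u y‖ₑ ≤ ∫⁻ y, k (x - y) * eLpNormEssSup u volume := by
          refine lintegral_mono_ae ?_
          filter_upwards [enorm_ae_le_eLpNormEssSup u volume] with y hy
          gcongr
      _ = _ := by
          have hmx : Measurable fun y : Euc n => k (x - y) :=
            hk.comp (measurable_const.sub measurable_id)
          rw [lintegral_mul_const _ hmx, lintegral_comp_sub]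
  · have hq : 1 ≤ p.toReal := by
      rw [← ENNReal.toReal_one]; exact ENNReal.toReal_mono hpt hp
    have hq0 : 0 < p.toReal := lt_of_lt_of_le one_pos hq
    rw [eLpNorm_eq_lintegral_rpow_enorm_toReal hp0 hpt,
      eLpNorm_eq_lintegral_rpow_enorm_toReal hp0 hpt]
    calc (∫⁻ x, ‖v x‖ₑ ^ p.toReal) ^ (1 / p.toReal)
        ≤ ((∫⁻ y, k y) ^ p.toReal * ∫⁻ y, ‖u y‖ₑ ^ p.toReal) ^ (1 / p.toReal) := by
          gcongr
          refine le_trans (lintegral_mono fun x => ?_) (lintegral_rpow_kernel_le hk hu hq)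
          gcongr
          exact hv x
      _ = _ := by
          rw [ENNReal.mul_rpow_of_nonneg _ _ (by positivity), ← ENNReal.rpow_mul, one_div,
            mul_inv_cancel₀ hq0.ne', ENNReal.rpow_one]

end Young

/-! ### Kernels dominated by rescalings of a fixed function: uniform bounds and convergence. -/

section ApproxKernel

variable {n : ℕ} {V W : Type*} [NormedAddCommGroup V] [NormedSpace ℂ V]
  [NormedAddCommGroup W] [NormedSpace ℂ W]

/-- A family of operator-valued integral kernels on `ℝ^n` that is dominated by the rescalings of a
fixed function `k` supported in the unit ball, and whose means converge uniformly to `m`. -/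
structure ApproxKernel (K : ℝ → Euc n → Euc n → V →L[ℂ] W) (m : V →L[ℂ] W) (k : Euc n → ℝ) :
    Prop where
  cont : ∀ t ∈ Ioc (0 : ℝ) 1, Continuous (Function.uncurry (K t))
  k_cont : Continuous k
  k_nonneg : ∀ z, 0 ≤ k z
  k_supp : ∀ z, 1 < ‖z‖ → k z = 0
  bound : ∀ t ∈ Ioc (0 : ℝ) 1, ∀ x y, ‖K t x y‖ ≤ (t ^ n)⁻¹ * k (t⁻¹ • (x - y))
  mean : ∀ δ : ℝ, 0 < δ → ∃ t₀ : ℝ, 0 < t₀ ∧ ∀ t ∈ Ioc (0 : ℝ) 1, t ≤ t₀ → ∀ (x : Euc n) (w : V),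
    ‖(∫ y, K t x y w) - m w‖ ≤ δ * ‖w‖

/-- The integral operator with a given operator-valued kernel. -/
def kerOp (K : Euc n → Euc n → V →L[ℂ] W) (g : Euc n → V) (x : Euc n) : W :=
  ∫ y, K x y (g y)

namespace ApproxKernel

variable {K : ℝ → Euc n → Euc n → V →L[ℂ] W} {m : V →L[ℂ] W} {k : Euc n → ℝ}

lemma eq_zero (H : ApproxKernel K m k) {t : ℝ} (ht : t ∈ Ioc (0 : ℝ) 1) {x y : Euc n}
    (h : t < ‖x - y‖) : K t x y = 0 := by
  have h1 := H.bound t ht x y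
  rw [H.k_supp, mul_zero] at h1
  · exact norm_le_zero_iff.1 h1
  · rw [norm_smul, norm_inv, Real.norm_of_nonneg ht.1.le, ← div_eq_inv_mul, one_lt_div ht.1]
    exact h

lemma hasCompactSupport (H : ApproxKernel K m k) : HasCompactSupport k :=
  HasCompactSupport.intro (isCompact_closedBall (0 : Euc n) 1) fun z hz => H.k_supp z (by
    simpa using hz)

lemma integrable_k (H : ApproxKernel K m k) : Integrable k :=
  H.k_cont.integrable_of_hasCompactSupport H.hasCompactSupport

lemma integral_scaled (k : Euc n → ℝ) {t : ℝ} (ht : 0 < t) (x : Euc n) :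
    ∫ y, (t ^ n)⁻¹ * k (t⁻¹ • (x - y)) = ∫ y, k y := by
  rw [integral_sub_left_eq_self (fun y => (t ^ n)⁻¹ * k (t⁻¹ • y)) volume x, integral_const_mul,
    Measure.integral_comp_smul]
  simp only [finrank_euclideanSpace, Fintype.card_fin, smul_eq_mul]
  rw [abs_of_nonneg (by positivity), ← mul_assoc]
  rw [← inv_pow t⁻¹, inv_inv, inv_mul_cancel₀ (by positivity), one_mul]

lemma integrable_scaled (H : ApproxKernel K m k) {t : ℝ} (ht : 0 < t) (x : Euc n) :
    Integrable fun y => (t ^ n)⁻¹ * k (t⁻¹ • (x - y)) :=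
  (((H.integrable_k.comp_smul (inv_ne_zero ht.ne')).comp_sub_left x)).const_mul _

lemma lintegral_scaled (H : ApproxKernel K m k) {t : ℝ} (ht : 0 < t) :
    ∫⁻ y, ENNReal.ofReal ((t ^ n)⁻¹ * k (t⁻¹ • y)) = ENNReal.ofReal (∫ y, k y) := by
  rw [← integral_scaled k ht 0, ofReal_integral_eq_lintegral_ofReal (H.integrable_scaled ht 0)]
  · rw [← lintegral_sub_left_eq_self _ (0 : Euc n)]
  · exact Eventually.of_forall fun y => mul_nonneg (by positivity) (H.k_nonneg _)

lemma aestronglyMeasurable_apply (H : ApproxKernel K m k) {t : ℝ} (ht : t ∈ Ioc (0 : ℝ) 1)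
    {g : Euc n → V} (hg : AEStronglyMeasurable g volume) (x : Euc n) :
    AEStronglyMeasurable (fun y => K t x y (g y)) volume :=
  (ContinuousLinearMap.id ℂ (V →L[ℂ] W)).aestronglyMeasurable_comp₂
    ((H.cont t ht).comp (Continuous.prodMk_right x)).aestronglyMeasurable hg

lemma integrable_apply (H : ApproxKernel K m k) {t : ℝ} (ht : t ∈ Ioc (0 : ℝ) 1)
    {g : Euc n → V} (hg : LocallyIntegrable g volume) (x : Euc n) :
    Integrable fun y => K t x y (g y) := by
  have hsupp : Function.support (fun y => K t x y (g y)) ⊆ Metric.closedBall x 1 := by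
    intro y hy
    by_contra hy'
    refine hy ?_
    have : t < ‖x - y‖ := by
      rw [Metric.mem_closedBall, not_le, dist_eq_norm, norm_sub_rev] at hy'
      exact ht.2.trans_lt hy'
    simp [H.eq_zero ht this]
  rw [← integrableOn_iff_integrable_of_support_subset hsupp]
  obtain ⟨C, hC⟩ := (isCompact_closedBall (0 : Euc n) 1).exists_bound_of_continuousOn
    H.k_cont.continuousOn
  have hC' : ∀ z, k z ≤ max C 0 := fun z => by
    by_cases hz : ‖z‖ ≤ 1
    · exact (le_abs_self _).trans ((hC z (by simpa using hz)).trans (le_max_left _ _))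
    · rw [H.k_supp z (not_le.1 hz)]; exact le_max_right _ _
  have hgi := hg.integrableOn_isCompact (isCompact_closedBall x 1)
  refine Integrable.mono' (hgi.norm.const_mul ((t ^ n)⁻¹ * max C 0))
    (H.aestronglyMeasurable_apply ht hg.aestronglyMeasurable x).restrict
    (Eventually.of_forall fun y => ?_)
  refine ((K t x y).le_opNorm _).trans ?_
  gcongr
  refine (H.bound t ht x y).trans ?_
  have := ht.1
  gcongr
  exact hC' _

lemma aestronglyMeasurable_kerOp (H : ApproxKernel K m k) {t : ℝ} (ht : t ∈ Ioc (0 : ℝ) 1)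
    {g : Euc n → V} (hg : AEStronglyMeasurable g volume) :
    AEStronglyMeasurable (kerOp (K t) g) volume := by
  have : AEStronglyMeasurable (fun z : Euc n × Euc n => K t z.1 z.2 (g z.2))
      (volume.prod volume) :=
    (ContinuousLinearMap.id ℂ (V →L[ℂ] W)).aestronglyMeasurable_comp₂
      (H.cont t ht).aestronglyMeasurable
      (hg.comp_quasiMeasurePreserving Measure.quasiMeasurePreserving_snd)
  exact this.integral_prod_right'

/-- The bound does not depend on `t` because all rescalings of `k` have the same integral. -/
lemma eLpNorm_kerOp_le (H : ApproxKernel K m k) {t : ℝ} (ht : t ∈ Ioc (0 : ℝ) 1)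
    {g : Euc n → V} (hg : AEStronglyMeasurable g volume) {p : ℝ≥0∞} (hp : 1 ≤ p) :
    eLpNorm (kerOp (K t) g) p volume ≤ ENNReal.ofReal (∫ y, k y) * eLpNorm g p volume := by
  rw [← H.lintegral_scaled ht.1]
  refine eLpNorm_le_of_kernel ?_ hg (fun x => ?_) hp
  · have := H.k_cont
    exact (ENNReal.continuous_ofReal.comp (by fun_prop : Continuous fun y : Euc n =>
      (t ^ n)⁻¹ * k (t⁻¹ • y))).measurable
  · refine (enorm_integral_le_lintegral_enorm _).trans (lintegral_mono fun y => ?_)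
    rw [← ofReal_norm, ← ofReal_norm, ← ENNReal.ofReal_mul]
    · refine ENNReal.ofReal_le_ofReal (((K t x y).le_opNorm _).trans ?_)
      gcongr
      exact H.bound t ht x y
    · have := ht.1
      exact mul_nonneg (by positivity) (H.k_nonneg _)

lemma kerOp_eq_zero (H : ApproxKernel K m k) {t : ℝ} (ht : t ∈ Ioc (0 : ℝ) 1)
    {g : Euc n → V} {x : Euc n} (h : ∀ y, ‖x - y‖ ≤ t → g y = 0) : kerOp (K t) g x = 0 := by
  refine integral_eq_zero_of_ae (Eventually.of_forall fun y => ?_)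
  by_cases hy : ‖x - y‖ ≤ t
  · simp [h y hy]
  · simp [H.eq_zero ht (not_le.1 hy)]

lemma kerOp_sub (H : ApproxKernel K m k) {t : ℝ} (ht : t ∈ Ioc (0 : ℝ) 1)
    {g g' : Euc n → V} (hg : LocallyIntegrable g volume) (hg' : LocallyIntegrable g' volume)
    (x : Euc n) : kerOp (K t) (g - g') x = kerOp (K t) g x - kerOp (K t) g' x := by
  simp only [kerOp, Pi.sub_apply, map_sub]
  exact integral_sub (H.integrable_apply ht hg x) (H.integrable_apply ht hg' x)

/-- Split `K_t g - m g` at `x` into `∫ K_t(x, y)(g(y) - g(x)) dy`, which is small by uniform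
continuity of `g` and the mass of `k`, and the mean of the kernel applied to `g(x)`, which is small
by `mean` and boundedness of `g`. -/
lemma uniform_approx (H : ApproxKernel K m k) {g : Euc n → V} (hg : Continuous g)
    (hc : HasCompactSupport g) {δ : ℝ} (hδ : 0 < δ) :
    ∃ t₀ : ℝ, 0 < t₀ ∧ ∀ t ∈ Ioc (0 : ℝ) 1, t ≤ t₀ → ∀ x, ‖kerOp (K t) g x - m (g x)‖ ≤ δ := by
  obtain ⟨S, hS⟩ := hc.exists_bound_of_continuous hg
  have hS0 : 0 ≤ S := (norm_nonneg _).trans (hS 0)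
  set I := ∫ y, k y with hI
  have hI0 : 0 ≤ I := integral_nonneg H.k_nonneg
  -- The summands `1` here and in `S + 1` below guard against a vanishing mass `I` or bound `S`.
  have hω : 0 < δ / (2 * (I + 1)) := by positivity
  obtain ⟨r, hr, hr'⟩ := Metric.uniformContinuous_iff.1
    (hc.uniformContinuous_of_continuous hg) _ hω
  obtain ⟨t₁, ht₁, hmean⟩ := H.mean (δ / (2 * (S + 1))) (by positivity)
  refine ⟨min t₁ (r / 2), by positivity, fun t ht htt x => ?_⟩
  have hgx : Integrable fun y => K t x y (g x) :=
    H.integrable_apply ht (continuous_const (y := g x)).locallyIntegrable x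
  have hgy : Integrable fun y => K t x y (g y) := H.integrable_apply ht hg.locallyIntegrable x
  have h1 : ‖∫ y, K t x y (g y - g x)‖ ≤ δ / 2 := by
    have : ∀ y, ‖K t x y (g y - g x)‖ ≤
        (t ^ n)⁻¹ * k (t⁻¹ • (x - y)) * (δ / (2 * (I + 1))) := by
      intro y
      refine ((K t x y).le_opNorm _).trans ?_
      have h0 : 0 ≤ (t ^ n)⁻¹ * k (t⁻¹ • (x - y)) := (norm_nonneg _).trans (H.bound t ht x y)
      by_cases hxy : t < ‖x - y‖
      · rw [H.eq_zero ht hxy, norm_zero, zero_mul]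
        exact mul_nonneg h0 hω.le
      · have hd : dist y x < r := by
          rw [dist_eq_norm, norm_sub_rev]
          have := htt.trans (min_le_right _ _)
          linarith [not_lt.1 hxy]
        have h2 := (hr' hd).le
        rw [dist_eq_norm] at h2
        exact mul_le_mul (H.bound t ht x y) h2 (norm_nonneg _) h0
    refine (norm_integral_le_of_norm_le ((H.integrable_scaled ht.1 x).mul_const _)
      (Eventually.of_forall this)).trans ?_
    rw [integral_mul_const, integral_scaled k ht.1, ← hI]
    rw [mul_div_assoc', div_le_div_iff₀ (by positivity) (by positivity)]
    nlinarith
  have h2 : ‖(∫ y, K t x y (g x)) - m (g x)‖ ≤ δ / 2 := by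
    refine (hmean t ht (htt.trans (min_le_left _ _)) x (g x)).trans ?_
    calc δ / (2 * (S + 1)) * ‖g x‖ ≤ δ / (2 * (S + 1)) * S := by gcongr; exact hS x
      _ ≤ δ / 2 := by
        rw [div_mul_eq_mul_div, div_le_div_iff₀ (by positivity) (by positivity)]
        nlinarith
  have h3 : kerOp (K t) g x - m (g x) =
      (∫ y, K t x y (g y - g x)) + ((∫ y, K t x y (g x)) - m (g x)) := by
    simp only [kerOp, map_sub]
    rw [integral_sub hgy hgx]
    abel
  rw [h3]
  refine (norm_add_le _ _).trans ?_
  linarith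

/-- For `t ≤ 1` the difference is supported in the closed 1-neighbourhood of the support of `g`; its
measure is finite, so uniform smallness gives smallness in every `L^p`. -/
lemma eLpNorm_approx_of_continuous (H : ApproxKernel K m k) {g : Euc n → V} (hg : Continuous g)
    (hc : HasCompactSupport g) (p : ℝ≥0∞) {δ : ℝ≥0∞} (hδ : δ ≠ 0) :
    ∃ t₀ : ℝ, 0 < t₀ ∧ ∀ t ∈ Ioc (0 : ℝ) 1, t ≤ t₀ →
      eLpNorm (fun x => kerOp (K t) g x - m (g x)) p volume ≤ δ := by
  set S := Metric.cthickening 1 (tsupport g) with hS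
  have hSc : IsCompact S := IsCompact.cthickening hc
  -- For `p = ⊤` the exponent is `1 / 0 = 0` and the factor is `1`, so the estimate below covers
  -- this case too.
  have hSm : volume S ^ (1 / p.toReal) ≠ ⊤ := by
    have := hSc.measure_lt_top (μ := volume)
    finiteness
  obtain ⟨s, hs, hs'⟩ := ENNReal.exists_nnreal_pos_mul_lt hSm hδ
  obtain ⟨t₀, ht₀, h⟩ := H.uniform_approx hg hc (δ := s) hs
  refine ⟨t₀, ht₀, fun t ht htt => ?_⟩
  calc eLpNorm (fun x => kerOp (K t) g x - m (g x)) p volume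
      ≤ eLpNorm (S.indicator fun _ => (s : ℝ)) p volume := by
        refine eLpNorm_mono fun x => ?_
        by_cases hx : x ∈ S
        · rw [indicator_of_mem hx, Real.norm_of_nonneg s.coe_nonneg]
          exact h t ht htt x
        · have hgx : ∀ y, ‖x - y‖ ≤ t → g y = 0 := by
            intro y hy
            by_contra hgy
            refine hx (Metric.mem_cthickening_of_dist_le x y 1 _
              (subset_tsupport g hgy) ?_)
            rw [dist_eq_norm]
            exact hy.trans ht.2
          rw [H.kerOp_eq_zero ht hgx, hgx x (by simpa using ht.1.le)]
          simp
    _ ≤ ‖(s : ℝ)‖ₑ * volume S ^ (1 / p.toReal) := eLpNorm_indicator_const_le _ _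
    _ ≤ δ := by
        rw [show ‖(s : ℝ)‖ₑ = (s : ℝ≥0∞) by simp]
        exact hs'.le

/-- Continuous functions of compact support are dense in `L^p` for `p < ∞`, and the operators `K_t`
and `m` are bounded uniformly in `t`, with total constant `C`. -/
lemma eLpNorm_approx (H : ApproxKernel K m k) {p : ℝ≥0∞} (hp : 1 ≤ p) (hpt : p ≠ ⊤)
    {g : Euc n → V} (hg : MemLp g p volume) {δ : ℝ≥0∞} (hδ : δ ≠ 0) :
    ∃ t₀ : ℝ, 0 < t₀ ∧ ∀ t ∈ Ioc (0 : ℝ) 1, t ≤ t₀ →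
      eLpNorm (fun x => kerOp (K t) g x - m (g x)) p volume ≤ δ := by
  set C : ℝ≥0∞ := ENNReal.ofReal (∫ y, k y) + ‖m‖ₑ with hC
  have hCt : C ≠ ⊤ := by finiteness
  obtain ⟨s, hs, hs'⟩ := ENNReal.exists_nnreal_pos_mul_lt hCt (ENNReal.half_pos hδ).ne'
  obtain ⟨g', hc', hgg', hg'c, hg'⟩ := hg.exists_hasCompactSupport_eLpNorm_sub_le hpt
    (ε := (s : ℝ≥0∞)) (by exact_mod_cast hs.ne')
  obtain ⟨t₀, ht₀, h⟩ := H.eLpNorm_approx_of_continuous hg'c hc' p (ENNReal.half_pos hδ).ne'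
  refine ⟨t₀, ht₀, fun t ht htt => ?_⟩
  have hd := hg.sub hg'
  have e1 : (fun x => kerOp (K t) g x - m (g x)) =
      kerOp (K t) (g - g') + ((fun x => kerOp (K t) g' x - m (g' x)) +
        fun x => -m ((g - g') x)) := by
    ext x
    simp only [Pi.add_apply]
    rw [H.kerOp_sub ht (hg.locallyIntegrable hp) (hg'.locallyIntegrable hp)]
    simp only [Pi.sub_apply, map_sub]
    abel
  have m1 := H.aestronglyMeasurable_kerOp ht hd.aestronglyMeasurable
  have m2 := (H.aestronglyMeasurable_kerOp ht hg'.aestronglyMeasurable).sub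
    (m.continuous.comp_aestronglyMeasurable hg'.aestronglyMeasurable)
  have m3 : AEStronglyMeasurable (fun x => -m ((g - g') x)) volume :=
    (m.continuous.comp_aestronglyMeasurable hd.aestronglyMeasurable).neg
  rw [e1]
  calc _ ≤ eLpNorm (kerOp (K t) (g - g')) p volume +
        (eLpNorm (fun x => kerOp (K t) g' x - m (g' x)) p volume +
          eLpNorm (fun x => -m ((g - g') x)) p volume) :=
        (eLpNorm_add_le m1 (m2.add m3) hp).trans (by gcongr; exact eLpNorm_add_le m2 m3 hp)
    _ ≤ ENNReal.ofReal (∫ y, k y) * s + (δ / 2 + ‖m‖ₑ * s) := by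
        gcongr
        · exact (H.eLpNorm_kerOp_le ht hd.aestronglyMeasurable hp).trans (by gcongr)
        · exact h t ht htt
        · refine (eLpNorm_le_mul_eLpNorm_of_ae_le_mul'' (c := ‖m‖ₑ) (g := g - g') p
            hd.aestronglyMeasurable (Eventually.of_forall fun x => ?_)).trans (by gcongr)
          rw [enorm_neg]
          exact m.le_opENorm _
    _ = C * s + δ / 2 := by rw [hC]; ring
    _ ≤ δ := by
        rw [mul_comm C]
        calc _ ≤ δ / 2 + δ / 2 := by gcongr
          _ = δ := ENNReal.add_halves δ

end ApproxKernel

end ApproxKernel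

/-- The partial derivative in the `j`-th coordinate direction. -/
def pd {n : ℕ} {X : Type*} [NormedAddCommGroup X] [NormedSpace ℝ X] (j : Fin n) (f : Euc n → X)
    (x : Euc n) : X :=
  fderiv ℝ f x (EuclideanSpace.single j 1)

/-! ### Real calculus for functions with values in complex linear maps. -/

section ComplexCLM

variable {G V W : Type*} [NormedAddCommGroup G] [NormedSpace ℝ G]
  [NormedAddCommGroup V] [NormedSpace ℂ V] [NormedAddCommGroup W] [NormedSpace ℂ W]

/-- Smoothness is over `ℝ` while the operators are `ℂ`-linear; restriction of scalars is a
continuous real linear map, so the real calculus of evaluation applies after composing with it. -/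
lemma contDiffAt_complexCLM_apply {A : G → V →L[ℂ] W} {w : G → V} {x : G}
    (hA : ContDiffAt ℝ ∞ A x) (hw : ContDiffAt ℝ ∞ w x) :
    ContDiffAt ℝ ∞ (fun x => A x (w x)) x :=
  ((ContinuousLinearMap.restrictScalarsL ℂ V W ℝ ℝ).contDiff.contDiffAt.comp x hA).clm_apply hw

lemma contDiff_complexCLM_apply {A : G → V →L[ℂ] W} {w : G → V}
    (hA : ContDiff ℝ ∞ A) (hw : ContDiff ℝ ∞ w) : ContDiff ℝ ∞ (fun x => A x (w x)) :=
  contDiff_iff_contDiffAt.2 fun _ => contDiffAt_complexCLM_apply hA.contDiffAt hw.contDiffAt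

lemma fderiv_complexCLM_apply {A : G → V →L[ℂ] W} {w : G → V} {x : G}
    {A' : G →L[ℝ] V →L[ℂ] W} {w' : G →L[ℝ] V} (hA : HasFDerivAt A A' x) (hw : HasFDerivAt w w' x)
    (v : G) : fderiv ℝ (fun x => A x (w x)) x v = A x (w' v) + A' v (w x) := by
  have h := ((ContinuousLinearMap.restrictScalarsL ℂ V W ℝ ℝ).hasFDerivAt.comp x hA).clm_apply hw
  have h' : HasFDerivAt (fun x => A x (w x)) _ x := h
  rw [h'.fderiv]
  simp

end ComplexCLM

/-! ### Partial derivatives. -/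

section PartialDerivatives

variable {n : ℕ} {X Y : Type*} [NormedAddCommGroup X] [NormedSpace ℝ X]
  [NormedAddCommGroup Y] [NormedSpace ℝ Y]

lemma contDiff_pd {f : Euc n → X} (hf : ContDiff ℝ ∞ f) (j : Fin n) : ContDiff ℝ ∞ (pd j f) :=
  (hf.fderiv_right (m := ∞) (by simp)).clm_apply contDiff_const

lemma hasCompactSupport_pd {f : Euc n → X} (hf : HasCompactSupport f) (j : Fin n) :
    HasCompactSupport (pd j f) :=
  hf.fderiv_apply ℝ _

lemma pd_eq_zero {f : Euc n → X} {x : Euc n} (hx : x ∉ tsupport f) (j : Fin n) :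
    pd j f x = 0 := by
  have := notMem_tsupport_iff_eventuallyEq.1 hx
  rw [pd, this.fderiv_eq]
  simp

lemma pd_comp_sub {f : Euc n → X} (hf : Differentiable ℝ f) (j : Fin n) (x y : Euc n) :
    pd j (fun z => f (x - z)) y = -pd j f (x - y) := by
  have h : HasFDerivAt (fun z => f (x - z)) _ y :=
    (hf (x - y)).hasFDerivAt.comp y ((hasFDerivAt_id y).const_sub x)
  rw [pd, h.fderiv]
  simp [pd]

end PartialDerivatives

/-! ### The kernels of the mollifier and of its commutator with a differential operator. -/

namespace Kernel

variable {n : ℕ} (φ : Kernel n)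

lemma eq_zero {z : Euc n} (hz : 1 < ‖z‖) : φ.toFun z = 0 := by
  by_contra h
  have := φ.tsupport_subset (subset_tsupport _ h)
  rw [mem_closedBall_zero_iff] at this
  linarith

lemma contDiff_scaled (t : ℝ) : ContDiff ℝ ∞ (φ.scaled t) := by
  have := φ.smooth
  unfold scaled
  fun_prop

lemma scaled_eq_zero {t : ℝ} (ht : 0 < t) {z : Euc n} (hz : t < ‖z‖) : φ.scaled t z = 0 := by
  rw [scaled, φ.eq_zero, mul_zero]
  rw [norm_smul, norm_inv, Real.norm_of_nonneg ht.le, ← div_eq_inv_mul, one_lt_div ht]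
  exact hz

lemma hasCompactSupport_scaled {t : ℝ} (ht : 0 < t) : HasCompactSupport (φ.scaled t) :=
  HasCompactSupport.intro (isCompact_closedBall (0 : Euc n) t) fun z hz =>
    φ.scaled_eq_zero ht (by simpa using hz)

lemma scaled_nonneg {t : ℝ} (ht : 0 < t) (z : Euc n) : 0 ≤ φ.scaled t z :=
  mul_nonneg (by positivity) (φ.nonneg _)

lemma integral_scaled_sub {t : ℝ} (ht : 0 < t) (x : Euc n) : ∫ y, φ.scaled t (x - y) = 1 := by
  rw [← φ.integral_eq_one]
  exact ApproxKernel.integral_scaled φ.toFun ht x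

lemma pd_scaled (t : ℝ) (j : Fin n) (z : Euc n) :
    pd j (φ.scaled t) z = (t ^ n)⁻¹ * (t⁻¹ * pd j φ.toFun (t⁻¹ • z)) := by
  have h1 : DifferentiableAt ℝ φ.toFun (t⁻¹ • z) := φ.smooth.differentiable (by simp) _
  have h2 : HasFDerivAt (fun z : Euc n => t⁻¹ • z) (t⁻¹ • ContinuousLinearMap.id ℝ (Euc n)) z :=
    (hasFDerivAt_id z).const_smul t⁻¹
  have h3 := (h1.hasFDerivAt.comp z h2).const_mul ((t ^ n)⁻¹)
  have h4 : HasFDerivAt (φ.scaled t) _ z := h3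
  rw [pd, h4.fderiv]
  simp [pd]

lemma pd_eq_zero {z : Euc n} (hz : 1 < ‖z‖) (j : Fin n) : pd j φ.toFun z = 0 := by
  refine Friedrichs.pd_eq_zero (fun h => ?_) j
  have := φ.tsupport_subset h
  rw [mem_closedBall_zero_iff] at this
  linarith

variable {V W : Type*} [NormedAddCommGroup V] [NormedSpace ℂ V]
  [NormedAddCommGroup W] [NormedSpace ℂ W]

/-- The kernel of the mollifier `J_t`. -/
def mollKer (V : Type*) [NormedAddCommGroup V] [NormedSpace ℂ V] (t : ℝ) (x y : Euc n) :
    V →L[ℂ] V :=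
  φ.scaled t (x - y) • ContinuousLinearMap.id ℂ V

lemma mollify_eq_kerOp (t : ℝ) (g : Euc n → V) : φ.mollify t g = kerOp (φ.mollKer V t) g := by
  ext x
  simp [mollify, kerOp, mollKer]

lemma approxKernel_mollKer [CompleteSpace V] :
    ApproxKernel (φ.mollKer V) (ContinuousLinearMap.id ℂ V) φ.toFun where
  cont t _ := by
    have := (φ.contDiff_scaled t).continuous
    unfold mollKer
    fun_prop
  k_cont := φ.smooth.continuous
  k_nonneg := φ.nonneg
  k_supp _ := φ.eq_zero
  bound t ht x y := by
    rw [mollKer, norm_smul, Real.norm_of_nonneg (φ.scaled_nonneg ht.1 _)]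
    exact mul_le_of_le_one_right (φ.scaled_nonneg ht.1 _) ContinuousLinearMap.norm_id_le
  mean δ hδ := by
    refine ⟨1, one_pos, fun t ht _ x w => ?_⟩
    have : (∫ y, φ.mollKer V t x y w) = w := by
      simp only [mollKer, _root_.smul_apply, ContinuousLinearMap.id_apply]
      rw [integral_smul_const, φ.integral_scaled_sub ht.1, one_smul]
    rw [this]
    simp only [ContinuousLinearMap.id_apply, sub_self, norm_zero]
    positivity

/-- The kernel of the commutator of `J_t` with the operator `b + ∑_j a_j ∂_j`, after integration
by parts. -/
def commKer (a : Fin n → Euc n → V →L[ℂ] W) (b : Euc n → V →L[ℂ] W) (t : ℝ) (x y : Euc n) :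
    V →L[ℂ] W :=
  φ.scaled t (x - y) • (b x - b y + ∑ j, pd j (a j) y) +
    ∑ j, pd j (φ.scaled t) (x - y) • (a j x - a j y)

/-- With `κ(y) = φ_t(x - y)`, the terms containing `a_j` add up to `∂_j (κ (a_j - a_j(x)))`, since
`∂_j κ(y) = -(∂_j φ_t)(x - y)`. They integrate to zero, and only the harmless difference of `b`
survives. -/
lemma integral_commKer (a : Fin n → Euc n → V →L[ℂ] W) (b : Euc n → V →L[ℂ] W)
    (ha : ∀ j, ContDiff ℝ ∞ (a j)) (hb : Continuous b) {t : ℝ} (ht : 0 < t) (x : Euc n) (w : V) :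
    ∫ y, φ.commKer a b t x y w = ∫ y, φ.scaled t (x - y) • (b x - b y) w := by
  set κ : Euc n → ℝ := fun y => φ.scaled t (x - y) with hκ
  have hκs : ContDiff ℝ ∞ κ := (φ.contDiff_scaled t).comp (contDiff_const.sub contDiff_id)
  have hκc : HasCompactSupport κ :=
    (φ.hasCompactSupport_scaled ht).comp_homeomorph (Homeomorph.subLeft x)
  have hg : ∀ j, ContDiff ℝ ∞ fun y => (a j y - a j x) w := fun j =>
    contDiff_complexCLM_apply ((ha j).sub contDiff_const) contDiff_const
  have hpd : ∀ j y, pd j (fun y => (a j y - a j x) w) y = pd j (a j) y w := by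
    intro j y
    have h1 : HasFDerivAt (a j) (fderiv ℝ (a j) y) y :=
      ((ha j).differentiable (by simp) y).hasFDerivAt
    rw [pd, fderiv_complexCLM_apply (h1.sub_const (a j x)) (hasFDerivAt_const w y)]
    simp [pd]
  have hpκ : ∀ j y, pd j κ y = -pd j (φ.scaled t) (x - y) := fun j y =>
    pd_comp_sub ((φ.contDiff_scaled t).differentiable (by simp)) j x y
  have int1 : ∀ j, Integrable fun y => κ y • pd j (a j) y w := by
    intro j
    have h1 := hκs.continuous
    have h2 := (contDiff_pd (ha j) j).continuous
    exact (by fun_prop : Continuous fun y => κ y • pd j (a j) y w).integrable_of_hasCompactSupport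
      hκc.smul_right
  have int2 : ∀ j, Integrable fun y => pd j κ y • (a j y - a j x) w := by
    intro j
    exact ((contDiff_pd hκs j).continuous.smul (hg j).continuous).integrable_of_hasCompactSupport
      (hasCompactSupport_pd hκc j).smul_right
  have int3 : Integrable fun y => κ y • (b x - b y) w := by
    have h1 := hκs.continuous
    exact (by fun_prop : Continuous fun y => κ y • (b x - b y) w).integrable_of_hasCompactSupport
      hκc.smul_right
  have ibp : ∀ j, ∫ y, κ y • pd j (a j) y w = -∫ y, pd j κ y • (a j y - a j x) w := by
    intro j
    simp_rw [← hpd j]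
    refine integral_smul_fderiv_eq_neg_fderiv_smul_of_integrable (𝕜 := ℝ) (int2 j) ?_ ?_
      (fun y _ => hκs.differentiable (by simp) y) (fun y _ => (hg j).differentiable (by simp) y)
    · have := int1 j
      simp_rw [← hpd j] at this
      exact this
    · exact (hκs.continuous.smul (hg j).continuous).integrable_of_hasCompactSupport hκc.smul_right
  have e : ∀ y, φ.commKer a b t x y w = κ y • (b x - b y) w +
      ((∑ j, κ y • pd j (a j) y w) + ∑ j, pd j κ y • (a j y - a j x) w) := by
    intro y
    simp only [commKer, _root_.add_apply, _root_.smul_apply,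
      _root_.sum_apply, smul_add, Finset.smul_sum, hpκ]
    rw [add_assoc]
    congr 2
    refine Finset.sum_congr rfl fun j _ => ?_
    rw [neg_smul, ← smul_neg]
    simp
  simp_rw [e]
  have int1' := integrable_finsetSum Finset.univ fun j _ => int1 j
  have int2' := integrable_finsetSum Finset.univ fun j _ => int2 j
  have s1 := integral_add (f := fun y => κ y • (b x - b y) w) int3 (int1'.add int2')
  have s2 := integral_add int1' int2'
  simp only [Pi.add_apply] at s1
  rw [s1, s2, integral_finsetSum _ fun j _ => int1 j, integral_finsetSum _ fun j _ => int2 j,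
    ← Finset.sum_add_distrib]
  rw [Finset.sum_eq_zero fun j _ => by rw [ibp j, neg_add_cancel], add_zero]

/-- The factor `1/t` from differentiating `φ_t` is compensated by the Lipschitz bound on `a_j` over
distances at most `t`. The mean tends to zero because after `integral_commKer` it is an average of
`b(x) - b(y)`. Compact supports provide global Lipschitz constants. -/
lemma exists_approxKernel_commKer (a : Fin n → Euc n → V →L[ℂ] W) (b : Euc n → V →L[ℂ] W)
    (ha : ∀ j, ContDiff ℝ ∞ (a j)) (hac : ∀ j, HasCompactSupport (a j))
    (hb : ContDiff ℝ ∞ b) (hbc : HasCompactSupport b) :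
    ∃ k, ApproxKernel (φ.commKer a b) 0 k := by
  obtain ⟨Lb, hLb⟩ := ContDiff.lipschitzWith_of_hasCompactSupport hbc hb (by simp)
  choose La hLa using fun j => ContDiff.lipschitzWith_of_hasCompactSupport (hac j) (ha j) (by simp)
  have hsc : Continuous fun y => ∑ j, pd j (a j) y :=
    continuous_finsetSum _ fun j _ => (contDiff_pd (ha j) j).continuous
  have hss : HasCompactSupport fun y => ∑ j, pd j (a j) y := by
    refine HasCompactSupport.intro (isCompact_iUnion fun j => hac j) fun y hy => ?_
    refine Finset.sum_eq_zero fun j _ => Friedrichs.pd_eq_zero (fun h => hy ?_) j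
    exact mem_iUnion.2 ⟨j, h⟩
  obtain ⟨B, hB⟩ := hss.exists_bound_of_continuous hsc
  have hB0 : 0 ≤ B := (norm_nonneg _).trans (hB 0)
  -- `Lb` bounds `b(x) - b(y)` since `‖x - y‖ ≤ t ≤ 1`, `B` bounds `∑_j ∂_j a_j`, and `La j` is what
  -- remains of `t⁻¹ * (La j * t)`.
  refine ⟨fun z => φ.toFun z * (Lb + B) + ∑ j, |pd j φ.toFun z| * La j, ⟨?_, ?_, ?_, ?_, ?_, ?_⟩⟩
  · intro t ht
    have h1 := (φ.contDiff_scaled t).continuous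
    have h2 := hb.continuous
    have h3 := fun j => (ha j).continuous
    have h4 := fun j => (contDiff_pd (φ.contDiff_scaled t) j).continuous
    have h5 := fun j => (contDiff_pd (ha j) j).continuous
    unfold commKer
    fun_prop
  · have h1 := φ.smooth.continuous
    have h2 := fun j => (contDiff_pd φ.smooth j).continuous
    fun_prop
  · intro z
    have := φ.nonneg z
    positivity
  · intro z hz
    simp [φ.eq_zero hz, φ.pd_eq_zero hz]
  · intro t ht x y
    have ht0 := ht.1
    by_cases hxy : t < ‖x - y‖
    · have h1 : 1 < ‖t⁻¹ • (x - y)‖ := by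
        rw [norm_smul, norm_inv, Real.norm_of_nonneg ht0.le, ← div_eq_inv_mul, one_lt_div ht0]
        exact hxy
      simp [commKer, φ.scaled_eq_zero ht0 hxy, φ.pd_scaled, φ.pd_eq_zero h1, φ.eq_zero h1]
    · have hxy' := not_lt.1 hxy
      have hL1 : ‖b x - b y‖ ≤ Lb := by
        refine (hLb.norm_sub_le x y).trans (mul_le_of_le_one_right Lb.coe_nonneg ?_)
        exact hxy'.trans ht.2
      have hL2 : ∀ j, ‖a j x - a j y‖ ≤ La j * t := fun j =>
        ((hLa j).norm_sub_le x y).trans (by gcongr)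
      calc ‖φ.commKer a b t x y‖
          ≤ φ.scaled t (x - y) * (Lb + B) + ∑ j, |pd j (φ.scaled t) (x - y)| * (La j * t) := by
            refine (norm_add_le _ _).trans (add_le_add ?_ ((norm_sum_le _ _).trans ?_))
            · rw [norm_smul, Real.norm_of_nonneg (φ.scaled_nonneg ht0 _)]
              have := φ.scaled_nonneg ht0 (x - y)
              gcongr
              exact (norm_add_le _ _).trans (add_le_add hL1 (hB y))
            · refine Finset.sum_le_sum fun j _ => ?_
              rw [norm_smul, Real.norm_eq_abs]
              gcongr
              exact hL2 j
        _ = _ := by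
            rw [mul_add ((t ^ n)⁻¹), Finset.mul_sum]
            congr 1
            · rw [scaled]; ring
            · refine Finset.sum_congr rfl fun j _ => ?_
              rw [pd_scaled, abs_mul, abs_mul, abs_of_pos (by positivity : 0 < (t ^ n)⁻¹),
                abs_of_pos (by positivity : 0 < t⁻¹)]
              field_simp
  · intro δ hδ
    -- This threshold makes `Lb * t ≤ δ`; the summand `1` allows `Lb = 0`.
    refine ⟨δ / (Lb + 1), by positivity, fun t ht htt x w => ?_⟩
    rw [φ.integral_commKer a b ha hb.continuous ht.1]
    simp only [_root_.zero_apply, sub_zero]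
    have hint : Integrable fun y => φ.scaled t (x - y) * (δ * ‖w‖) := by
      have h1 := (φ.contDiff_scaled t).continuous
      exact Continuous.integrable_of_hasCompactSupport (by fun_prop)
        (((φ.hasCompactSupport_scaled ht.1).comp_homeomorph (Homeomorph.subLeft x)).mul_right)
    refine (norm_integral_le_of_norm_le hint (Eventually.of_forall fun y => ?_)).trans_eq ?_
    · by_cases hxy : t < ‖x - y‖
      · simp [φ.scaled_eq_zero ht.1 hxy]
      · rw [norm_smul, Real.norm_of_nonneg (φ.scaled_nonneg ht.1 _)]
        have := φ.scaled_nonneg ht.1 (x - y)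
        gcongr
        refine ((b x - b y).le_opNorm w).trans ?_
        gcongr
        refine (hLb.norm_sub_le x y).trans ?_
        rw [le_div_iff₀ (by positivity)] at htt
        have h1 := not_lt.1 hxy
        have h2 : (0 : ℝ) ≤ Lb := Lb.coe_nonneg
        nlinarith [ht.1]
    · rw [integral_mul_const, φ.integral_scaled_sub ht.1, one_mul]

end Kernel

/-! ### Smoothness and derivatives of mollified functions. -/

namespace Kernel

variable {n : ℕ} (φ : Kernel n) {V W : Type*} [NormedAddCommGroup V] [NormedSpace ℂ V]
  [NormedAddCommGroup W] [NormedSpace ℂ W]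

/-- The smooth kernel is placed as the right-hand factor, so that smoothness and derivatives of the
convolution come from it and `g` need only be locally integrable. -/
lemma mollify_eq_convolution (t : ℝ) (g : Euc n → V) :
    φ.mollify t g = convolution g (φ.scaled t) (ContinuousLinearMap.lsmul ℝ ℝ).flip volume := by
  ext x
  simp [mollify, convolution]

lemma contDiff_mollify {t : ℝ} (ht : 0 < t) {g : Euc n → V} (hg : LocallyIntegrable g volume) :
    ContDiff ℝ ∞ (φ.mollify t g) := by
  rw [mollify_eq_convolution]
  exact (φ.hasCompactSupport_scaled ht).contDiff_convolution_right _ hg (φ.contDiff_scaled t)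

lemma pd_mollify {t : ℝ} (ht : 0 < t) {g : Euc n → V} (hg : LocallyIntegrable g volume)
    (j : Fin n) (x : Euc n) :
    pd j (φ.mollify t g) x = ∫ y, pd j (φ.scaled t) (x - y) • g y := by
  have h := (φ.hasCompactSupport_scaled ht).hasFDerivAt_convolution_right
    (ContinuousLinearMap.lsmul ℝ ℝ).flip hg ((φ.contDiff_scaled t).of_le (by simp)) x
  rw [pd, mollify_eq_convolution, h.fderiv, convolution_precompR_apply]
  · simp [convolution, pd]
  · exact hg
  · exact (φ.hasCompactSupport_scaled ht).fderiv ℝ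
  · exact (φ.contDiff_scaled t).continuous_fderiv (by simp)

lemma mollify_eq_zero {t : ℝ} (ht : t ∈ Ioc (0 : ℝ) 1) {g : Euc n → V} {x : Euc n}
    (h : ∀ y, ‖x - y‖ ≤ t → g y = 0) : φ.mollify t g x = 0 := by
  refine integral_eq_zero_of_ae (Eventually.of_forall fun y => ?_)
  by_cases hy : ‖x - y‖ ≤ t
  · simp [h y hy]
  · simp [φ.scaled_eq_zero ht.1 (not_le.1 hy)]

end Kernel

/-! ### Integration by parts and the commutator formula in a chart. -/

section Transpose

variable {n : ℕ} {V W : Type*} [NormedAddCommGroup V] [NormedSpace ℂ V]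
  [NormedAddCommGroup W] [NormedSpace ℂ W]

/-- The function `θ b - ∑_j ∂_j(θ a_j)`, which gives the action of the distribution
`b v + ∑_j a_j ∂_j v` on `θ`. -/
def transposeCoeff (a : Fin n → Euc n → V →L[ℂ] W) (b : Euc n → V →L[ℂ] W) (θ : Euc n → ℝ)
    (y : Euc n) : V →L[ℂ] W :=
  θ y • b y - ∑ j, pd j (fun y => θ y • a j y) y

variable {a : Fin n → Euc n → V →L[ℂ] W} {b : Euc n → V →L[ℂ] W} {θ : Euc n → ℝ}

lemma contDiff_transposeCoeff (ha : ∀ j, ContDiff ℝ ∞ (a j)) (hb : ContDiff ℝ ∞ b)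
    (hθ : ContDiff ℝ ∞ θ) : ContDiff ℝ ∞ (transposeCoeff a b θ) :=
  (hθ.smul hb).sub (ContDiff.sum fun j _ => contDiff_pd (hθ.smul (ha j)) j)

lemma transposeCoeff_eq_zero {y : Euc n} (hy : y ∉ tsupport θ) : transposeCoeff a b θ y = 0 := by
  rw [transposeCoeff, image_eq_zero_of_notMem_tsupport hy, zero_smul, zero_sub, neg_eq_zero]
  exact Finset.sum_eq_zero fun j _ =>
    pd_eq_zero (fun h => hy (tsupport_smul_subset_left θ (a j) h)) j

lemma hasCompactSupport_transposeCoeff (hθc : HasCompactSupport θ) :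
    HasCompactSupport (transposeCoeff a b θ) :=
  HasCompactSupport.intro hθc fun _ hy => transposeCoeff_eq_zero hy

lemma pd_smul {X : Type*} [NormedAddCommGroup X] [NormedSpace ℝ X] {f : Euc n → X} {y : Euc n}
    (hθ : DifferentiableAt ℝ θ y) (hf : DifferentiableAt ℝ f y) (j : Fin n) :
    pd j (fun y => θ y • f y) y = θ y • pd j f y + pd j θ y • f y := by
  have h : HasFDerivAt (fun y => θ y • f y) _ y := hθ.hasFDerivAt.smul hf.hasFDerivAt
  rw [pd, h.fderiv]
  simp [pd]

/-- Integration by parts. -/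
lemma integral_transposeCoeff (ha : ∀ j, ContDiff ℝ ∞ (a j)) (hb : ContDiff ℝ ∞ b)
    (hθ : ContDiff ℝ ∞ θ) (hθc : HasCompactSupport θ) {w : Euc n → V} (hw : ContDiff ℝ ∞ w) :
    ∫ y, transposeCoeff a b θ y (w y) = ∫ y, θ y • (b y (w y) + ∑ j, a j y (pd j w y)) := by
  have hf : ∀ j, ContDiff ℝ ∞ fun y => θ y • a j y := fun j => hθ.smul (ha j)
  have hfc : ∀ j, HasCompactSupport fun y => θ y • a j y := fun j => hθc.smul_right
  let B : (V →L[ℂ] W) →L[ℝ] V →L[ℝ] W := ContinuousLinearMap.restrictScalarsL ℂ V W ℝ ℝ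
  have happ : ∀ {A : Euc n → V →L[ℂ] W} {u : Euc n → V}, ContDiff ℝ ∞ A → ContDiff ℝ ∞ u →
      HasCompactSupport A → Integrable fun y => A y (u y) := by
    intro A u hA hu hAc
    refine (contDiff_complexCLM_apply hA hu).continuous.integrable_of_hasCompactSupport ?_
    exact hAc.mono fun y hy h => hy (by simp [h])
  have i1 : ∀ j, Integrable fun y => pd j (fun y => θ y • a j y) y (w y) := fun j =>
    happ (contDiff_pd (hf j) j) hw (hasCompactSupport_pd (hfc j) j)
  have i2 : ∀ j, Integrable fun y => (θ y • a j y) (pd j w y) := fun j =>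
    happ (hf j) (contDiff_pd hw j) (hfc j)
  have i3 : Integrable fun y => (θ y • b y) (w y) := happ (hθ.smul hb) hw hθc.smul_right
  have ibp : ∀ j, ∫ y, (θ y • a j y) (pd j w y) =
      -∫ y, pd j (fun y => θ y • a j y) y (w y) := fun j =>
    integral_bilinear_fderiv_right_eq_neg_left_of_integrable (B := B) (i1 j) (i2 j)
      (happ (hf j) hw (hfc j)) (fun y _ => (hf j).differentiable (by simp) y)
      (fun y _ => hw.differentiable (by simp) y)
  have e1 : ∀ y, transposeCoeff a b θ y (w y) =
      (θ y • b y) (w y) - ∑ j, pd j (fun y => θ y • a j y) y (w y) := by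
    intro y
    simp [transposeCoeff]
  have e2 : ∀ y, θ y • (b y (w y) + ∑ j, a j y (pd j w y)) =
      (θ y • b y) (w y) + ∑ j, (θ y • a j y) (pd j w y) := by
    intro y
    simp [Finset.smul_sum]
  simp_rw [e1, e2]
  rw [integral_sub i3 (integrable_finsetSum _ fun j _ => i1 j),
    integral_add i3 (integrable_finsetSum _ fun j _ => i2 j),
    integral_finsetSum _ fun j _ => i1 j, integral_finsetSum _ fun j _ => i2 j]
  rw [Finset.sum_congr rfl fun j _ => ibp j, Finset.sum_neg_distrib, sub_eq_add_neg]

/-- The formula for the commutator of `J_t` with a differential operator of order one, applied to a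
function `v` that is cut off by `η`. -/
lemma Kernel.commutator_formula (φ : Kernel n) [CompleteSpace V] [CompleteSpace W]
    (ha : ∀ j, ContDiff ℝ ∞ (a j))
    (hac : ∀ j, HasCompactSupport (a j)) (hb : ContDiff ℝ ∞ b) (hbc : HasCompactSupport b)
    {η : Euc n → ℝ} (hη : ContDiff ℝ ∞ η) {v : Euc n → V} (hv : LocallyIntegrable v volume)
    {t : ℝ} (ht : t ∈ Ioc (0 : ℝ) 1) (x : Euc n) :
    b x (φ.mollify t (fun y => η y • v y) x) +
        ∑ j, a j x (pd j (φ.mollify t (fun y => η y • v y)) x) -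
        ∫ y, transposeCoeff a b (fun y => φ.scaled t (x - y) * η y) y (v y) =
      kerOp (φ.commKer a b t) (fun y => η y • v y) x +
        φ.mollify t (fun y => (∑ j, pd j η y • a j y) (v y)) x := by
  set g : Euc n → V := fun y => η y • v y with hg
  have hgl : LocallyIntegrable g volume := by
    exact hv.continuous_smul hη.continuous
  obtain ⟨k, hk⟩ := φ.exists_approxKernel_commKer a b ha hac hb hbc
  have hsη : ContDiff ℝ ∞ fun y => ∑ j, pd j η y • a j y :=
    ContDiff.sum fun j _ => (contDiff_pd hη j).smul (ha j)
  have hκ : ContDiff ℝ ∞ fun y => φ.scaled t (x - y) :=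
    (φ.contDiff_scaled t).comp (contDiff_const.sub contDiff_id)
  have hκc : HasCompactSupport fun y => φ.scaled t (x - y) :=
    (φ.hasCompactSupport_scaled ht.1).comp_homeomorph (Homeomorph.subLeft x)
  have happ : ∀ {A : Euc n → V →L[ℂ] W} {u : Euc n → V}, Continuous A →
      LocallyIntegrable u volume → HasCompactSupport A → Integrable fun y => A y (u y) := by
    intro A u hA hu hAc
    obtain ⟨C, hC⟩ := hAc.exists_bound_of_continuous hA
    have hs : Function.support (fun y => A y (u y)) ⊆ tsupport A := by
      intro y hy
      by_contra hy'
      exact hy (by simp [image_eq_zero_of_notMem_tsupport hy'])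
    rw [← integrableOn_iff_integrable_of_support_subset hs]
    refine Integrable.mono' ((hu.integrableOn_isCompact hAc).norm.const_mul C)
      ((ContinuousLinearMap.id ℂ (V →L[ℂ] W)).aestronglyMeasurable_comp₂
        hA.aestronglyMeasurable hu.aestronglyMeasurable).restrict
      (Eventually.of_forall fun y => ((A y).le_opNorm _).trans ?_)
    gcongr
    exact hC y
  have i0 : Integrable fun y => φ.scaled t (x - y) • g y := by
    have := φ.approxKernel_mollKer (V := V) |>.integrable_apply ht hgl x
    simpa [Kernel.mollKer] using this
  have ij : ∀ j, Integrable fun y => pd j (φ.scaled t) (x - y) • g y := by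
    intro j
    have hc : HasCompactSupport fun y => pd j (φ.scaled t) (x - y) :=
      (hasCompactSupport_pd (φ.hasCompactSupport_scaled ht.1) j).comp_homeomorph
        (Homeomorph.subLeft x)
    have hcc := (contDiff_pd (φ.contDiff_scaled t) j).continuous
    have := (hgl.integrable_smul_left_of_hasCompactSupport
      (by fun_prop : Continuous fun y => pd j (φ.scaled t) (x - y)) hc)
    exact this
  have iM : Integrable fun y =>
      transposeCoeff a b (fun y => φ.scaled t (x - y) * η y) y (v y) :=
    happ (contDiff_transposeCoeff ha hb (hκ.mul hη)).continuous hv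
      (hasCompactSupport_transposeCoeff hκc.mul_right)
  have iC : Integrable fun y => φ.commKer a b t x y (g y) := hk.integrable_apply ht hgl x
  have iS : Integrable fun y => φ.scaled t (x - y) • (∑ j, pd j η y • a j y) (v y) := by
    have := happ (A := fun y => φ.scaled t (x - y) • (∑ j, pd j η y • a j y))
      (hκ.continuous.smul hsη.continuous) hv hκc.smul_right
    simpa using this
  have e0 : b x (φ.mollify t g x) = ∫ y, b x (φ.scaled t (x - y) • g y) :=
    ((b x).integral_comp_comm i0).symm
  have ej : ∀ j, a j x (pd j (φ.mollify t g) x) =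
      ∫ y, a j x (pd j (φ.scaled t) (x - y) • g y) := fun j => by
    rw [φ.pd_mollify ht.1 hgl]
    exact ((a j x).integral_comp_comm (ij j)).symm
  have ib := (b x).integrable_comp i0
  have ia := fun j => (a j x).integrable_comp (ij j)
  have s1 := integral_finsetSum Finset.univ fun j _ => ia j
  have s2 := integral_add ib (integrable_finsetSum Finset.univ fun j _ => ia j)
  have s3 := integral_sub (ib.add (integrable_finsetSum Finset.univ fun j _ => ia j)) iM
  simp only [Pi.add_apply] at s3
  rw [e0, Finset.sum_congr rfl fun j _ => ej j, ← s1, ← s2, ← s3]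
  have s4 := integral_add iC iS
  rw [kerOp, Kernel.mollify, ← s4]
  -- All terms are now under one integral. The derivatives were already moved to smooth factors by
  -- `pd_mollify` and by `transposeCoeff`, so the two integrands agree pointwise, by the product
  -- rule alone.
  refine integral_congr_ae (Eventually.of_forall fun y => ?_)
  have hd : ∀ j, pd j (fun y => (φ.scaled t (x - y) * η y) • a j y) y =
      (φ.scaled t (x - y) * η y) • pd j (a j) y +
        (φ.scaled t (x - y) * pd j η y - pd j (φ.scaled t) (x - y) * η y) • a j y := by
    intro j
    have d1 := hκ.differentiable (by simp) y
    have d2 := hη.differentiable (by simp) y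
    rw [pd_smul (θ := fun y => φ.scaled t (x - y) * η y) (d1.mul d2)
      ((ha j).differentiable (by simp) y)]
    have := pd_smul d1 d2 j
    simp only [smul_eq_mul] at this
    rw [this, pd_comp_sub ((φ.contDiff_scaled t).differentiable (by simp)), neg_mul,
      ← sub_eq_add_neg]
  -- Expanding `∂_j(φ_t(x - y) η a_j)` gives three terms: the derivative of `φ_t` combines with
  -- `a_j(x)` into a difference, the derivative of `a_j` stays in the kernel, and the derivative of
  -- `η` is the symbol term.
  have key : ∀ j, a j x (pd j (φ.scaled t) (x - y) • g y) +
      pd j (fun y => (φ.scaled t (x - y) * η y) • a j y) y (v y) =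
      φ.scaled t (x - y) • pd j (a j) y (g y) +
        (pd j (φ.scaled t) (x - y) • (a j x - a j y)) (g y) +
        φ.scaled t (x - y) • (pd j η y • a j y) (v y) := by
    intro j
    simp only [hd, hg, _root_.add_apply, _root_.sub_apply, _root_.smul_apply,
      ContinuousLinearMap.map_smul_of_tower]
    module
  have key' := Finset.sum_congr (rfl : (Finset.univ : Finset (Fin n)) = Finset.univ)
    fun j _ => key j
  simp only [Finset.sum_add_distrib] at key'
  have e3 : b x (φ.scaled t (x - y) • g y) - (φ.scaled t (x - y) * η y) • b y (v y) =
      φ.scaled t (x - y) • (b x - b y) (g y) := by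
    simp only [hg, _root_.sub_apply, ContinuousLinearMap.map_smul_of_tower]
    module
  simp only [transposeCoeff, Kernel.commKer, _root_.add_apply, _root_.sub_apply,
    _root_.smul_apply, _root_.sum_apply, smul_add, Finset.smul_sum] at key' e3 ⊢
  rw [← e3]
  rw [show ∀ p q r s : W, p + q - (r - s) = p - r + (q + s) from fun p q r s => by abel, key']
  abel

end Transpose

/-! ### Charts with image `ℝ^n` and the measure in them -/

section Chart

variable {n : ℕ} {M : Type*} [TopologicalSpace M] {e : OpenPartialHomeomorph M (Euc n)}

lemma isOpenEmbedding_chart_symm (he : e.target = univ) : IsOpenEmbedding e.symm :=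
  e.symm.isOpenEmbedding (by simpa using he)

lemma range_chart_symm (he : e.target = univ) : range e.symm = e.source := by
  rw [← image_univ, ← he, e.symm_image_target_eq_source]

lemma chart_symm_mem (he : e.target = univ) (y : Euc n) : e.symm y ∈ e.source :=
  e.map_target (he ▸ mem_univ y)

lemma chart_right_inv (he : e.target = univ) (y : Euc n) : e (e.symm y) = y :=
  e.right_inv (he ▸ mem_univ y)

variable [MeasurableSpace M] [BorelSpace M]

lemma measurableEmbedding_chart_symm (he : e.target = univ) : MeasurableEmbedding e.symm :=
  (isOpenEmbedding_chart_symm he).measurableEmbedding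

variable [ChartedSpace (Euc n) M] {μ : Measure M}

/-- A smooth positive density of the measure in a chart that is onto `ℝ^n`. -/
lemma IsSmoothMeasure.exists_density (hμ : IsSmoothMeasure n μ)
    (hm : e ∈ IsManifold.maximalAtlas (𝓡 n) ∞ M) (he : e.target = univ) :
    ∃ ρ : Euc n → ℝ, ContDiff ℝ ∞ ρ ∧ (∀ y, 0 < ρ y) ∧
      μ.restrict e.source =
        (volume.withDensity (fun y => ENNReal.ofReal (ρ y))).map e.symm := by
  obtain ⟨ρ, h1, h2, h3⟩ := hμ e hm
  rw [he] at h1 h2 h3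
  rw [Measure.restrict_univ] at h3
  refine ⟨ρ, contDiffOn_univ.1 h1, fun y => h2 y (mem_univ y), ?_⟩
  -- Pushing forward by the chart and back by its inverse is the identity almost everywhere on the
  -- domain.
  rw [← h3, AEMeasurable.map_map_of_aemeasurable]
  · nth_rewrite 1 [← Measure.map_id (μ := μ.restrict e.source)]
    refine Measure.map_congr ?_
    filter_upwards [ae_restrict_mem e.open_source.measurableSet] with x hx
    exact (e.left_inv hx).symm
  · exact (isOpenEmbedding_chart_symm he).continuous.measurable.aemeasurable
  · exact e.continuousOn.aemeasurable e.open_source.measurableSet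

/-- Strict positivity of the density is what makes a `μ`-null set Lebesgue null in the chart. -/
lemma IsSmoothMeasure.ae_chart (hμ : IsSmoothMeasure n μ)
    (hm : e ∈ IsManifold.maximalAtlas (𝓡 n) ∞ M) (he : e.target = univ) {q : M → Prop}
    (h : ∀ᵐ x ∂(μ.restrict e.source), q x) : ∀ᵐ y, q (e.symm y) := by
  obtain ⟨ρ, h1, h2, h3⟩ := hμ.exists_density hm he
  rw [h3, (measurableEmbedding_chart_symm he).ae_map_iff,
    ae_withDensity_iff h1.continuous.measurable.ennreal_ofReal] at h
  filter_upwards [h] with y hy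
  exact hy (by simpa using h2 y)

lemma IsSmoothMeasure.aestronglyMeasurable_chart (hμ : IsSmoothMeasure n μ)
    (hm : e ∈ IsManifold.maximalAtlas (𝓡 n) ∞ M) (he : e.target = univ) {X : Type*}
    [TopologicalSpace X] {f : M → X}
    (h : AEStronglyMeasurable f (μ.restrict e.source)) :
    AEStronglyMeasurable (f ∘ e.symm) volume := by
  obtain ⟨ρ, h1, h2, h3⟩ := hμ.exists_density hm he
  rw [h3, (measurableEmbedding_chart_symm he).aestronglyMeasurable_map_iff] at h
  refine h.mono_ac (withDensity_absolutelyContinuous'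
    h1.continuous.measurable.ennreal_ofReal.aemeasurable (Eventually.of_forall fun y => ?_))
  simpa using h2 y

/-- A factor `c` in the measure contributes `c^{1/p}`, and `c^{1/p} ≤ c` for `c ≥ 1`; so a single
constant serves for all `p`, including `⊤`. -/
lemma eLpNorm_le_mul_of_le_smul {α ε : Type*} [MeasurableSpace α] [TopologicalSpace ε]
    [ContinuousENorm ε]
    {μ ν : Measure α} {c : ℝ≥0∞} (hc : 1 ≤ c) (h : μ ≤ c • ν) {p : ℝ≥0∞} (hp : 1 ≤ p)
    (f : α → ε) : eLpNorm f p μ ≤ c * eLpNorm f p ν := by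
  refine (eLpNorm_mono_measure f h).trans ?_
  rw [eLpNorm_smul_measure_of_ne_zero (zero_lt_one.trans_le hc).ne', smul_eq_mul]
  gcongr
  rcases eq_or_ne p ⊤ with rfl | hpt
  · simpa using hc
  · nth_rewrite 2 [← ENNReal.rpow_one c]
    refine ENNReal.rpow_le_rpow_of_exponent_le hc ?_
    rw [ENNReal.toReal_div, ENNReal.toReal_one, div_le_one]
    · rw [← ENNReal.toReal_one]; exact ENNReal.toReal_mono hpt hp
    · exact ENNReal.toReal_pos (zero_lt_one.trans_le hp).ne' hpt

/-- On compact subsets of a chart, the measure is comparable with Lebesgue measure. -/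
lemma IsSmoothMeasure.exists_comparison (hμ : IsSmoothMeasure n μ)
    (hm : e ∈ IsManifold.maximalAtlas (𝓡 n) ∞ M) (he : e.target = univ)
    {B : Set (Euc n)} (hB : IsCompact B) :
    ∃ c : ℝ≥0∞, c ≠ ⊤ ∧ ∀ p : ℝ≥0∞, 1 ≤ p → ∀ f : M → ℝ,
      eLpNorm f p (μ.restrict (e.symm '' B)) ≤ c * eLpNorm (f ∘ e.symm) p (volume.restrict B) ∧
      eLpNorm (f ∘ e.symm) p (volume.restrict B) ≤ c * eLpNorm f p (μ.restrict (e.symm '' B)) := by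
  obtain ⟨ρ, h1, h2, h3⟩ := hμ.exists_density hm he
  have hemb := measurableEmbedding_chart_symm (e := e) he
  set ν := (volume : Measure (Euc n)).withDensity fun y => ENNReal.ofReal (ρ y) with hν
  have hres : μ.restrict (e.symm '' B) = (ν.restrict B).map e.symm := by
    have hs : e.symm '' B ⊆ e.source := by
      rw [← range_chart_symm he]; exact image_subset_range _ _
    rw [← Measure.restrict_restrict_of_subset hs, h3, hemb.restrict_map,
      preimage_image_eq _ hemb.injective]
  obtain ⟨C1, hC1⟩ := hB.exists_bound_of_continuousOn h1.continuous.continuousOn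
  obtain ⟨C2, hC2⟩ := hB.exists_bound_of_continuousOn
    (h1.continuous.inv₀ fun y => (h2 y).ne').continuousOn
  have hBm := hB.measurableSet
  -- `C1` and `C2` bound the density and its reciprocal on `B`; the `1` ensures `1 ≤ c`, as required
  -- for a constant that is independent of `p`.
  set c : ℝ≥0∞ := 1 + ENNReal.ofReal C1 + ENNReal.ofReal C2 with hc
  have hc1 : 1 ≤ c := by rw [hc, add_assoc]; exact le_self_add
  have hle1 : ν.restrict B ≤ c • volume.restrict B := by
    rw [hν, restrict_withDensity hBm, ← withDensity_const]
    refine withDensity_mono ?_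
    filter_upwards [ae_restrict_mem hBm] with y hy
    refine le_trans (ENNReal.ofReal_le_ofReal ((le_abs_self _).trans (hC1 y hy))) ?_
    rw [hc, add_right_comm]
    exact le_add_self
  have hle2 : volume.restrict B ≤ c • ν.restrict B := by
    rw [hν, restrict_withDensity hBm, ← withDensity_smul _
      h1.continuous.measurable.ennreal_ofReal]
    nth_rewrite 1 [← withDensity_one (μ := volume.restrict B)]
    refine withDensity_mono ?_
    filter_upwards [ae_restrict_mem hBm] with y hy
    have h4 : ‖(ρ y)⁻¹‖ ≤ C2 := hC2 y hy
    rw [Real.norm_of_nonneg (inv_nonneg.2 (h2 y).le)] at h4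
    have h5 : ENNReal.ofReal C2 ≤ c := by rw [hc]; exact le_add_self
    calc (1 : ℝ≥0∞) = ENNReal.ofReal ((ρ y)⁻¹ * ρ y) := by
          rw [inv_mul_cancel₀ (h2 y).ne', ENNReal.ofReal_one]
      _ = ENNReal.ofReal ((ρ y)⁻¹) * ENNReal.ofReal (ρ y) :=
          ENNReal.ofReal_mul (inv_nonneg.2 (h2 y).le)
      _ ≤ c * ENNReal.ofReal (ρ y) := by
          gcongr
          exact (ENNReal.ofReal_le_ofReal h4).trans h5
  refine ⟨c, by finiteness, fun p hp f => ?_⟩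
  rw [hres, hemb.eLpNorm_map_measure]
  exact ⟨eLpNorm_le_mul_of_le_smul hc1 hle1 hp _, eLpNorm_le_mul_of_le_smul hc1 hle2 hp _⟩

lemma IsSmoothMeasure.measure_image_lt_top (hμ : IsSmoothMeasure n μ)
    (hm : e ∈ IsManifold.maximalAtlas (𝓡 n) ∞ M) (he : e.target = univ)
    {B : Set (Euc n)} (hB : IsCompact B) : μ (e.symm '' B) < ⊤ := by
  obtain ⟨c, hc, h⟩ := hμ.exists_comparison hm he hB
  have h1 := (h 1 le_rfl fun _ => 1).1
  have hf : (fun _ : M => (1 : ℝ)) ∘ e.symm = fun _ => 1 := rfl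
  rw [hf, eLpNorm_const' _ one_ne_zero ENNReal.one_ne_top,
    eLpNorm_const' _ one_ne_zero ENNReal.one_ne_top] at h1
  simp only [enorm_one, Measure.restrict_apply_univ, ENNReal.toReal_one, div_one,
    ENNReal.rpow_one, one_mul] at h1
  exact h1.trans_lt (ENNReal.mul_lt_top hc.lt_top hB.measure_lt_top)

lemma IsSmoothMeasure.integral_chart (hμ : IsSmoothMeasure n μ)
    (hm : e ∈ IsManifold.maximalAtlas (𝓡 n) ∞ M) (he : e.target = univ) :
    ∃ ρ : Euc n → ℝ, ContDiff ℝ ∞ ρ ∧ (∀ y, 0 < ρ y) ∧ ∀ f : M → ℂ,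
      (∀ x ∉ e.source, f x = 0) → ∫ x, f x ∂μ = ∫ y, ρ y • f (e.symm y) := by
  obtain ⟨ρ, h1, h2, h3⟩ := hμ.exists_density hm he
  refine ⟨ρ, h1, h2, fun f hf => ?_⟩
  rw [← setIntegral_eq_integral_of_forall_compl_eq_zero (s := e.source) hf, h3,
    (measurableEmbedding_chart_symm he).integral_map,
    integral_withDensity_eq_integral_toReal_smul h1.continuous.measurable.ennreal_ofReal
      (Eventually.of_forall fun _ => ENNReal.ofReal_lt_top)]
  simp_rw [ENNReal.toReal_ofReal (h2 _).le]

/-- Local finiteness is not part of `IsSmoothMeasure`; it holds because images of closed balls under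
inverse charts are neighbourhoods of finite measure. -/
lemma IsSmoothMeasure.isFiniteMeasureOnCompacts (hμ : IsSmoothMeasure n μ) {A : Type*}
    (𝒜 : GoodAtlas n M A) : IsFiniteMeasureOnCompacts μ := by
  have : IsLocallyFiniteMeasure μ := by
    refine ⟨fun x => ?_⟩
    obtain ⟨α, hα⟩ := 𝒜.η.exists_pos_of_mem (mem_univ x)
    have hx := (𝒜.tsupport_subset α (subset_tsupport _ hα.ne')).1
    refine ⟨(𝒜.chart α).symm '' Metric.closedBall (𝒜.chart α x) 1, ?_,
      hμ.measure_image_lt_top (𝒜.mem_atlas α) (𝒜.target_eq α) (isCompact_closedBall _ _)⟩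
    have := (isOpenEmbedding_chart_symm (𝒜.target_eq α)).isOpenMap.image_mem_nhds
      (Metric.closedBall_mem_nhds (𝒜.chart α x) one_pos)
    rwa [(𝒜.chart α).left_inv hx] at this
  infer_instance

/-- An open null set would be Lebesgue null and open in a chart. This is what upgrades essential
bounds on smooth sections to pointwise bounds. -/
lemma IsSmoothMeasure.isOpenPosMeasure (hμ : IsSmoothMeasure n μ) {A : Type*}
    (𝒜 : GoodAtlas n M A) : μ.IsOpenPosMeasure := by
  refine ⟨fun U hU hne h0 => ?_⟩
  obtain ⟨x, hxU⟩ := hne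
  obtain ⟨α, hα⟩ := 𝒜.η.exists_pos_of_mem (mem_univ x)
  have hx := (𝒜.tsupport_subset α (subset_tsupport _ hα.ne')).1
  have hae : ∀ᵐ x ∂(μ.restrict (𝒜.chart α).source), x ∉ U :=
    ae_restrict_of_ae (measure_eq_zero_iff_ae_notMem.1 h0)
  have h1 := hμ.ae_chart (𝒜.mem_atlas α) (𝒜.target_eq α) hae
  have h2 : IsOpen ((𝒜.chart α).symm ⁻¹' U) :=
    hU.preimage (isOpenEmbedding_chart_symm (𝒜.target_eq α)).continuous
  refine (h2.measure_pos volume ⟨𝒜.chart α x, ?_⟩).ne' (measure_eq_zero_iff_ae_notMem.2 h1)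
  simpa [(𝒜.chart α).left_inv hx] using hxU

end Chart

/-! ### Sections in local frames -/

section LocalFrame

variable {n : ℕ} {M : Type*} [TopologicalSpace M] [ChartedSpace (Euc n) M]
variable {V : Type*} [NormedAddCommGroup V] [InnerProductSpace ℂ V]
  {E : M → Type*} [∀ x, AddCommGroup (E x)] [∀ x, Module ℂ (E x)]
  [∀ x, TopologicalSpace (E x)] [TopologicalSpace (TotalSpace V E)] [FiberBundle V E]

/-- A chart onto `ℝ^n`, with a smooth trivialisation of a bundle over its domain. -/
structure LocalFrame (e : OpenPartialHomeomorph M (Euc n)) (t : Trivialization V (π V E)) :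
    Prop where
  mem : e ∈ IsManifold.maximalAtlas (𝓡 n) ∞ M
  target : e.target = univ
  smooth : IsSmoothTriv n t
  base : e.source ⊆ t.baseSet

lemma GoodTriv.localFrame {A : Type*} {𝒜 : GoodAtlas n M A} (τ : GoodTriv 𝒜 V E) (α : A) :
    LocalFrame (𝒜.chart α) (τ.triv α) :=
  ⟨𝒜.mem_atlas α, 𝒜.target_eq α, τ.isSmooth α, (τ.baseSet_eq α).ge⟩

variable {e : OpenPartialHomeomorph M (Euc n)} {t : Trivialization V (π V E)}

namespace LocalFrame

lemma mem_source (h : LocalFrame e t) (y : Euc n) : e.symm y ∈ e.source :=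
  chart_symm_mem h.target y

lemma mem_base (h : LocalFrame e t) (y : Euc n) : e.symm y ∈ t.baseSet :=
  h.base (h.mem_source y)

lemma right_inv (h : LocalFrame e t) (y : Euc n) : e (e.symm y) = y := chart_right_inv h.target y

/-- The trivialisation as a linear equivalence of fibres. -/
def equiv (h : LocalFrame e t) (y : Euc n) : E (e.symm y) ≃ₗ[ℂ] V :=
  haveI := h.smooth.1
  t.linearEquivAt ℂ (e.symm y) (h.mem_base y)

lemma equiv_symm_apply (h : LocalFrame e t) (y : Euc n) (v : V) :
    (h.equiv y).symm v = t.symm (e.symm y) v := rfl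

lemma localRep_eq (h : LocalFrame e t) (f : ∀ x, E x) (y : Euc n) :
    localRep e t f y = h.equiv y (f (e.symm y)) := rfl

lemma fromLocal_symm (h : LocalFrame e t) (w : Euc n → V) (y : Euc n) :
    fromLocal (E := E) e t w (e.symm y) = (h.equiv y).symm (w y) := by
  rw [fromLocal, if_pos (h.mem_source y), h.right_inv, equiv_symm_apply]

lemma exists_eq (_h : LocalFrame e t) {x : M} (hx : x ∈ e.source) : ∃ y, x = e.symm y :=
  ⟨e x, (e.left_inv hx).symm⟩

lemma fromLocal_of_notMem {x : M} (w : Euc n → V) (hx : x ∉ e.source) :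
    fromLocal (E := E) e t w x = 0 := if_neg hx

lemma localRep_fromLocal (h : LocalFrame e t) (w : Euc n → V) :
    localRep (E := E) e t (fromLocal e t w) = w := by
  ext y
  rw [h.localRep_eq, h.fromLocal_symm, LinearEquiv.apply_symm_apply]

lemma fromLocal_localRep (h : LocalFrame e t) (f : ∀ x, E x) {x : M} (hx : x ∈ e.source) :
    fromLocal e t (localRep e t f) x = f x := by
  obtain ⟨y, rfl⟩ := h.exists_eq hx
  rw [h.fromLocal_symm, h.localRep_eq, LinearEquiv.symm_apply_apply]

lemma eq_of_localRep_eq (h : LocalFrame e t) {f g : ∀ x, E x} {y : Euc n}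
    (hfg : localRep e t f y = localRep e t g y) : f (e.symm y) = g (e.symm y) :=
  (h.equiv y).injective hfg

lemma localRep_add (h : LocalFrame e t) (f g : ∀ x, E x) :
    localRep e t (f + g) = localRep e t f + localRep e t g := by
  ext y
  simp [h.localRep_eq]

lemma localRep_sub (h : LocalFrame e t) (f g : ∀ x, E x) :
    localRep e t (f - g) = localRep e t f - localRep e t g := by
  ext y
  simp [h.localRep_eq]

lemma localRep_smul (h : LocalFrame e t) (c : ℂ) (f : ∀ x, E x) :
    localRep e t (c • f) = c • localRep e t f := by
  ext y
  simp [h.localRep_eq]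

lemma localRep_mul (h : LocalFrame e t) (η : M → ℝ) (f : ∀ x, E x) (y : Euc n) :
    localRep e t (fun x => ((η x : ℝ) : ℂ) • f x) y = η (e.symm y) • localRep e t f y := by
  rw [h.localRep_eq, map_smul, Complex.coe_smul, ← h.localRep_eq]

lemma fromLocal_sub (h : LocalFrame e t) (w w' : Euc n → V) :
    fromLocal (E := E) e t (w - w') = fromLocal e t w - fromLocal e t w' := by
  ext x
  by_cases hx : x ∈ e.source
  · obtain ⟨y, rfl⟩ := h.exists_eq hx
    simp [h.fromLocal_symm]
  · simp [fromLocal_of_notMem _ hx]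

lemma fromLocal_smul (h : LocalFrame e t) (c : ℂ) (w : Euc n → V) :
    fromLocal (E := E) e t (c • w) = c • fromLocal e t w := by
  ext x
  by_cases hx : x ∈ e.source
  · obtain ⟨y, rfl⟩ := h.exists_eq hx
    simp [h.fromLocal_symm]
  · simp [fromLocal_of_notMem _ hx]

lemma fromLocal_ne_zero (h : LocalFrame e t) {w : Euc n → V} {x : M}
    (hx : fromLocal (E := E) e t w x ≠ 0) : x ∈ e.symm '' Function.support w := by
  by_cases hxe : x ∈ e.source
  · obtain ⟨y, rfl⟩ := h.exists_eq hxe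
    refine ⟨y, fun hy => hx ?_, rfl⟩
    rw [h.fromLocal_symm, hy, map_zero]
  · exact absurd (fromLocal_of_notMem w hxe) hx

/-- A fibre seminorm in a local frame. -/
def seminormAt (h : LocalFrame e t) (P : FibreSeminorm V E) (y : Euc n) : Seminorm ℂ V :=
  (P.seminorm (e.symm y)).comp (h.equiv y).symm.toLinearMap

lemma seminormAt_localRep (h : LocalFrame e t) (P : FibreSeminorm V E) (f : ∀ x, E x)
    (y : Euc n) : h.seminormAt P y (localRep e t f y) = P.seminorm (e.symm y) (f (e.symm y)) := by
  simp [seminormAt, h.localRep_eq]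

lemma seminorm_fromLocal (h : LocalFrame e t) (P : FibreSeminorm V E) (w : Euc n → V)
    (y : Euc n) : P.seminorm (e.symm y) (fromLocal e t w (e.symm y)) = h.seminormAt P y (w y) := by
  simp [seminormAt, h.fromLocal_symm]

lemma continuous_symm (h : LocalFrame e t) : Continuous e.symm :=
  (isOpenEmbedding_chart_symm h.target).continuous

lemma continuous_total (h : LocalFrame e t) : Continuous fun z : Euc n × V =>
    (TotalSpace.mk' V (e.symm z.1) ((h.equiv z.1).symm z.2) : TotalSpace V E) := by
  have h1 : ∀ z : Euc n × V, (TotalSpace.mk' V (e.symm z.1) ((h.equiv z.1).symm z.2) :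
      TotalSpace V E) = t.toOpenPartialHomeomorph.symm (e.symm z.1, z.2) := fun z =>
    t.mk_symm (h.mem_base z.1) z.2
  simp_rw [h1]
  refine t.toOpenPartialHomeomorph.continuousOn_symm.comp_continuous
    (by have := h.continuous_symm; fun_prop) fun z => ?_
  exact t.mem_target.2 (h.mem_base z.1)

lemma continuous_seminormAt (h : LocalFrame e t) (P : FibreSeminorm V E) :
    Continuous fun z : Euc n × V => h.seminormAt P z.1 z.2 :=
  P.continuous.comp h.continuous_total

variable [FiniteDimensional ℂ V]

/-- A continuous function is bounded on the compact set `B × closedBall 0 1`; homogeneity does the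
rest. -/
lemma exists_seminormAt_le (h : LocalFrame e t) (P : FibreSeminorm V E) {B : Set (Euc n)}
    (hB : IsCompact B) : ∃ C : ℝ, 0 ≤ C ∧ ∀ y ∈ B, ∀ v, h.seminormAt P y v ≤ C * ‖v‖ := by
  have : ProperSpace V := FiniteDimensional.proper_rclike ℂ V
  obtain ⟨C, hC⟩ := (hB.prod (isCompact_closedBall (0 : V) 1)).exists_bound_of_continuousOn
    (h.continuous_seminormAt P).continuousOn
  refine ⟨max C 0, le_max_right _ _, fun y hy v => ?_⟩
  rcases eq_or_ne v 0 with rfl | hv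
  · simp
  · have hv' : 0 < ‖v‖ := norm_pos_iff.2 hv
    have h1 : ‖((‖v‖⁻¹ : ℝ) : ℂ) • v‖ = 1 := by
      rw [norm_smul, Complex.norm_real, norm_inv, norm_norm, inv_mul_cancel₀ hv'.ne']
    have h2 := hC (y, ((‖v‖⁻¹ : ℝ) : ℂ) • v) ⟨hy, mem_closedBall_zero_iff.2 h1.le⟩
    rw [map_smul_eq_mul, Complex.norm_real, norm_inv, norm_norm, Real.norm_eq_abs] at h2
    have h3 := (le_abs_self _).trans (h2.trans (le_max_left C 0))
    rwa [inv_mul_le_iff₀ hv', mul_comm] at h3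

/-- A fibre norm is positive on the compact set `B × sphere 0 1`, hence bounded below there by a
positive constant; homogeneity does the rest. -/
lemma exists_le_seminormAt (h : LocalFrame e t) {N : FibreSeminorm V E} (hN : N.IsNorm)
    {B : Set (Euc n)} (hB : IsCompact B) :
    ∃ C : ℝ, 0 ≤ C ∧ ∀ y ∈ B, ∀ v, ‖v‖ ≤ C * h.seminormAt N y v := by
  have : ProperSpace V := FiniteDimensional.proper_rclike ℂ V
  obtain ⟨c, hc, hc'⟩ := (hB.prod (isCompact_sphere (0 : V) 1)).exists_forall_le'
    (h.continuous_seminormAt N).continuousOn (a := 0) (fun z hz => by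
      refine lt_of_le_of_ne (apply_nonneg _ _) fun h0 => ?_
      have h1 := hN _ _ h0.symm
      rw [LinearEquiv.coe_coe, LinearEquiv.map_eq_zero_iff] at h1
      have := hz.2
      simp [h1] at this)
  refine ⟨c⁻¹, by positivity, fun y hy v => ?_⟩
  rcases eq_or_ne v 0 with rfl | hv
  · simp
  · have hv' : 0 < ‖v‖ := norm_pos_iff.2 hv
    have h1 : ‖((‖v‖⁻¹ : ℝ) : ℂ) • v‖ = 1 := by
      rw [norm_smul, Complex.norm_real, norm_inv, norm_norm, inv_mul_cancel₀ hv'.ne']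
    have h2 := hc' (y, ((‖v‖⁻¹ : ℝ) : ℂ) • v) ⟨hy, mem_sphere_zero_iff_norm.2 h1⟩
    rw [map_smul_eq_mul, Complex.norm_real, norm_inv, norm_norm] at h2
    rw [le_inv_mul_iff₀ hc]
    rwa [le_inv_mul_iff₀ hv', mul_comm] at h2

end LocalFrame

end LocalFrame

/-! ### Regularity of sections and of their local expressions. -/

section Regularity

variable {n : ℕ} {M : Type*} [TopologicalSpace M] [ChartedSpace (Euc n) M]
variable {V : Type*} [NormedAddCommGroup V] [InnerProductSpace ℂ V]
  {E : M → Type*} [∀ x, AddCommGroup (E x)] [∀ x, Module ℂ (E x)]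
  [∀ x, TopologicalSpace (E x)] [TopologicalSpace (TotalSpace V E)] [FiberBundle V E]
  {e : OpenPartialHomeomorph M (Euc n)} {t : Trivialization V (π V E)}

namespace LocalFrame

lemma contMDiff_symm [IsManifold (𝓡 n) ∞ M] (h : LocalFrame e t) :
    ContMDiff (𝓡 n) (𝓡 n) ∞ e.symm := by
  have := contMDiffOn_symm_of_mem_maximalAtlas h.mem
  rwa [h.target, contMDiffOn_univ] at this

lemma contDiff_localRep [IsManifold (𝓡 n) ∞ M] (h : LocalFrame e t) {f : ∀ x, E x}
    (hf : IsSmoothSection n V f) : ContDiff ℝ ∞ (localRep e t f) := by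
  have h1 : ContMDiff (𝓡 n) ((𝓡 n).prod 𝓘(ℝ, V)) ∞
      (fun y => (TotalSpace.mk' V (e.symm y) (f (e.symm y)) : TotalSpace V E)) :=
    hf.comp h.contMDiff_symm
  have h2 : ContMDiff (𝓡 n) ((𝓡 n).prod 𝓘(ℝ, V)) ∞
      (fun y => t (TotalSpace.mk' V (e.symm y) (f (e.symm y)))) :=
    h.smooth.2.1.comp_contMDiff h1 fun y => t.mem_source.2 (h.mem_base y)
  exact (contMDiff_snd.comp h2).contDiff

lemma continuous_localRep (h : LocalFrame e t) {f : ∀ x, E x}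
    (hf : IsContSection V f) : Continuous (localRep e t f) := by
  have h1 : Continuous
      (fun y => (TotalSpace.mk' V (e.symm y) (f (e.symm y)) : TotalSpace V E)) :=
    Continuous.comp hf h.continuous_symm
  exact continuous_snd.comp (t.continuousOn.comp_continuous h1
    fun y => t.mem_source.2 (h.mem_base y))

lemma secSupport_fromLocal_subset [T2Space M] (h : LocalFrame e t) {w : Euc n → V}
    {B : Set (Euc n)} (hB : IsCompact B) (hw : ∀ y ∉ B, w y = 0) :
    secSupport (fromLocal (E := E) e t w) ⊆ e.symm '' B := by
  refine closure_minimal (fun x hx => ?_) (hB.image h.continuous_symm).isClosed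
  obtain ⟨y, hy, rfl⟩ := h.fromLocal_ne_zero hx
  exact ⟨y, by_contra fun hyB => hy (hw y hyB), rfl⟩

/-- Off the chart domain the section vanishes near each point: its support lies in the image of a
compact set, which is closed because `M` is Hausdorff. This is where extension by zero needs compact
support. -/
lemma isSmoothSection_fromLocal [IsManifold (𝓡 n) ∞ M] [T2Space M] [VectorBundle ℝ V E]
    (h : LocalFrame e t) {w : Euc n → V}
    (hw : ContDiff ℝ ∞ w) (hc : HasCompactSupport w) :
    IsSmoothSection n V (fromLocal (E := E) e t w) := by
  intro x
  by_cases hx : x ∈ e.source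
  · have h1 : ContMDiffOn (𝓡 n) ((𝓡 n).prod 𝓘(ℝ, V)) ∞
        (fun x => (t.toOpenPartialHomeomorph.symm (x, w (e x)) : TotalSpace V E)) e.source := by
      refine h.smooth.2.2.comp ?_ fun x hx => t.mem_target.2 (h.base hx)
      exact contMDiffOn_id.prodMk
        (hw.contMDiff.comp_contMDiffOn (contMDiffOn_of_mem_maximalAtlas h.mem))
    refine (h1.contMDiffAt (e.open_source.mem_nhds hx)).congr_of_eventuallyEq ?_
    filter_upwards [e.open_source.mem_nhds hx] with x' hx'
    rw [fromLocal, if_pos hx']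
    exact t.mk_symm (h.base hx') _
  · have hx' : x ∉ secSupport (fromLocal (E := E) e t w) := fun hx' => by
      obtain ⟨y, -, rfl⟩ := h.secSupport_fromLocal_subset hc
        (fun _ hy => image_eq_zero_of_notMem_tsupport hy) hx'
      exact hx (h.mem_source y)
    refine (contMDiff_zeroSection ℝ E x).congr_of_eventuallyEq ?_
    filter_upwards [isClosed_closure.isOpen_compl.mem_nhds hx'] with x' hx''
    have : fromLocal (E := E) e t w x' = 0 := by
      by_contra h0
      exact hx'' (subset_closure h0)
    rw [this]
    rfl

lemma isTestSection_fromLocal [IsManifold (𝓡 n) ∞ M] [T2Space M] [VectorBundle ℝ V E]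
    (h : LocalFrame e t) {w : Euc n → V}
    (hw : ContDiff ℝ ∞ w) (hc : HasCompactSupport w) :
    IsTestSection n V (fromLocal (E := E) e t w) :=
  ⟨h.isSmoothSection_fromLocal hw hc, (hc.isCompact.image h.continuous_symm).of_isClosed_subset
    isClosed_closure (h.secSupport_fromLocal_subset hc
      fun _ hy => image_eq_zero_of_notMem_tsupport hy)⟩

end LocalFrame

/-- The change of linear trivialisations in an orthonormal basis. -/
lemma trivialization_snd_eq_sum [FiniteDimensional ℂ V] (t t₀ : Trivialization V (π V E))
    [t.IsLinear ℂ] [t₀.IsLinear ℂ] {x : M} (ht : x ∈ t.baseSet) (ht₀ : x ∈ t₀.baseSet) (v : E x) :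
    (t ⟨x, v⟩).2 = ∑ k, inner ℂ (stdOrthonormalBasis ℂ V k) (t₀ ⟨x, v⟩).2 •
      (t ⟨x, t₀.symm x (stdOrthonormalBasis ℂ V k)⟩).2 := by
  have h1 : (t₀.linearEquivAt ℂ x ht₀).symm (t₀ ⟨x, v⟩).2 = v :=
    (t₀.linearEquivAt ℂ x ht₀).symm_apply_apply v
  have h2 : ∀ u : E x, (t ⟨x, u⟩).2 = t.linearEquivAt ℂ x ht u := fun u => rfl
  nth_rewrite 1 [← h1, ← (stdOrthonormalBasis ℂ V).sum_repr' (t₀ ⟨x, v⟩).2]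
  rw [h2, map_sum, map_sum]
  simp_rw [map_smul]
  rfl

lemma continuousOn_trivialization_symm (t t₀ : Trivialization V (π V E)) (v : V) :
    ContinuousOn (fun x => (t ⟨x, t₀.symm x v⟩).2) (t.baseSet ∩ t₀.baseSet) := by
  have h1 : ContinuousOn (fun x => (⟨x, t₀.symm x v⟩ : TotalSpace V E)) t₀.baseSet := by
    refine ContinuousOn.congr (f := fun x => t₀.toOpenPartialHomeomorph.symm (x, v)) ?_
      fun x hx => t₀.mk_symm hx v
    exact t₀.toOpenPartialHomeomorph.continuousOn_symm.comp (by fun_prop)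
      fun x hx => t₀.mem_target.2 hx
  exact continuous_snd.comp_continuousOn (t.continuousOn.comp (h1.mono inter_subset_right)
    fun x hx => t.mem_source.2 hx.1)

variable [MeasurableSpace M] [BorelSpace M] {μ : Measure M} [SigmaCompactSpace M]
  [FiniteDimensional ℂ V] [VectorBundle ℂ V E]

/-- Measurability is defined in the preferred trivialisations only. Countably many of their base
sets cover `M`, and on each overlap the change of trivialisation is linear in the fibre and
continuous in the base point. -/
lemma LocalFrame.aestronglyMeasurable_source (h : LocalFrame e t) {f : ∀ x, E x}
    (hf : IsMeasurableSection V μ f) :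
    AEStronglyMeasurable (fun x => (t ⟨x, f x⟩).2) (μ.restrict e.source) := by
  have := h.smooth.1
  have : SecondCountableTopology M := ChartedSpace.secondCountable_of_sigmaCompact (Euc n) M
  obtain ⟨s, hs, hs'⟩ := TopologicalSpace.countable_cover_nhds
    (f := fun x₀ : M => (trivializationAt V E x₀).baseSet)
    fun x₀ => (trivializationAt V E x₀).open_baseSet.mem_nhds (mem_baseSet_trivializationAt V E x₀)
  have : Countable s := hs.to_subtype
  have hcov : e.source = ⋃ x₀ : s, e.source ∩ (trivializationAt V E x₀.1).baseSet := by
    rw [← inter_iUnion, ← biUnion_eq_iUnion s (fun x₀ _ => (trivializationAt V E x₀).baseSet), hs',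
      inter_univ]
  rw [hcov, aestronglyMeasurable_iUnion_iff]
  rintro ⟨x₀, -⟩
  set t₀ := trivializationAt V E x₀ with ht₀
  have hm : MeasurableSet (e.source ∩ t₀.baseSet) :=
    (e.open_source.inter t₀.open_baseSet).measurableSet
  have hu : AEStronglyMeasurable (fun x => (t₀ ⟨x, f x⟩).2)
      (μ.restrict (e.source ∩ t₀.baseSet)) :=
    (hf x₀).mono_measure (Measure.restrict_mono inter_subset_right le_rfl)
  have key : AEStronglyMeasurable (fun x => ∑ k, inner ℂ (stdOrthonormalBasis ℂ V k)
      (t₀ ⟨x, f x⟩).2 • (t ⟨x, t₀.symm x (stdOrthonormalBasis ℂ V k)⟩).2)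
      (μ.restrict (e.source ∩ t₀.baseSet)) := by
    refine Finset.aestronglyMeasurable_fun_sum _ fun k _ => ?_
    refine (aestronglyMeasurable_const.inner hu).smul ?_
    exact ((continuousOn_trivialization_symm t t₀ _).mono
      (inter_subset_inter_left _ h.base)).aestronglyMeasurable hm
  refine key.congr ?_
  filter_upwards [ae_restrict_mem hm] with x hx
  exact (trivialization_snd_eq_sum t t₀ (h.base hx.1) hx.2 (f x)).symm

lemma LocalFrame.aestronglyMeasurable_localRep (hμ : IsSmoothMeasure n μ) (h : LocalFrame e t)
    {f : ∀ x, E x} (hf : IsMeasurableSection V μ f) :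
    AEStronglyMeasurable (localRep e t f) volume :=
  hμ.aestronglyMeasurable_chart h.mem h.target (h.aestronglyMeasurable_source hf)

end Regularity

/-! ### Comparison of norms on the manifold with norms in a chart. -/

section Norms

variable {n : ℕ} {M : Type*} [TopologicalSpace M] [ChartedSpace (Euc n) M]
variable {V : Type*} [NormedAddCommGroup V] [InnerProductSpace ℂ V]
  {E : M → Type*} [∀ x, AddCommGroup (E x)] [∀ x, Module ℂ (E x)]
  [∀ x, TopologicalSpace (E x)] [TopologicalSpace (TotalSpace V E)] [FiberBundle V E]
  {e : OpenPartialHomeomorph M (Euc n)} {t : Trivialization V (π V E)}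
  [MeasurableSpace M] [BorelSpace M] {μ : Measure M} [FiniteDimensional ℂ V]

/-- The multiplier enters only through its essential supremum over a compact set, and the constant
depends on neither `p` nor `ζ`; so compactly-supported multipliers will see only finitely many
charts. -/
lemma LocalFrame.secNorm_fromLocal_le [T2Space M] (hμ : IsSmoothMeasure n μ)
    (h : LocalFrame e t) (P : FibreSeminorm V E) {B : Set (Euc n)} (hB : IsCompact B) :
    ∃ C : ℝ≥0∞, C ≠ ⊤ ∧ ∀ p : ℝ≥0∞, 1 ≤ p → ∀ (ζ : M → ℂ),
      eLpNorm ζ ⊤ (μ.restrict (e.symm '' B)) ≠ ⊤ → ∀ (w : Euc n → V), (∀ y ∉ B, w y = 0) →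
      secNorm P μ p ζ (fromLocal e t w) ≤
        C * eLpNorm ζ ⊤ (μ.restrict (e.symm '' B)) * eLpNorm w p volume := by
  obtain ⟨c, hc, hcc⟩ := hμ.exists_comparison h.mem h.target hB
  obtain ⟨C, hC0, hC⟩ := h.exists_seminormAt_le P hB
  refine ⟨c * ENNReal.ofReal C, by finiteness, fun p hp ζ hζ w hw => ?_⟩
  have hsupp : Function.support (fun x => ‖ζ x‖ * P.seminorm x (fromLocal e t w x)) ⊆
      e.symm '' B := by
    intro x hx
    have hx' : fromLocal (E := E) e t w x ≠ 0 := fun h0 => hx (by simp [h0])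
    obtain ⟨y, hy, rfl⟩ := h.fromLocal_ne_zero hx'
    exact ⟨y, by_contra fun hyB => hy (hw y hyB), rfl⟩
  lift eLpNorm ζ ⊤ (μ.restrict (e.symm '' B)) to NNReal using hζ with Z hZ
  calc secNorm P μ p ζ (fromLocal e t w)
      = eLpNorm (fun x => ‖ζ x‖ * P.seminorm x (fromLocal e t w x)) p
          (μ.restrict (e.symm '' B)) := (eLpNorm_restrict_eq_of_support_subset hsupp).symm
    _ ≤ Z • eLpNorm (fun x => P.seminorm x (fromLocal e t w x)) p
          (μ.restrict (e.symm '' B)) := by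
        refine eLpNorm_le_nnreal_smul_eLpNorm_of_ae_le_mul ?_ p
        have h1 := enorm_ae_le_eLpNormEssSup ζ (μ.restrict (e.symm '' B))
        rw [← eLpNorm_exponent_top, ← hZ] at h1
        filter_upwards [h1] with x hx
        rw [enorm_le_coe] at hx
        rw [nnnorm_mul, nnnorm_norm]
        gcongr
    _ ≤ Z * (c * eLpNorm ((fun x => P.seminorm x (fromLocal e t w x)) ∘ e.symm) p
          (volume.restrict B)) := by
        rw [ENNReal.smul_def, smul_eq_mul]
        gcongr
        exact (hcc p hp _).1
    _ ≤ Z * (c * (ENNReal.ofReal C * eLpNorm w p volume)) := by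
        gcongr
        refine (eLpNorm_le_mul_eLpNorm_of_ae_le_mul (c := C) (g := w) ?_ p).trans
          (by gcongr; exact Measure.restrict_le_self)
        filter_upwards [ae_restrict_mem hB.measurableSet] with y hy
        rw [Function.comp_apply, h.seminorm_fromLocal, Real.norm_of_nonneg (apply_nonneg _ _)]
        exact hC y hy _
    _ = _ := by ring

lemma LocalFrame.eLpNorm_localRep_le (hμ : IsSmoothMeasure n μ)
    (h : LocalFrame e t) {N : FibreSeminorm V E} (hN : N.IsNorm) {B : Set (Euc n)}
    (hB : IsCompact B) :
    ∃ C : ℝ≥0∞, C ≠ ⊤ ∧ ∀ p : ℝ≥0∞, 1 ≤ p → ∀ (f : ∀ x, E x),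
      eLpNorm (localRep e t f) p (volume.restrict B) ≤
        C * eLpNorm (fun x => N.seminorm x (f x)) p (μ.restrict (e.symm '' B)) := by
  obtain ⟨c, hc, hcc⟩ := hμ.exists_comparison h.mem h.target hB
  obtain ⟨C, hC0, hC⟩ := h.exists_le_seminormAt hN hB
  refine ⟨ENNReal.ofReal C * c, by finiteness, fun p hp f => ?_⟩
  calc eLpNorm (localRep e t f) p (volume.restrict B)
      ≤ ENNReal.ofReal C * eLpNorm ((fun x => N.seminorm x (f x)) ∘ e.symm) p
          (volume.restrict B) := by
        refine eLpNorm_le_mul_eLpNorm_of_ae_le_mul ?_ p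
        filter_upwards [ae_restrict_mem hB.measurableSet] with y hy
        rw [Function.comp_apply, Real.norm_of_nonneg (apply_nonneg _ _),
          ← h.seminormAt_localRep]
        exact hC y hy _
    _ ≤ _ := by
        rw [mul_assoc]
        gcongr
        exact (hcc p hp _).2

lemma mul_eLpNorm_le_secNorm {N : FibreSeminorm V E} {p : ℝ≥0∞} {ξ : M → ℂ} {K : Set M}
    (hK : MeasurableSet K) {c : NNReal} (hξ : ∀ x ∈ K, (c : ℝ) ≤ ‖ξ x‖) (f : ∀ x, E x) :
    c * eLpNorm (fun x => N.seminorm x (f x)) p (μ.restrict K) ≤ secNorm N μ p ξ f := by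
  have h1 : (c : ℝ≥0∞) * eLpNorm (fun x => N.seminorm x (f x)) p (μ.restrict K) =
      eLpNorm ((c : ℝ) • fun x => N.seminorm x (f x)) p (μ.restrict K) := by
    rw [eLpNorm_const_smul]
    simp
  rw [h1]
  refine (eLpNorm_mono_ae ?_).trans (eLpNorm_mono_measure _ Measure.restrict_le_self)
  filter_upwards [ae_restrict_mem hK] with x hx
  rw [Pi.smul_apply, smul_eq_mul, norm_mul, norm_mul, norm_norm]
  gcongr
  rw [Real.norm_of_nonneg c.coe_nonneg]
  exact hξ x hx

variable [SigmaCompactSpace M] [VectorBundle ℂ V E]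

lemma LocalFrame.memLp_localRep (hμ : IsSmoothMeasure n μ)
    (h : LocalFrame e t) {N : FibreSeminorm V E} (hN : N.IsNorm) {p : ℝ≥0∞} (hp : 1 ≤ p)
    {f : ∀ x, E x} (hf : IsLpLoc N μ p f) {B : Set (Euc n)} (hB : IsCompact B) :
    MemLp (localRep e t f) p (volume.restrict B) := by
  obtain ⟨C, hC, hCC⟩ := h.eLpNorm_localRep_le hμ hN hB
  exact ⟨(h.aestronglyMeasurable_localRep hμ hf.1).restrict, (hCC p hp f).trans_lt
    (ENNReal.mul_lt_top hC.lt_top (hf.2 _ (hB.image h.continuous_symm)))⟩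

lemma LocalFrame.locallyIntegrable_localRep (hμ : IsSmoothMeasure n μ)
    (h : LocalFrame e t) {N : FibreSeminorm V E} (hN : N.IsNorm) {p : ℝ≥0∞} (hp : 1 ≤ p)
    {f : ∀ x, E x} (hf : IsLpLoc N μ p f) : LocallyIntegrable (localRep e t f) volume := by
  rw [locallyIntegrable_iff]
  intro B hB
  have : IsFiniteMeasure (volume.restrict B) := ⟨by simpa using hB.measure_lt_top⟩
  exact (h.memLp_localRep hμ hN hp hf hB).integrable hp

lemma IsContSection.isLpLoc [SecondCountableTopology M] [T2Space M] [IsFiniteMeasureOnCompacts μ]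
    {f : ∀ x, E x} (hf : IsContSection V f)
    (N : FibreSeminorm V E) (p : ℝ≥0∞) : IsLpLoc N μ p f := by
  refine ⟨fun x₀ => ?_, fun K hK => ?_⟩
  · refine ContinuousOn.aestronglyMeasurable ?_
      (trivializationAt V E x₀).open_baseSet.measurableSet
    refine continuous_snd.comp_continuousOn ((trivializationAt V E x₀).continuousOn.comp
      (Continuous.continuousOn hf) fun x hx => ?_)
    exact (trivializationAt V E x₀).mem_source.2 hx
  · have hc : Continuous fun x => N.seminorm x (f x) := N.continuous.comp hf
    obtain ⟨C, hC⟩ := hK.exists_bound_of_continuousOn hc.continuousOn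
    have : IsFiniteMeasure (μ.restrict K) := ⟨by simpa using hK.measure_lt_top⟩
    refine (MemLp.of_bound hc.aestronglyMeasurable C ?_).2
    filter_upwards [ae_restrict_mem hK.measurableSet] with x hx using hC x hx

end Norms

/-! ### Smooth sections and differential operators -/

section SmoothSections

variable {n : ℕ} {M : Type*} [TopologicalSpace M] [ChartedSpace (Euc n) M]
variable {V : Type*} [NormedAddCommGroup V] [InnerProductSpace ℂ V]
  {E : M → Type*} [∀ x, AddCommGroup (E x)] [∀ x, Module ℂ (E x)]
  [∀ x, TopologicalSpace (E x)] [TopologicalSpace (TotalSpace V E)] [FiberBundle V E]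
  [VectorBundle ℝ V E]

lemma IsSmoothSection.add {f g : ∀ x, E x} (hf : IsSmoothSection n V f)
    (hg : IsSmoothSection n V g) : IsSmoothSection n V (f + g) :=
  ContMDiff.add_section hf hg

lemma IsSmoothSection.sub {f g : ∀ x, E x} (hf : IsSmoothSection n V f)
    (hg : IsSmoothSection n V g) : IsSmoothSection n V (f - g) :=
  ContMDiff.sub_section hf hg

lemma isSmoothSection_zero : IsSmoothSection n V (0 : ∀ x, E x) :=
  contMDiff_zeroSection ℝ E

lemma IsSmoothSection.mul {f : ∀ x, E x} (hf : IsSmoothSection n V f) {η : M → ℝ}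
    (hη : ContMDiff (𝓡 n) 𝓘(ℝ, ℝ) ∞ η) :
    IsSmoothSection n V (fun x => ((η x : ℝ) : ℂ) • f x) :=
  ContMDiff.smul_section hη hf

lemma isSmoothSection_finsum {ι : Type*} {s : ι → ∀ x, E x}
    (hs : ∀ i, IsSmoothSection n V (s i)) (hl : LocallyFinite fun i => {x | s i x ≠ 0}) :
    IsSmoothSection n V (fun x => ∑ᶠ i, s i x) :=
  ContMDiff.finsum_section_of_locallyFinite hl hs

end SmoothSections

/-! ### Locality of differential operators and their coefficients in charts. -/

section Operator

variable {n : ℕ} {M : Type*} [TopologicalSpace M] [ChartedSpace (Euc n) M]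
  [IsManifold (𝓡 n) ∞ M] [T2Space M]
variable {V : Type*} [NormedAddCommGroup V] [InnerProductSpace ℂ V]
  {E : M → Type*} [∀ x, AddCommGroup (E x)] [∀ x, Module ℂ (E x)]
  [∀ x, TopologicalSpace (E x)] [TopologicalSpace (TotalSpace V E)] [FiberBundle V E]
  [VectorBundle ℝ V E]
variable {W : Type*} [NormedAddCommGroup W] [InnerProductSpace ℂ W]
  {F : M → Type*} [∀ x, AddCommGroup (F x)] [∀ x, Module ℂ (F x)]
  [∀ x, TopologicalSpace (F x)] [TopologicalSpace (TotalSpace W F)] [FiberBundle W F]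
variable {A : Type*} {𝒜 : GoodAtlas n M A}

/-- The expression `b w + ∑_j a_j ∂_j w` of a differential operator in coordinates. -/
def localOp (a : Fin n → Euc n → V →L[ℂ] W) (b : Euc n → V →L[ℂ] W) (w : Euc n → V)
    (y : Euc n) : W :=
  b y (w y) + ∑ j, a j y (pd j w y)

lemma localOp_congr {a : Fin n → Euc n → V →L[ℂ] W} {b : Euc n → V →L[ℂ] W} {w w' : Euc n → V}
    {y : Euc n} (h : w =ᶠ[𝓝 y] w') : localOp a b w y = localOp a b w' y := by
  simp only [localOp, pd, h.fderiv_eq, h.eq_of_nhds]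

lemma localOp_zero {a : Fin n → Euc n → V →L[ℂ] W} {b : Euc n → V →L[ℂ] W} (y : Euc n) :
    localOp a b 0 y = 0 := by
  simp [localOp, pd]

namespace FirstOrderOp

variable (D : FirstOrderOp n V E W F)

lemma isSmoothSection_app {f : ∀ x, E x} (hf : IsSmoothSection n V f) :
    IsSmoothSection n W (D.app f) := by
  rw [app, dif_pos hf]
  exact (D.toFun ⟨f, hf⟩).2

lemma exists_localForm (τE : GoodTriv 𝒜 V E) (τF : GoodTriv 𝒜 W F) (α : A) :
    ∃ (a : Fin n → Euc n → V →L[ℂ] W) (b : Euc n → V →L[ℂ] W),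
      (∀ j, ContDiff ℝ ∞ (a j)) ∧ ContDiff ℝ ∞ b ∧ ∀ f : ∀ x, E x, IsSmoothSection n V f →
        ∀ y, localRep (𝒜.chart α) (τF.triv α) (D.app f) y =
          localOp a b (localRep (𝒜.chart α) (τE.triv α) f) y := by
  obtain ⟨a, b, ha, hb, h⟩ := D.local_form (𝒜.chart α) (𝒜.mem_atlas α) (τE.triv α) (τF.triv α)
    (τE.isSmooth α) (τF.isSmooth α) (τE.baseSet_eq α).ge (τF.baseSet_eq α).ge
  rw [𝒜.target_eq] at hb h
  refine ⟨a, b, fun j => ?_, contDiffOn_univ.1 hb, fun f hf y => ?_⟩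
  · have := ha j
    rwa [𝒜.target_eq, contDiffOn_univ] at this
  · rw [app, dif_pos hf]
    exact h ⟨f, hf⟩ y (mem_univ y)

lemma _root_.Friedrichs.GoodAtlas.exists_mem (𝒜 : GoodAtlas n M A) (x : M) :
    ∃ α y, x = (𝒜.chart α).symm y := by
  obtain ⟨α, hα⟩ := 𝒜.η.exists_pos_of_mem (mem_univ x)
  have hx := (𝒜.tsupport_subset α (subset_tsupport _ hα.ne')).1
  exact ⟨α, 𝒜.chart α x, ((𝒜.chart α).left_inv hx).symm⟩

variable {D}

/-- Linearity is not a field of `FirstOrderOp`; additivity is read off from the coordinate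
expression, as is locality in `app_congr`. -/
lemma app_add (τE : GoodTriv 𝒜 V E) (τF : GoodTriv 𝒜 W F) {f g : ∀ x, E x}
    (hf : IsSmoothSection n V f) (hg : IsSmoothSection n V g) :
    D.app (f + g) = D.app f + D.app g := by
  ext x
  obtain ⟨α, y, rfl⟩ := 𝒜.exists_mem x
  obtain ⟨a, b, -, -, h⟩ := D.exists_localForm τE τF α
  have hE := τE.localFrame α
  have hF := τF.localFrame α
  apply hF.eq_of_localRep_eq
  rw [hF.localRep_add, Pi.add_apply, h _ (hf.add hg), h _ hf, h _ hg, hE.localRep_add]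
  have d1 := (hE.contDiff_localRep hf).differentiable (by simp) y
  have d2 := (hE.contDiff_localRep hg).differentiable (by simp) y
  simp only [localOp, pd, fderiv_add d1 d2, Pi.add_apply, map_add, _root_.add_apply,
    Finset.sum_add_distrib]
  abel

lemma app_congr (τE : GoodTriv 𝒜 V E) (τF : GoodTriv 𝒜 W F) {f g : ∀ x, E x}
    (hf : IsSmoothSection n V f) (hg : IsSmoothSection n V g) {x : M}
    (hfg : ∀ᶠ x' in 𝓝 x, f x' = g x') : D.app f x = D.app g x := by
  obtain ⟨α, y, rfl⟩ := 𝒜.exists_mem x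
  obtain ⟨a, b, -, -, h⟩ := D.exists_localForm τE τF α
  apply (τF.localFrame α).eq_of_localRep_eq
  rw [h _ hf, h _ hg]
  refine localOp_congr ?_
  filter_upwards [(τE.localFrame α).continuous_symm.continuousAt.eventually hfg] with y' hy'
  rw [localRep, localRep, hy']

lemma app_zero (τE : GoodTriv 𝒜 V E) (τF : GoodTriv 𝒜 W F) : D.app 0 = 0 := by
  have h := app_add (D := D) τE τF (isSmoothSection_zero (n := n) (V := V) (E := E))
    isSmoothSection_zero
  rw [add_zero] at h
  exact left_eq_add.1 h

lemma app_eq_zero (τE : GoodTriv 𝒜 V E) (τF : GoodTriv 𝒜 W F) {f : ∀ x, E x}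
    (hf : IsSmoothSection n V f) {x : M} (h : x ∉ secSupport f) : D.app f x = 0 := by
  rw [app_congr τE τF hf isSmoothSection_zero, app_zero τE τF]
  · rfl
  · filter_upwards [isClosed_closure.isOpen_compl.mem_nhds h] with x' hx'
    by_contra h0
    exact hx' (subset_closure h0)

lemma app_sum (τE : GoodTriv 𝒜 V E) (τF : GoodTriv 𝒜 W F) {ι : Type*} {s : ι → ∀ x, E x}
    (hs : ∀ i, IsSmoothSection n V (s i)) (I : Finset ι) :
    IsSmoothSection n V (∑ i ∈ I, s i) ∧ D.app (∑ i ∈ I, s i) = ∑ i ∈ I, D.app (s i) := by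
  classical
  induction I using Finset.induction_on with
  | empty => simpa using ⟨isSmoothSection_zero, app_zero τE τF⟩
  | insert i I hi ih =>
    rw [Finset.sum_insert hi, Finset.sum_insert hi]
    exact ⟨(hs i).add ih.1, by rw [app_add τE τF (hs i) ih.1, ih.2]⟩

/-- Near each point only finitely many summands are nonzero, and the operator is local, so
additivity over finite sums suffices. -/
lemma app_finsum (τE : GoodTriv 𝒜 V E) (τF : GoodTriv 𝒜 W F) {ι : Type*} {s : ι → ∀ x, E x}
    (hs : ∀ i, IsSmoothSection n V (s i)) (hl : LocallyFinite fun i => {x | s i x ≠ 0}) (x : M) :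
    D.app (fun x => ∑ᶠ i, s i x) x = ∑ᶠ i, D.app (s i) x := by
  obtain ⟨U, hU, hfin⟩ := hl x
  set I := hfin.toFinset with hI
  have hzero : ∀ i ∉ I, ∀ x' ∈ U, s i x' = 0 := by
    intro i hi x' hx'
    by_contra h0
    exact hi (by rw [hI, Finite.mem_toFinset]; exact ⟨x', h0, hx'⟩)
  have h1 : ∀ᶠ x' in 𝓝 x, (fun x => ∑ᶠ i, s i x) x' = (∑ i ∈ I, s i) x' := by
    filter_upwards [hU] with x' hx'
    rw [Finset.sum_apply]
    refine finsum_eq_sum_of_support_subset _ fun i hi => ?_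
    by_contra h0
    exact hi (hzero i h0 x' hx')
  rw [app_congr τE τF (isSmoothSection_finsum hs hl) (app_sum (D := D) τE τF hs I).1 h1,
    (app_sum τE τF hs I).2, Finset.sum_apply, eq_comm]
  refine finsum_eq_sum_of_support_subset _ fun i hi => ?_
  by_contra h0
  refine hi ?_
  change D.app (s i) x = 0
  rw [app_congr τE τF (hs i) isSmoothSection_zero, app_zero τE τF]
  · rfl
  · filter_upwards [hU] with x' hx' using hzero i h0 x' hx'

/-- Smooth compactly-supported coefficients that describe a differential operator in the part of a
chart that is relevant for the mollifiers. -/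
structure LocalCoeff (D : FirstOrderOp n V E W F) (τE : GoodTriv 𝒜 V E) (τF : GoodTriv 𝒜 W F)
    (α : A) (a : Fin n → Euc n → V →L[ℂ] W) (b : Euc n → V →L[ℂ] W) : Prop where
  smooth_a : ∀ j, ContDiff ℝ ∞ (a j)
  compact_a : ∀ j, HasCompactSupport (a j)
  smooth_b : ContDiff ℝ ∞ b
  compact_b : HasCompactSupport b
  form : ∀ f : ∀ x, E x, IsSmoothSection n V f → ∀ y ∈ Metric.closedBall (0 : Euc n) 3,
    localRep (𝒜.chart α) (τF.triv α) (D.app f) y =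
      localOp a b (localRep (𝒜.chart α) (τE.triv α) f) y

variable (D) in
-- The coefficients are multiplied by a bump function. The mollified pieces live in the ball of
-- radius 2, so nothing changes for them as long as the bump is `1` on the ball of radius 3, and
-- compactly-supported coefficients have the global Lipschitz bounds needed for the commutator
-- kernel.
lemma exists_localCoeff (τE : GoodTriv 𝒜 V E) (τF : GoodTriv 𝒜 W F) (α : A) :
    ∃ a b, D.LocalCoeff τE τF α a b := by
  obtain ⟨a, b, ha, hb, h⟩ := D.exists_localForm τE τF α
  let χ : ContDiffBump (0 : Euc n) := ⟨3, 4, by norm_num, by norm_num⟩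
  refine ⟨fun j y => χ y • a j y, fun y => χ y • b y, fun j => χ.contDiff.smul (ha j),
    fun j => χ.hasCompactSupport.smul_right, χ.contDiff.smul hb,
    χ.hasCompactSupport.smul_right, fun f hf y hy => ?_⟩
  rw [h f hf]
  simp [localOp, χ.one_of_mem_closedBall hy]

/-- A differential operator applied to a section that is supported in a chart. -/
lemma LocalCoeff.app_fromLocal {τE : GoodTriv 𝒜 V E} {τF : GoodTriv 𝒜 W F} {α : A}
    {a : Fin n → Euc n → V →L[ℂ] W} {b : Euc n → V →L[ℂ] W} (h : D.LocalCoeff τE τF α a b)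
    {w : Euc n → V} (hw : ContDiff ℝ ∞ w) (hw2 : ∀ y ∉ Metric.closedBall (0 : Euc n) 2, w y = 0) :
    D.app (fromLocal (𝒜.chart α) (τE.triv α) w) =
      fromLocal (𝒜.chart α) (τF.triv α) (localOp a b w) := by
  have hE := τE.localFrame α
  have hF := τF.localFrame α
  have hwc : HasCompactSupport w := HasCompactSupport.intro (isCompact_closedBall _ _) hw2
  have hs := hE.isSmoothSection_fromLocal hw hwc
  have hsupp := hE.secSupport_fromLocal_subset (isCompact_closedBall _ _) hw2
  ext x
  by_cases hx : x ∈ (𝒜.chart α).source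
  · obtain ⟨y, rfl⟩ := hF.exists_eq hx
    -- Inside radius 3 the coefficients are the true ones; outside it, `w` vanishes near `y` and
    -- both sides are zero.
    by_cases hy : y ∈ Metric.closedBall (0 : Euc n) 3
    · apply hF.eq_of_localRep_eq
      rw [h.form _ hs y hy, hE.localRep_fromLocal, hF.localRep_fromLocal]
    · have hy2 : y ∉ Metric.closedBall (0 : Euc n) 2 := fun h2 =>
        hy (Metric.closedBall_subset_closedBall (by norm_num) h2)
      rw [hF.fromLocal_symm, localOp_congr (w' := 0), localOp_zero, map_zero]
      · refine app_eq_zero τE τF hs fun hys => hy2 ?_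
        obtain ⟨y', hy', he⟩ := hsupp hys
        rwa [(isOpenEmbedding_chart_symm (𝒜.target_eq α)).injective he] at hy'
      · filter_upwards [Metric.isClosed_closedBall.isOpen_compl.mem_nhds hy2] with y' hy'
        exact hw2 y' hy'
  · rw [LocalFrame.fromLocal_of_notMem _ hx]
    refine app_eq_zero τE τF hs fun hxs => hx ?_
    obtain ⟨y', -, rfl⟩ := hsupp hxs
    exact hE.mem_source y'

/-- The cutoff function `η_α` in the chart `α`. -/
def _root_.Friedrichs.GoodAtlas.cut (𝒜 : GoodAtlas n M A) (α : A) (y : Euc n) : ℝ :=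
  𝒜.η α ((𝒜.chart α).symm y)

lemma _root_.Friedrichs.GoodAtlas.contDiff_cut (𝒜 : GoodAtlas n M A) (α : A) :
    ContDiff ℝ ∞ (𝒜.cut α) := by
  have h1 := contMDiffOn_symm_of_mem_maximalAtlas (𝒜.mem_atlas α)
  rw [𝒜.target_eq, contMDiffOn_univ] at h1
  exact ((𝒜.η α).contMDiff.comp h1).contDiff

lemma _root_.Friedrichs.GoodAtlas.tsupport_cut (𝒜 : GoodAtlas n M A) (α : A) :
    tsupport (𝒜.cut α) ⊆ Metric.ball 0 1 := by
  have h1 := isOpenEmbedding_chart_symm (𝒜.target_eq α)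
  intro y hy
  have h2 : (𝒜.chart α).symm y ∈ tsupport (𝒜.η α) :=
    tsupport_comp_subset_preimage (𝒜.η α) h1.continuous hy
  have h3 := (𝒜.tsupport_subset α h2).2
  rwa [mem_preimage, chart_right_inv (𝒜.target_eq α)] at h3

lemma _root_.Friedrichs.GoodAtlas.finsum_η_smul (𝒜 : GoodAtlas n M A) {x : M} (v : E x) :
    ∑ᶠ α, ((𝒜.η α x : ℝ) : ℂ) • v = v := by
  have hfin : (Function.support fun α => ((𝒜.η α x : ℝ) : ℂ)).Finite := by
    refine (𝒜.η.locallyFinite.point_finite x).subset fun α hα h0 => hα ?_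
    simp [show 𝒜.η α x = 0 from h0]
  have hsum : ∑ᶠ α, ((𝒜.η α x : ℝ) : ℂ) = 1 := by
    rw [← Complex.ofReal_one, ← 𝒜.η.sum_eq_one (mem_univ x)]
    exact (AddMonoidHom.map_finsum_of_injective Complex.ofRealHom.toAddMonoidHom
      Complex.ofReal_injective _).symm
  rw [← finsum_smul' hfin, hsum, one_smul]

/-- In the Leibniz rule the terms with `b` and with derivatives of `w` cancel, so the commutator
with a function has order zero. -/
lemma localOp_smul_sub {a : Fin n → Euc n → V →L[ℂ] W} {b : Euc n → V →L[ℂ] W} {η : Euc n → ℝ}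
    {w : Euc n → V} {y : Euc n} (hη : DifferentiableAt ℝ η y) (hw : DifferentiableAt ℝ w y) :
    localOp a b (fun y => η y • w y) y - η y • localOp a b w y =
      (∑ j, pd j η y • a j y) (w y) := by
  simp only [localOp, pd_smul hη hw, map_add, ContinuousLinearMap.map_smul_of_tower, smul_add,
    Finset.smul_sum, Finset.sum_add_distrib, _root_.sum_apply, _root_.smul_apply]
  abel

variable [FiniteDimensional ℂ V]

/-- The commutators of a differential operator with the functions of a partition of unity add up
to zero. -/
lemma finsum_symbol_eq_zero (τE : GoodTriv 𝒜 V E) (τF : GoodTriv 𝒜 W F)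
    {a : A → Fin n → Euc n → V →L[ℂ] W} {b : A → Euc n → V →L[ℂ] W}
    (h : ∀ α, D.LocalCoeff τE τF α (a α) (b α)) (f : ∀ x, E x) (x : M) :
    ∑ᶠ α, fromLocal (E := F) (𝒜.chart α) (τF.triv α) (fun y =>
      (∑ j, pd j (𝒜.cut α) y • a α j y) (localRep (𝒜.chart α) (τE.triv α) f y)) x = 0 := by
  obtain ⟨β, y₀, hx⟩ := 𝒜.exists_mem x
  -- The summands depend on `f` only through its value at `x`, because the symbol has order zero. So
  -- the arbitrary section `f` may be replaced by a smooth section `s` with the same value at `x`,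
  -- to which `D` can be applied.
  let χ : ContDiffBump y₀ := ⟨1, 2, by norm_num, by norm_num⟩
  set w : Euc n → V := fun y => χ y • localRep (𝒜.chart β) (τE.triv β) f y₀ with hw
  have hwc : HasCompactSupport w := χ.hasCompactSupport.smul_right
  set s : ∀ x, E x := fromLocal (𝒜.chart β) (τE.triv β) w with hs
  have hss : IsSmoothSection n V s :=
    (τE.localFrame β).isSmoothSection_fromLocal (χ.contDiff.smul contDiff_const) hwc
  have hsx : s x = f x := by
    rw [hx, hs, (τE.localFrame β).fromLocal_symm, hw]
    simp only [χ.one_of_mem_closedBall (Metric.mem_closedBall_self zero_le_one), one_smul]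
    rw [(τE.localFrame β).localRep_eq, LinearEquiv.symm_apply_apply]
  have hsm : ∀ α, IsSmoothSection n V (fun x => ((𝒜.η α x : ℝ) : ℂ) • s x) := fun α =>
    hss.mul (𝒜.η α).contMDiff
  -- Each summand is `[D, η_α] s` at `x`; off the support of `η_α` all terms vanish.
  have key : ∀ α, fromLocal (E := F) (𝒜.chart α) (τF.triv α) (fun y =>
      (∑ j, pd j (𝒜.cut α) y • a α j y) (localRep (𝒜.chart α) (τE.triv α) f y)) x =
      D.app (fun x => ((𝒜.η α x : ℝ) : ℂ) • s x) x - ((𝒜.η α x : ℝ) : ℂ) • D.app s x := by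
    intro α
    have hE := τE.localFrame α
    have hF := τF.localFrame α
    by_cases hη : x ∈ tsupport (𝒜.η α)
    · have hxs := (𝒜.tsupport_subset α hη).1
      have hxb := (𝒜.tsupport_subset α hη).2
      obtain ⟨y, hy⟩ := hE.exists_eq hxs
      subst hy
      rw [mem_preimage, hE.right_inv] at hxb
      have hy3 : y ∈ Metric.closedBall (0 : Euc n) 3 :=
        Metric.ball_subset_closedBall (Metric.ball_subset_ball (by norm_num) hxb)
      have e1 := hF.eq_of_localRep_eq (f := fromLocal (E := F) (𝒜.chart α) (τF.triv α) (fun y =>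
        (∑ j, pd j (𝒜.cut α) y • a α j y) (localRep (𝒜.chart α) (τE.triv α) f y)))
        (g := D.app (fun x => ((𝒜.η α x : ℝ) : ℂ) • s x) -
          fun x => ((𝒜.η α x : ℝ) : ℂ) • D.app s x) (y := y)
      refine e1 ?_
      rw [hF.localRep_fromLocal, hF.localRep_sub, Pi.sub_apply, hF.localRep_mul,
        (h α).form _ (hsm α) y hy3, (h α).form _ hss y hy3]
      have e2 : localRep (𝒜.chart α) (τE.triv α) (fun x => ((𝒜.η α x : ℝ) : ℂ) • s x) =
          fun y => 𝒜.cut α y • localRep (𝒜.chart α) (τE.triv α) s y := by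
        ext y'
        exact hE.localRep_mul _ _ _
      have e3 := localOp_smul_sub (a := a α) (b := b α)
        ((𝒜.contDiff_cut α).differentiable (by simp) y)
        ((hE.contDiff_localRep hss).differentiable (by simp) y)
      have e4 : localRep (𝒜.chart α) (τE.triv α) s y = localRep (𝒜.chart α) (τE.triv α) f y := by
        rw [localRep, localRep, hsx]
      rw [e2]
      rw [e4] at e3
      exact e3.symm
    · have e1 : D.app (fun x => ((𝒜.η α x : ℝ) : ℂ) • s x) x = 0 := by
        refine app_eq_zero τE τF (hsm α) fun hx' => hη ?_
        refine closure_mono (fun x' hx' => ?_) hx'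
        intro h0
        exact hx' (by simp [h0])
      rw [e1, image_eq_zero_of_notMem_tsupport hη, Complex.ofReal_zero, zero_smul, sub_zero]
      by_cases hxs : x ∈ (𝒜.chart α).source
      · obtain ⟨y, hy⟩ := hE.exists_eq hxs
        rw [hy, hF.fromLocal_symm]
        have hyt : y ∉ tsupport (𝒜.cut α) := fun h' => hη <| by
          rw [hy]
          exact tsupport_comp_subset_preimage (𝒜.η α) hE.continuous_symm h'
        simp [pd_eq_zero hyt]
      · exact LocalFrame.fromLocal_of_notMem _ hxs
  have hl : LocallyFinite fun α => {x | ((𝒜.η α x : ℝ) : ℂ) • s x ≠ 0} :=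
    𝒜.η.locallyFinite.subset fun α x hx h0 => hx (by simp [h0])
  have hfin1 : (Function.support fun α => D.app (fun x => ((𝒜.η α x : ℝ) : ℂ) • s x) x).Finite := by
    obtain ⟨U, hU, hf⟩ := hl x
    refine hf.subset fun α hα => ?_
    by_contra hne
    rw [mem_ofPred_eq, not_nonempty_iff_eq_empty] at hne
    refine hα (app_eq_zero τE τF (hsm α) fun hx' => ?_)
    obtain ⟨x', h1, h2⟩ := mem_closure_iff_nhds.1 hx' U hU
    have : x' ∈ ({x | ((𝒜.η α x : ℝ) : ℂ) • s x ≠ 0} ∩ U) := ⟨h2, h1⟩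
    rw [hne] at this
    exact this
  have hfin3 : (Function.support fun α => ((𝒜.η α x : ℝ) : ℂ) • D.app s x).Finite :=
    (𝒜.η.locallyFinite.point_finite x).subset fun α hα h0 => hα (by
      simp [show 𝒜.η α x = 0 from h0])
  -- Since `∑_α η_α = 1`, both `∑_α D(η_α s)` and `∑_α η_α D s` equal `D s` at `x`.
  rw [finsum_congr key, finsum_sub_distrib hfin1 hfin3, ← app_finsum τE τF hsm hl x,
    𝒜.finsum_η_smul, sub_eq_zero]
  simp_rw [𝒜.finsum_η_smul]

end FirstOrderOp

end Operator

/-! ### Hermitean metrics in local frames, and test sections as functionals -/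

section Gram

variable {n : ℕ} {M : Type*} [TopologicalSpace M] [ChartedSpace (Euc n) M]
variable {V : Type*} [NormedAddCommGroup V] [InnerProductSpace ℂ V]
  {E : M → Type*} [∀ x, AddCommGroup (E x)] [∀ x, Module ℂ (E x)]
  [∀ x, TopologicalSpace (E x)] [TopologicalSpace (TotalSpace V E)] [FiberBundle V E]
  {e : OpenPartialHomeomorph M (Euc n)} {t : Trivialization V (π V E)}

namespace LocalFrame

/-- A hermitean metric in a local frame. -/
def gram (h : LocalFrame e t) (H : HermitianMetric n V E) (y : Euc n) (v w : V) : ℂ :=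
  H.form (e.symm y) ((h.equiv y).symm v) ((h.equiv y).symm w)

lemma gram_localRep (h : LocalFrame e t) (H : HermitianMetric n V E) (f g : ∀ x, E x) (y : Euc n) :
    h.gram H y (localRep e t f y) (localRep e t g y) =
      H.form (e.symm y) (f (e.symm y)) (g (e.symm y)) := by
  simp [gram, h.localRep_eq]

variable [FiniteDimensional ℂ V]

lemma gram_eq_sum (h : LocalFrame e t) (H : HermitianMetric n V E) (y : Euc n) (v w : V) :
    h.gram H y v w = ∑ k, ∑ l, inner ℂ (stdOrthonormalBasis ℂ V k) v *
      conj (inner ℂ (stdOrthonormalBasis ℂ V l) w) *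
      h.gram H y (stdOrthonormalBasis ℂ V k) (stdOrthonormalBasis ℂ V l) := by
  conv_lhs => rw [← (stdOrthonormalBasis ℂ V).sum_repr' v, ← (stdOrthonormalBasis ℂ V).sum_repr' w]
  simp only [gram, map_sum, map_smulₛₗ, LinearMap.sum_apply, LinearMap.smul_apply, smul_eq_mul,
    RingHom.id_apply, Finset.mul_sum, mul_assoc]
  rw [Finset.sum_comm]
  refine Finset.sum_congr rfl fun k _ => Finset.sum_congr rfl fun l _ => ?_
  ring

variable [VectorBundle ℂ V E] [VectorBundle ℝ V E] [ContMDiffVectorBundle ∞ V E (𝓡 n)]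
  [IsManifold (𝓡 n) ∞ M]

lemma contDiffAt_trivialization_symm (h : LocalFrame e t) (x₀ : M) {y : Euc n}
    (hy : e.symm y ∈ (trivializationAt V E x₀).baseSet) (v : V) :
    ContDiffAt ℝ ∞ (fun y => (trivializationAt V E x₀ ⟨e.symm y, (h.equiv y).symm v⟩).2) y := by
  have h1 : ContMDiff (𝓡 n) ((𝓡 n).prod 𝓘(ℝ, V)) ∞
      (fun y => (⟨e.symm y, (h.equiv y).symm v⟩ : TotalSpace V E)) := by
    have h2 : ContMDiff (𝓡 n) ((𝓡 n).prod 𝓘(ℝ, V)) ∞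
        (fun y => (t.toOpenPartialHomeomorph.symm (e.symm y, v) : TotalSpace V E)) :=
      h.smooth.2.2.comp_contMDiff (h.contMDiff_symm.prodMk contMDiff_const)
        fun y => t.mem_target.2 (h.mem_base y)
    refine h2.congr fun y => ?_
    exact t.mk_symm (h.mem_base y) v
  have h3 := (Trivialization.contMDiffOn (n := ∞) (IB := 𝓡 n) (trivializationAt V E x₀)).contMDiffAt
    ((trivializationAt V E x₀).open_source.mem_nhds ((trivializationAt V E x₀).mem_source.2
      (show (⟨e.symm y, (h.equiv y).symm v⟩ : TotalSpace V E).proj ∈ _ from hy)))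
  have h4 := h3.comp y h1.contMDiffAt
  exact h4.snd.contDiffAt

/-- The metric is assumed smooth only in the preferred trivialisations. The frame vectors are
expanded in the preferred frame at `e.symm y₀`, with coefficients that are smooth near `y₀`. -/
lemma contDiff_gram (h : LocalFrame e t) (H : HermitianMetric n V E) (v w : V) :
    ContDiff ℝ ∞ fun y => h.gram H y v w := by
  rw [contDiff_iff_contDiffAt]
  intro y₀
  set t₀ := trivializationAt V E (e.symm y₀) with ht₀
  have hy₀ : e.symm y₀ ∈ t₀.baseSet := mem_baseSet_trivializationAt V E _
  set c : V → Fin (Module.finrank ℂ V) → Euc n → ℂ := fun v k y =>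
    inner ℂ (stdOrthonormalBasis ℂ V k) (t₀ ⟨e.symm y, (h.equiv y).symm v⟩).2 with hc
  have hcs : ∀ v k, ContDiffAt ℝ ∞ (c v k) y₀ := fun v k =>
    ((innerSL ℂ (stdOrthonormalBasis ℂ V k)).restrictScalars ℝ).contDiff.contDiffAt.comp y₀
      (h.contDiffAt_trivialization_symm _ hy₀ v)
  have hexp : ∀ v y, e.symm y ∈ t₀.baseSet → (h.equiv y).symm v =
      ∑ k, c v k y • t₀.symm (e.symm y) (stdOrthonormalBasis ℂ V k) := by
    intro v y hy
    apply (t₀.linearEquivAt ℂ (e.symm y) hy).injective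
    have h1 : (t₀.linearEquivAt ℂ (e.symm y) hy) ((h.equiv y).symm v) =
      (t₀ ⟨e.symm y, (h.equiv y).symm v⟩).2 := rfl
    have h2 : ∀ u : V, (t₀.linearEquivAt ℂ (e.symm y) hy) (t₀.symm (e.symm y) u) = u :=
      fun u => (t₀.linearEquivAt ℂ (e.symm y) hy).apply_symm_apply u
    rw [h1, map_sum]
    simp_rw [map_smul, h2]
    exact ((stdOrthonormalBasis ℂ V).sum_repr' _).symm
  have key : ContDiffAt ℝ ∞ (fun y => ∑ k, ∑ l, c v k y * conj (c w l y) *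
      H.form (e.symm y) (t₀.symm (e.symm y) (stdOrthonormalBasis ℂ V k))
        (t₀.symm (e.symm y) (stdOrthonormalBasis ℂ V l))) y₀ := by
    refine ContDiffAt.sum fun k _ => ContDiffAt.sum fun l _ => ?_
    refine ((hcs v k).mul ?_).mul ?_
    · exact (Complex.conjCLE : ℂ →L[ℝ] ℂ).contDiff.contDiffAt.comp y₀ (hcs w l)
    · have h1 := (H.smooth (e.symm y₀) (stdOrthonormalBasis ℂ V k)
        (stdOrthonormalBasis ℂ V l)).contMDiffAt (t₀.open_baseSet.mem_nhds hy₀)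
      exact (h1.comp y₀ h.contMDiff_symm.contMDiffAt).contDiffAt
  refine key.congr_of_eventuallyEq ?_
  filter_upwards [h.continuous_symm.continuousAt.preimage_mem_nhds
    (t₀.open_baseSet.mem_nhds hy₀)] with y hy
  simp only [gram]
  rw [hexp v y hy, hexp w y hy]
  simp only [map_sum, map_smulₛₗ, LinearMap.sum_apply, LinearMap.smul_apply, smul_eq_mul,
    RingHom.id_apply, Finset.mul_sum, mul_assoc]
  rw [Finset.sum_comm]
  refine Finset.sum_congr rfl fun k _ => Finset.sum_congr rfl fun l _ => ?_
  ring

lemma continuous_gram (h : LocalFrame e t) (H : HermitianMetric n V E) {u w : Euc n → V}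
    (hu : Continuous u) (hw : Continuous w) : Continuous fun y => h.gram H y (u y) (w y) := by
  simp_rw [h.gram_eq_sum H _ (u _) (w _)]
  refine continuous_finsetSum _ fun k _ => continuous_finsetSum _ fun l _ => ?_
  have := (h.contDiff_gram H (stdOrthonormalBasis ℂ V k) (stdOrthonormalBasis ℂ V l)).continuous
  refine ((by fun_prop : Continuous fun y => inner ℂ (stdOrthonormalBasis ℂ V k) (u y)).mul
    (Complex.continuous_conj.comp (by fun_prop))).mul this

/-- The endomorphism that represents a hermitean metric in a local frame. -/
def gramCLM (h : LocalFrame e t) (H : HermitianMetric n V E) (y : Euc n) : V →L[ℂ] V :=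
  ∑ j, ∑ k, h.gram H y (stdOrthonormalBasis ℂ V j) (stdOrthonormalBasis ℂ V k) •
    (innerSL ℂ (stdOrthonormalBasis ℂ V j)).smulRight (stdOrthonormalBasis ℂ V k)

lemma gramCLM_apply (h : LocalFrame e t) (H : HermitianMetric n V E) (y : Euc n) (v : V) :
    h.gramCLM H y v =
      ∑ k, h.gram H y v (stdOrthonormalBasis ℂ V k) • stdOrthonormalBasis ℂ V k := by
  have h1 : ∀ k, h.gram H y v (stdOrthonormalBasis ℂ V k) =
      ∑ j, inner ℂ (stdOrthonormalBasis ℂ V j) v *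
        h.gram H y (stdOrthonormalBasis ℂ V j) (stdOrthonormalBasis ℂ V k) := by
    intro k
    conv_lhs => rw [← (stdOrthonormalBasis ℂ V).sum_repr' v]
    simp only [gram, map_sum, map_smul, LinearMap.sum_apply, LinearMap.smul_apply, smul_eq_mul]
  simp only [gramCLM, _root_.sum_apply, _root_.smul_apply, ContinuousLinearMap.smulRight_apply,
    innerSL_apply_apply, h1, Finset.sum_smul]
  rw [Finset.sum_comm]
  refine Finset.sum_congr rfl fun k _ => Finset.sum_congr rfl fun l _ => ?_
  rw [smul_smul, mul_comm]

/-- Positivity of the metric makes the endomorphism injective, hence bijective in finite dimension.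
-/
lemma isUnit_gramCLM (h : LocalFrame e t) (H : HermitianMetric n V E) (y : Euc n) :
    IsUnit (h.gramCLM H y) := by
  have : CompleteSpace V := FiniteDimensional.complete ℂ V
  have hinj : Function.Injective (h.gramCLM H y) := by
    rw [injective_iff_map_eq_zero]
    intro v hv
    have h1 : ∀ k, h.gram H y v (stdOrthonormalBasis ℂ V k) = 0 := by
      intro k
      have h2 := congrArg (inner ℂ (stdOrthonormalBasis ℂ V k)) hv
      rw [gramCLM_apply, (stdOrthonormalBasis ℂ V).orthonormal.inner_right_fintype,
        inner_zero_right] at h2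
      exact h2
    by_contra hne
    have h2 : (h.equiv y).symm v ≠ 0 := by simpa using hne
    have h3 : h.gram H y v v = 0 := by
      conv_lhs => rw [← (stdOrthonormalBasis ℂ V).sum_repr' v]
      have h4 : ∀ u : V, h.gram H y u (∑ k, inner ℂ (stdOrthonormalBasis ℂ V k) v •
          stdOrthonormalBasis ℂ V k) = ∑ k, conj (inner ℂ (stdOrthonormalBasis ℂ V k) v) *
            h.gram H y u (stdOrthonormalBasis ℂ V k) := by
        intro u
        simp only [gram, map_sum, map_smul, map_smulₛₗ, smul_eq_mul]
      rw [h4, (stdOrthonormalBasis ℂ V).sum_repr' v]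
      simp [h1]
    have h5 := H.pos _ _ h2
    rw [show H.form (e.symm y) ((h.equiv y).symm v) ((h.equiv y).symm v) = 0 from h3] at h5
    simp at h5
  rw [ContinuousLinearMap.isUnit_iff_bijective]
  exact ⟨hinj, (LinearMap.injective_iff_surjective (f := (h.gramCLM H y).toLinearMap)).1 hinj⟩

lemma contDiff_gramCLM (h : LocalFrame e t) (H : HermitianMetric n V E) :
    ContDiff ℝ ∞ (h.gramCLM H) := by
  unfold gramCLM
  exact ContDiff.sum fun j _ => ContDiff.sum fun k _ => (h.contDiff_gram H _ _).smul contDiff_const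

variable [T2Space M] [MeasurableSpace M] [BorelSpace M] {μ : Measure M}

/-- The functional on sections that is given by a smooth compactly-supported family of linear forms
in a local frame is the pairing with a test section. -/
lemma exists_dual_section (hμ : IsSmoothMeasure n μ) (h : LocalFrame e t)
    (H : HermitianMetric n V E) {l : Euc n → V →L[ℂ] ℂ} (hl : ContDiff ℝ ∞ l)
    (hlc : HasCompactSupport l) :
    ∃ Θ : ∀ x, E x, IsTestSection n V Θ ∧
      ∀ g : ∀ x, E x, H.pairing μ g Θ = ∫ y, l y (localRep e t g y) := by
  have : CompleteSpace V := FiniteDimensional.complete ℂ V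
  obtain ⟨ρ, hρ, hρ0, hρi⟩ := hμ.integral_chart h.mem h.target
  -- The coefficients are conjugated because the test section stands in the conjugate-linear slot,
  -- and the reciprocal of `ρ` cancels the density of the measure. Then `θ` is the solution of
  -- `gramCLM θ = lam`.
  set lam : Euc n → V := fun y => (ρ y)⁻¹ • ∑ k, conj (l y (stdOrthonormalBasis ℂ V k)) •
    stdOrthonormalBasis ℂ V k with hlam
  set θ : Euc n → V := fun y => Ring.inverse (h.gramCLM H y) (lam y) with hθ
  have hlams : ContDiff ℝ ∞ lam := by
    refine (hρ.inv fun y => (hρ0 y).ne').smul (ContDiff.sum fun k _ => ?_)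
    refine ContDiff.smul ?_ contDiff_const
    exact (Complex.conjCLE : ℂ →L[ℝ] ℂ).contDiff.comp
      (contDiff_complexCLM_apply hl contDiff_const)
  -- Inversion is smooth at every unit, so pointwise invertibility of the Gram endomorphism is
  -- enough.
  have hinv : ContDiff ℝ ∞ fun y => Ring.inverse (h.gramCLM H y) := by
    rw [contDiff_iff_contDiffAt]
    intro y
    obtain ⟨u, hu⟩ := h.isUnit_gramCLM H y
    have h1 := (contDiffAt_ringInverse ℂ (n := ∞) u).restrict_scalars ℝ
    rw [hu] at h1
    exact h1.comp y (h.contDiff_gramCLM H).contDiffAt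
  have hθs : ContDiff ℝ ∞ θ := contDiff_complexCLM_apply hinv hlams
  have hθc : HasCompactSupport θ := by
    refine hlc.mono fun y hy h0 => hy ?_
    simp [hθ, hlam, h0]
  have hG : ∀ y, h.gramCLM H y (θ y) = lam y := by
    intro y
    have h1 := Ring.mul_inverse_cancel _ (h.isUnit_gramCLM H y)
    exact congrArg (fun T : V →L[ℂ] V => T (lam y)) h1
  have hgr : ∀ y v, h.gram H y v (θ y) = (ρ y)⁻¹ • l y v := by
    intro y v
    have h1 : ∀ k, h.gram H y (stdOrthonormalBasis ℂ V k) (θ y) =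
        (ρ y)⁻¹ • l y (stdOrthonormalBasis ℂ V k) := by
      intro k
      have h2 := congrArg (inner ℂ (stdOrthonormalBasis ℂ V k)) (hG y)
      rw [gramCLM_apply, (stdOrthonormalBasis ℂ V).orthonormal.inner_right_fintype] at h2
      simp only [hlam] at h2
      rw [← Complex.coe_smul, inner_smul_right,
        (stdOrthonormalBasis ℂ V).orthonormal.inner_right_fintype] at h2
      have h3 : h.gram H y (stdOrthonormalBasis ℂ V k) (θ y) =
          conj (h.gram H y (θ y) (stdOrthonormalBasis ℂ V k)) := H.conj_symm _ _ _
      rw [h3, h2, map_mul, Complex.conj_conj, Complex.conj_ofReal, ← smul_eq_mul, Complex.coe_smul]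
    conv_lhs => rw [← (stdOrthonormalBasis ℂ V).sum_repr' v]
    conv_rhs => rw [← (stdOrthonormalBasis ℂ V).sum_repr' v]
    have h4 : ∀ u : V, h.gram H y (∑ k, inner ℂ (stdOrthonormalBasis ℂ V k) v •
          stdOrthonormalBasis ℂ V k) u = ∑ k, (inner ℂ (stdOrthonormalBasis ℂ V k) v) *
            h.gram H y (stdOrthonormalBasis ℂ V k) u := by
      intro u
      simp only [gram, map_sum, map_smul, LinearMap.sum_apply, LinearMap.smul_apply, smul_eq_mul]
    rw [h4, map_sum, Finset.smul_sum]
    refine Finset.sum_congr rfl fun k _ => ?_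
    rw [h1, map_smul, smul_eq_mul, mul_smul_comm]
  refine ⟨fromLocal e t θ, h.isTestSection_fromLocal hθs hθc, fun g => ?_⟩
  rw [HermitianMetric.pairing, hρi _ fun x hx => by rw [fromLocal_of_notMem _ hx, map_zero]]
  refine integral_congr_ae (Eventually.of_forall fun y => ?_)
  have h1 := h.gram_localRep H g (fromLocal e t θ) y
  rw [h.localRep_fromLocal, hgr] at h1
  simp only
  rw [← h1, smul_inv_smul₀ (hρ0 y).ne']

end LocalFrame

variable [FiniteDimensional ℂ V] [VectorBundle ℂ V E] [VectorBundle ℝ V E]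
  [ContMDiffVectorBundle ∞ V E (𝓡 n)] [IsManifold (𝓡 n) ∞ M]
  [T2Space M] [MeasurableSpace M] [BorelSpace M] {μ : Measure M}

/-- Test sections are determined by their pairings with test sections. -/
lemma IsTestSection.eq_of_pairing (hμ : IsSmoothMeasure n μ) {A : Type*} {𝒜 : GoodAtlas n M A}
    (τ : GoodTriv 𝒜 V E) (H : HermitianMetric n V E) {ψ ψ' : ∀ x, E x} (hψ : IsTestSection n V ψ)
    (hψ' : IsTestSection n V ψ')
    (h : ∀ g : ∀ x, E x, IsTestSection n V g → H.pairing μ g ψ = H.pairing μ g ψ') : ψ = ψ' := by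
  ext x
  obtain ⟨α, y₀, rfl⟩ := 𝒜.exists_mem x
  have hα := τ.localFrame α
  set e := 𝒜.chart α
  set t := τ.triv α
  obtain ⟨ρ, hρ, hρ0, hρi⟩ := hμ.integral_chart hα.mem hα.target
  let χ : ContDiffBump y₀ := ⟨1, 2, by norm_num, by norm_num⟩
  -- Testing with `χ (ψ - ψ')`, for a bump function `χ` at the point in question, gives a vanishing
  -- integral of the continuous nonnegative function `ρ χ ⟨d, d⟩`, so `d` vanishes at `y₀`.
  set d : Euc n → V := localRep e t (ψ - ψ') with hd
  have hds : ContDiff ℝ ∞ d := hα.contDiff_localRep (hψ.1.sub hψ'.1)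
  set w : Euc n → V := fun y => χ y • d y with hw
  have hws : ContDiff ℝ ∞ w := χ.contDiff.smul hds
  have hwc : HasCompactSupport w := χ.hasCompactSupport.smul_right
  have hg := hα.isTestSection_fromLocal (E := E) hws hwc
  have hpair : ∀ θ : ∀ x, E x, H.pairing μ (fromLocal e t w) θ =
      ∫ y, ρ y • hα.gram H y (w y) (localRep e t θ y) := by
    intro θ
    rw [HermitianMetric.pairing, hρi _ fun x hx => by
      rw [LocalFrame.fromLocal_of_notMem _ hx, map_zero, LinearMap.zero_apply]]
    refine integral_congr_ae (Eventually.of_forall fun y => ?_)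
    have h1 := hα.gram_localRep H (fromLocal e t w) θ y
    rw [hα.localRep_fromLocal] at h1
    simp only
    rw [← h1]
  have hint : ∀ θ : ∀ x, E x, IsSmoothSection n V θ →
      Integrable fun y => ρ y • hα.gram H y (w y) (localRep e t θ y) := by
    intro θ hθ
    refine Continuous.integrable_of_hasCompactSupport ?_ ?_
    · exact hρ.continuous.smul
        (hα.continuous_gram H hws.continuous (hα.contDiff_localRep hθ).continuous)
    · refine hwc.mono fun y hy h0 => hy ?_
      simp [LocalFrame.gram, h0]
  have h1 := h _ hg
  rw [hpair, hpair, ← sub_eq_zero, ← integral_sub (hint _ hψ.1) (hint _ hψ'.1)] at h1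
  set F : Euc n → ℝ := fun y => ρ y * χ y * (hα.gram H y (d y) (d y)).re with hF
  have h2 : (fun y => ρ y • hα.gram H y (w y) (localRep e t ψ y) -
      ρ y • hα.gram H y (w y) (localRep e t ψ' y)) =
      fun y => ((ρ y * χ y : ℝ) : ℂ) * hα.gram H y (d y) (d y) := by
    ext y
    rw [← smul_sub]
    have h3 : hα.gram H y (w y) (localRep e t ψ y) - hα.gram H y (w y) (localRep e t ψ' y) =
        hα.gram H y (w y) (d y) := by
      rw [hd, hα.localRep_sub, Pi.sub_apply]
      simp only [LocalFrame.gram, map_sub]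
    have h4 : hα.gram H y (w y) (d y) = (χ y : ℂ) * hα.gram H y (d y) (d y) := by
      rw [hw]
      simp only [LocalFrame.gram]
      rw [← Complex.coe_smul, map_smul, map_smul, LinearMap.smul_apply, smul_eq_mul]
    rw [h3, h4, ← Complex.coe_smul, smul_eq_mul, Complex.ofReal_mul, mul_assoc]
  rw [h2] at h1
  have hcF : Continuous F := by
    have h3 := hα.continuous_gram H hds.continuous hds.continuous
    have h4 := χ.continuous
    exact (hρ.continuous.mul h4).mul (Complex.continuous_re.comp h3)
  have hF0 : 0 ≤ F := by
    intro y
    refine mul_nonneg (mul_nonneg (hρ0 y).le χ.nonneg) ?_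
    rcases eq_or_ne ((hα.equiv y).symm (d y)) 0 with h0 | h0
    · simp [LocalFrame.gram, h0]
    · exact (H.pos _ _ h0).le
  have hFc : HasCompactSupport F := by
    refine χ.hasCompactSupport.mono fun y hy h0 => hy ?_
    simp [hF, h0]
  have hFi : ∫ y, F y = 0 := by
    have hi : Integrable fun y => ((ρ y * χ y : ℝ) : ℂ) * hα.gram H y (d y) (d y) := by
      rw [← h2]
      exact (hint _ hψ.1).sub (hint _ hψ'.1)
    have h3 := (Complex.reCLM.integral_comp_comm hi)
    rw [h1] at h3
    simpa [hF] using h3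
  by_contra hne
  have hFne : F y₀ ≠ 0 := by
    have h0 : (hα.equiv y₀).symm (d y₀) ≠ 0 := by
      rw [hd, hα.localRep_eq, LinearEquiv.symm_apply_apply]
      exact sub_ne_zero.2 hne
    refine mul_ne_zero (mul_ne_zero (hρ0 y₀).ne' ?_) (H.pos _ _ h0).ne'
    rw [χ.one_of_mem_closedBall (Metric.mem_closedBall_self zero_le_one)]
    exact one_ne_zero
  exact (hcF.integral_pos_of_hasCompactSupport_nonneg_nonzero hFc hF0 hFne).ne' hFi

end Gram

/-! ### Distributions and their mollifiers -/

lemma integrable_complexCLM_apply {n : ℕ} {V W : Type*} [NormedAddCommGroup V] [NormedSpace ℂ V]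
    [NormedAddCommGroup W] [NormedSpace ℂ W] {T : Euc n → V →L[ℂ] W} {u : Euc n → V}
    (hT : Continuous T) (hTc : HasCompactSupport T) (hu : LocallyIntegrable u volume) :
    Integrable fun y => T y (u y) := by
  obtain ⟨C, hC⟩ := hTc.exists_bound_of_continuous hT
  have hs : Function.support (fun y => T y (u y)) ⊆ tsupport T := by
    intro y hy
    by_contra hy'
    exact hy (by simp [image_eq_zero_of_notMem_tsupport hy'])
  rw [← integrableOn_iff_integrable_of_support_subset hs]
  refine Integrable.mono' ((hu.integrableOn_isCompact hTc).norm.const_mul C)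
    ((ContinuousLinearMap.id ℂ (V →L[ℂ] W)).aestronglyMeasurable_comp₂
      hT.aestronglyMeasurable hu.aestronglyMeasurable).restrict
    (Eventually.of_forall fun y => ((T y).le_opNorm _).trans ?_)
  gcongr
  exact hC y

section Dist

variable {n : ℕ} {M : Type*} [TopologicalSpace M] [ChartedSpace (Euc n) M]
  [IsManifold (𝓡 n) ∞ M] [T2Space M] [MeasurableSpace M] [BorelSpace M] {μ : Measure M}
variable {V : Type*} [NormedAddCommGroup V] [InnerProductSpace ℂ V] [FiniteDimensional ℂ V]
  {E : M → Type*} [∀ x, AddCommGroup (E x)] [∀ x, Module ℂ (E x)]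
  [∀ x, TopologicalSpace (E x)] [TopologicalSpace (TotalSpace V E)] [FiberBundle V E]
  [VectorBundle ℂ V E] [VectorBundle ℝ V E] [ContMDiffVectorBundle ∞ V E (𝓡 n)]
variable {W : Type*} [NormedAddCommGroup W] [InnerProductSpace ℂ W] [FiniteDimensional ℂ W]
  {F : M → Type*} [∀ x, AddCommGroup (F x)] [∀ x, Module ℂ (F x)]
  [∀ x, TopologicalSpace (F x)] [TopologicalSpace (TotalSpace W F)] [FiberBundle W F]
  [VectorBundle ℂ W F] [VectorBundle ℝ W F] [ContMDiffVectorBundle ∞ W F (𝓡 n)]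
variable {A : Type*} {𝒜 : GoodAtlas n M A}

lemma GoodTriv.cutRep_eq (τ : GoodTriv 𝒜 V E) (α : A) (f : ∀ x, E x) :
    τ.cutRep α f = fun y => 𝒜.cut α y • localRep (𝒜.chart α) (τ.triv α) f y := by
  ext y
  exact (τ.localFrame α).localRep_mul _ _ _

lemma GoodAtlas.hasCompactSupport_cut (𝒜 : GoodAtlas n M A) (α : A) :
    HasCompactSupport (𝒜.cut α) :=
  (isCompact_closedBall (0 : Euc n) 1).of_isClosed_subset (isClosed_tsupport _)
    ((𝒜.tsupport_cut α).trans Metric.ball_subset_closedBall)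

/-- Multiplication with a function, followed by a component, as a family of linear forms. -/
lemma contDiff_smul_innerSL {θ : Euc n → ℝ} (hθ : ContDiff ℝ ∞ θ) (v : V) :
    ContDiff ℝ ∞ fun y => θ y • innerSL ℂ v :=
  hθ.smul contDiff_const

/-- The transpose is the dual section of the linear forms `κ η_α ⟨v, ·⟩`. Its pairing formula holds
for all sections, not only for test sections, and this is what later evaluates the pairing with a
locally integrable weak derivative. -/
lemma GoodTriv.exists_isTransposeAt (hμ : IsSmoothMeasure n μ) (τ : GoodTriv 𝒜 V E)
    (H : HermitianMetric n V E) (α : A) {κ : Euc n → ℝ} (hκ : ContDiff ℝ ∞ κ) (v : V) :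
    ∃ Ψ : ∀ x, E x, τ.IsTransposeAt μ H α (fun y => κ y • v) Ψ ∧
      ∀ f : ∀ x, E x, H.pairing μ f Ψ = ∫ y, (κ y * 𝒜.cut α y) •
        inner ℂ v (localRep (𝒜.chart α) (τ.triv α) f y) := by
  have hs : ContDiff ℝ ∞ fun y => (κ y * 𝒜.cut α y) • innerSL ℂ v :=
    contDiff_smul_innerSL (hκ.mul (𝒜.contDiff_cut α)) v
  have hc : HasCompactSupport fun y => (κ y * 𝒜.cut α y) • innerSL ℂ v :=
    (𝒜.hasCompactSupport_cut α).mono fun y hy h0 => hy (by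
      simp only [h0, mul_zero]
      exact zero_smul ℝ (innerSL ℂ v : V →L[ℂ] ℂ))
  obtain ⟨Ψ, hΨ, h⟩ := (τ.localFrame α).exists_dual_section hμ H hs hc
  refine ⟨Ψ, ⟨hΨ, fun g hg => ?_⟩, h⟩
  rw [h]
  refine integral_congr_ae (Eventually.of_forall fun y => ?_)
  simp only [τ.cutRep_eq, ← Complex.coe_smul, inner_smul_left, inner_smul_right,
    _root_.smul_apply, innerSL_apply_apply, Complex.conj_ofReal, smul_eq_mul]
  push_cast
  ring

/-- The definition selects some transposed test section; pairings determine test sections, so any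
explicit one gives the same value. The same reason applies to `adjoint_eq`. -/
lemma GoodTriv.cutRepDist_eq (hμ : IsSmoothMeasure n μ) (τ : GoodTriv 𝒜 V E)
    (H : HermitianMetric n V E) (α : A) (u : (∀ x, E x) → ℂ) {ψ : Euc n → V} {Ψ : ∀ x, E x}
    (hΨ : τ.IsTransposeAt μ H α ψ Ψ) : τ.cutRepDist μ H α u ψ = u Ψ := by
  have hex : ∃ Ψ, τ.IsTransposeAt μ H α ψ Ψ := ⟨Ψ, hΨ⟩
  rw [GoodTriv.cutRepDist, dif_pos hex]
  congr 1
  refine IsTestSection.eq_of_pairing hμ τ H hex.choose_spec.1 hΨ.1 fun g hg => ?_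
  rw [← hex.choose_spec.2 g hg, ← hΨ.2 g hg]

/-! ### The distribution `D f` and its mollification, computed in charts. -/

namespace FirstOrderOp

variable {D : FirstOrderOp n V E W F} {hE : HermitianMetric n V E} {hF : HermitianMetric n W F}

lemma adjoint_eq (hμ : IsSmoothMeasure n μ) (τE : GoodTriv 𝒜 V E) {φ : ∀ x, F x} {ψ : ∀ x, E x}
    (hψ : D.IsAdjointAt μ hE hF φ ψ) : D.adjoint μ hE hF φ = ψ := by
  have hex : ∃ ψ, D.IsAdjointAt μ hE hF φ ψ := ⟨ψ, hψ⟩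
  rw [adjoint, dif_pos hex]
  refine IsTestSection.eq_of_pairing hμ τE hE hex.choose_spec.1 hψ.1 fun g hg => ?_
  rw [← hex.choose_spec.2 g hg, ← hψ.2 g hg]

/-- The distribution `D f` in a chart. -/
lemma LocalCoeff.distApp_eq (hμ : IsSmoothMeasure n μ) {τE : GoodTriv 𝒜 V E}
    {τF : GoodTriv 𝒜 W F} {α : A} {a : Fin n → Euc n → V →L[ℂ] W} {b : Euc n → V →L[ℂ] W}
    (h : D.LocalCoeff τE τF α a b) {θ : Euc n → ℝ} (hθ : ContDiff ℝ ∞ θ)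
    (hθ3 : ∀ y ∉ Metric.closedBall (0 : Euc n) 3, θ y = 0) (v : W) {Φ : ∀ x, F x}
    (hΦ : ∀ g : ∀ x, F x, hF.pairing μ g Φ =
      ∫ y, θ y • inner ℂ v (localRep (𝒜.chart α) (τF.triv α) g y)) (f : ∀ x, E x) :
    D.distApp μ hE hF f Φ =
      ∫ y, inner ℂ v (transposeCoeff a b θ y (localRep (𝒜.chart α) (τE.triv α) f y)) := by
  have hθc : HasCompactSupport θ := HasCompactSupport.intro (isCompact_closedBall _ _) hθ3
  have hT := contDiff_transposeCoeff h.smooth_a h.smooth_b hθ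
  have hTc := hasCompactSupport_transposeCoeff (a := a) (b := b) hθc
  have hl : ContDiff ℝ ∞ fun y => (innerSL ℂ v).comp (transposeCoeff a b θ y) :=
    ((ContinuousLinearMap.compL ℂ V W ℂ (innerSL ℂ v)).restrictScalars ℝ).contDiff.comp hT
  have hlc : HasCompactSupport fun y => (innerSL ℂ v).comp (transposeCoeff a b θ y) :=
    hTc.mono fun y hy h0 => hy (by simp [h0])
  obtain ⟨ψ, hψ, hψp⟩ := (τE.localFrame α).exists_dual_section hμ hE hl hlc
  -- The dual section `ψ` of the forms `⟨v, transposeCoeff ·⟩` is the value of the formal adjoint,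
  -- by integration by parts; the coordinate expression is available because `θ` vanishes off the
  -- ball of radius 3.
  have hadj : D.IsAdjointAt μ hE hF Φ ψ := by
    refine ⟨hψ, fun g hg => ?_⟩
    have hw := (τE.localFrame α).contDiff_localRep hg.1
    set w := localRep (𝒜.chart α) (τE.triv α) g with hwdef
    have hwl : LocallyIntegrable w volume := hw.continuous.locallyIntegrable
    have hop : Continuous fun y => θ y • localOp a b w y := by
      unfold localOp
      refine hθ.continuous.smul ((contDiff_complexCLM_apply h.smooth_b hw).continuous.add
        (continuous_finsetSum _ fun j _ => ?_))
      exact (contDiff_complexCLM_apply (h.smooth_a j) (contDiff_pd hw j)).continuous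
    have hopi : Integrable fun y => θ y • localOp a b w y :=
      hop.integrable_of_hasCompactSupport hθc.smul_right
    rw [hΦ, hψp]
    have e1 : ∀ y, θ y • inner ℂ v (localRep (𝒜.chart α) (τF.triv α) (D.app g) y) =
        innerSL ℂ v (θ y • localOp a b w y) := by
      intro y
      by_cases hy : y ∈ Metric.closedBall (0 : Euc n) 3
      · rw [h.form g hg.1 y hy, ContinuousLinearMap.map_smul_of_tower, innerSL_apply_apply]
      · simp [hθ3 y hy]
    simp_rw [e1, ContinuousLinearMap.comp_apply]
    rw [(innerSL ℂ v).integral_comp_comm hopi,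
      (innerSL ℂ v).integral_comp_comm (integrable_complexCLM_apply hT.continuous hTc hwl),
      integral_transposeCoeff h.smooth_a h.smooth_b hθ hθc hw]
    rfl
  rw [distApp, adjoint_eq hμ τE hadj, hψp]
  rfl

/-- The mollification of the distribution `D f` in a chart. -/
lemma LocalCoeff.mollifyDist_distApp (hμ : IsSmoothMeasure n μ) {τE : GoodTriv 𝒜 V E}
    {τF : GoodTriv 𝒜 W F} {α : A} {a : Fin n → Euc n → V →L[ℂ] W} {b : Euc n → V →L[ℂ] W}
    (h : D.LocalCoeff τE τF α a b) (φ : Kernel n) (t : ℝ) {f : ∀ x, E x}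
    (hf : LocallyIntegrable (localRep (𝒜.chart α) (τE.triv α) f) volume) (x : Euc n) :
    φ.mollifyDist t (τF.cutRepDist μ hF α (D.distApp μ hE hF f)) x =
      ∫ y, transposeCoeff a b (fun y => φ.scaled t (x - y) * 𝒜.cut α y) y
        (localRep (𝒜.chart α) (τE.triv α) f y) := by
  have : CompleteSpace W := FiniteDimensional.complete ℂ W
  have hκ : ContDiff ℝ ∞ fun y => φ.scaled t (x - y) :=
    (φ.contDiff_scaled t).comp (contDiff_const.sub contDiff_id)
  have hθ := hκ.mul (𝒜.contDiff_cut α)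
  have hθ3 : ∀ y ∉ Metric.closedBall (0 : Euc n) 3, φ.scaled t (x - y) * 𝒜.cut α y = 0 := by
    intro y hy
    rw [image_eq_zero_of_notMem_tsupport (f := 𝒜.cut α), mul_zero]
    exact fun h' => hy (Metric.ball_subset_closedBall
      (Metric.ball_subset_ball (by norm_num) (𝒜.tsupport_cut α h')))
  have hθc := HasCompactSupport.intro (isCompact_closedBall (0 : Euc n) 3) hθ3
  have hint := integrable_complexCLM_apply
    (contDiff_transposeCoeff h.smooth_a h.smooth_b hθ).continuous
    (hasCompactSupport_transposeCoeff (a := a) (b := b) hθc) hf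
  rw [Kernel.mollifyDist, ← (stdOrthonormalBasis ℂ W).sum_repr' (∫ y, transposeCoeff a b _ y _)]
  refine Finset.sum_congr rfl fun k _ => ?_
  obtain ⟨Ψ, hΨ, hΨp⟩ := τF.exists_isTransposeAt hμ hF α hκ (stdOrthonormalBasis ℂ W k)
  rw [τF.cutRepDist_eq hμ hF α _ hΨ, h.distApp_eq hμ hθ hθ3 _ hΨp]
  congr 1
  exact (innerSL ℂ (stdOrthonormalBasis ℂ W k)).integral_comp_comm hint

/-- This reconciles the two definitions of the mollifier: for a distribution that is given by a
locally integrable section, the components of the distributional version are the pairings with the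
transposed test functions, that is, the components of the convolution. -/
lemma IsWeakDeriv.mollifyDist_distApp (hμ : IsSmoothMeasure n μ) (τF : GoodTriv 𝒜 W F) (α : A)
    (φ : Kernel n) {t : ℝ} (ht : t ∈ Ioc (0 : ℝ) 1) {f : ∀ x, E x} {g : ∀ x, F x}
    (hfg : D.IsWeakDeriv μ hE hF f g)
    (hg : LocallyIntegrable (localRep (𝒜.chart α) (τF.triv α) g) volume) (x : Euc n) :
    φ.mollifyDist t (τF.cutRepDist μ hF α (D.distApp μ hE hF f)) x =
      φ.mollify t (τF.cutRep α g) x := by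
  have : CompleteSpace W := FiniteDimensional.complete ℂ W
  have hκ : ContDiff ℝ ∞ fun y => φ.scaled t (x - y) :=
    (φ.contDiff_scaled t).comp (contDiff_const.sub contDiff_id)
  have hint : Integrable fun y => φ.scaled t (x - y) • τF.cutRep α g y := by
    have h1 : LocallyIntegrable (τF.cutRep α g) volume := by
      rw [τF.cutRep_eq]
      exact hg.continuous_smul (𝒜.contDiff_cut α).continuous
    simpa [Kernel.mollKer] using φ.approxKernel_mollKer (V := W) |>.integrable_apply ht h1 x
  rw [Kernel.mollifyDist, ← (stdOrthonormalBasis ℂ W).sum_repr' (φ.mollify t _ x)]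
  refine Finset.sum_congr rfl fun k _ => ?_
  obtain ⟨Ψ, hΨ, hΨp⟩ := τF.exists_isTransposeAt hμ hF α hκ (stdOrthonormalBasis ℂ W k)
  rw [τF.cutRepDist_eq hμ hF α _ hΨ, hfg _ hΨ.1, hΨp]
  congr 1
  rw [Kernel.mollify, ← innerSL_apply_apply ℂ,
    ← (innerSL ℂ (stdOrthonormalBasis ℂ W k)).integral_comp_comm hint]
  refine integral_congr_ae (Eventually.of_forall fun y => ?_)
  simp only [τF.cutRep_eq, ← Complex.coe_smul, innerSL_apply_apply, inner_smul_right, smul_eq_mul]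
  push_cast
  ring

end FirstOrderOp

/-! ### Mollifiers and commutators as sums over the charts. -/

section Global

variable [SigmaCompactSpace M] {D : FirstOrderOp n V E W F} {hE : HermitianMetric n V E}
  {hF : HermitianMetric n W F}

lemma GoodAtlas.finite_mem (𝒜 : GoodAtlas n M A) (x : M) :
    {α | x ∈ (𝒜.chart α).source}.Finite :=
  𝒜.locallyFinite.point_finite x

lemma GoodTriv.finite_support (τ : GoodTriv 𝒜 V E) (w : A → Euc n → V) (x : M) :
    (Function.support fun α => fromLocal (E := E) (𝒜.chart α) (τ.triv α) (w α) x).Finite :=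
  (𝒜.finite_mem x).subset fun _ hα => by_contra fun h =>
    hα (LocalFrame.fromLocal_of_notMem _ h)

lemma GoodTriv.locallyFinite_support (τ : GoodTriv 𝒜 V E) (w : A → Euc n → V) :
    LocallyFinite fun α => {x | fromLocal (E := E) (𝒜.chart α) (τ.triv α) (w α) x ≠ 0} :=
  𝒜.locallyFinite.subset fun _ _ hx => by_contra fun h =>
    hx (LocalFrame.fromLocal_of_notMem _ h)

lemma GoodTriv.cutRep_eq_zero (τ : GoodTriv 𝒜 V E) (α : A) (f : ∀ x, E x) {y : Euc n}
    (hy : y ∉ Metric.ball (0 : Euc n) 1) : τ.cutRep α f y = 0 := by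
  rw [τ.cutRep_eq]
  simp only
  rw [image_eq_zero_of_notMem_tsupport (fun h => hy (𝒜.tsupport_cut α h)), zero_smul]

/-- The cutoff lives in the unit ball, and mollification with `t ≤ 1` widens supports by at most 1;
hence the radius 2. -/
lemma GoodTriv.mollify_eq_zero (τ : GoodTriv 𝒜 V E) (φ : Kernel n) (α : A) (f : ∀ x, E x) {t : ℝ}
    (ht : t ∈ Ioc (0 : ℝ) 1) {y : Euc n} (hy : y ∉ Metric.closedBall (0 : Euc n) 2) :
    φ.mollify t (τ.cutRep α f) y = 0 := by
  refine φ.mollify_eq_zero ht fun z hz => τ.cutRep_eq_zero α f fun hz1 => hy ?_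
  rw [mem_closedBall_zero_iff]
  rw [mem_ball_zero_iff] at hz1
  have := norm_add_le (y - z) z
  rw [sub_add_cancel] at this
  linarith [ht.2]

lemma GoodTriv.locallyIntegrable_cutRep (τ : GoodTriv 𝒜 V E) {α : A} {f : ∀ x, E x}
    (hf : LocallyIntegrable (localRep (𝒜.chart α) (τ.triv α) f) volume) :
    LocallyIntegrable (τ.cutRep α f) volume := by
  rw [τ.cutRep_eq]
  exact hf.continuous_smul (𝒜.contDiff_cut α).continuous

lemma GoodTriv.isSmoothSection_mollify (τ : GoodTriv 𝒜 V E) (φ : Kernel n) (ε : Params A)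
    {f : ∀ x, E x} (hf : ∀ α, LocallyIntegrable (localRep (𝒜.chart α) (τ.triv α) f) volume) :
    IsSmoothSection n V (τ.mollify φ ε f) := by
  refine isSmoothSection_finsum (fun α => ?_) (τ.locallyFinite_support _)
  have : CompleteSpace V := FiniteDimensional.complete ℂ V
  exact (τ.localFrame α).isSmoothSection_fromLocal
    (φ.contDiff_mollify (ε α).2.1 (τ.locallyIntegrable_cutRep (hf α)))
    (HasCompactSupport.intro (isCompact_closedBall _ _)
      fun y hy => τ.mollify_eq_zero φ α f (ε α).2 hy)

/-- The symbol of the commutator of a differential operator with a cutoff function. -/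
def cutSymbol (𝒜 : GoodAtlas n M A) (a : A → Fin n → Euc n → V →L[ℂ] W) (α : A) (y : Euc n) :
    V →L[ℂ] W :=
  ∑ j, pd j (𝒜.cut α) y • a α j y

/-- The commutator of a differential operator with the mollifiers, in terms of integral operators
in the charts. -/
lemma commutator_eq_finsum (hμ : IsSmoothMeasure n μ) (τE : GoodTriv 𝒜 V E) (τF : GoodTriv 𝒜 W F)
    (φ : Kernel n) (ε : Params A) {a : A → Fin n → Euc n → V →L[ℂ] W} {b : A → Euc n → V →L[ℂ] W}
    (h : ∀ α, D.LocalCoeff τE τF α (a α) (b α)) {f : ∀ x, E x}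
    (hf : ∀ α, LocallyIntegrable (localRep (𝒜.chart α) (τE.triv α) f) volume) (x : M) :
    commutator τE τF φ μ hE hF D ε f x = ∑ᶠ α, fromLocal (E := F) (𝒜.chart α) (τF.triv α)
      (kerOp (φ.commKer (a α) (b α) (ε α)) (τE.cutRep α f) +
        φ.mollify (ε α) (fun y => cutSymbol 𝒜 a α y
          (localRep (𝒜.chart α) (τE.triv α) f y))) x := by
  have : CompleteSpace V := FiniteDimensional.complete ℂ V
  have : CompleteSpace W := FiniteDimensional.complete ℂ W
  have hs : ∀ α, ContDiff ℝ ∞ (φ.mollify (ε α) (τE.cutRep α f)) := fun α =>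
    φ.contDiff_mollify (ε α).2.1 (τE.locallyIntegrable_cutRep (hf α))
  have h0 : ∀ α, ∀ y ∉ Metric.closedBall (0 : Euc n) 2,
      φ.mollify (ε α) (τE.cutRep α f) y = 0 := fun α y hy =>
    τE.mollify_eq_zero φ α f (ε α).2 hy
  -- By locality `D` passes through the locally finite sum, and on each piece, supported in radius
  -- 2, it is given by the cut-off coefficients.
  have e1 : D.app (τE.mollify φ ε f) x = ∑ᶠ α, fromLocal (E := F) (𝒜.chart α) (τF.triv α)
      (localOp (a α) (b α) (φ.mollify (ε α) (τE.cutRep α f))) x := by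
    refine (FirstOrderOp.app_finsum τE τF
      (s := fun α => fromLocal (𝒜.chart α) (τE.triv α) (φ.mollify (ε α) (τE.cutRep α f)))
      (fun α => (τE.localFrame α).isSmoothSection_fromLocal (hs α)
        (HasCompactSupport.intro (isCompact_closedBall _ _) (h0 α)))
      (τE.locallyFinite_support _) x).trans ?_
    exact finsum_congr fun α => by rw [(h α).app_fromLocal (hs α) (h0 α)]
  rw [commutator, e1, GoodTriv.mollifyDist,
    ← finsum_sub_distrib (τF.finite_support _ x) (τF.finite_support _ x)]
  refine finsum_congr fun α => ?_
  have h2 := (τF.localFrame α).fromLocal_sub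
    (localOp (a α) (b α) (φ.mollify (ε α) (τE.cutRep α f)))
    (φ.mollifyDist (ε α) (τF.cutRepDist μ hF α (D.distApp μ hE hF f)))
  rw [← Pi.sub_apply, ← h2]
  congr 1
  ext y
  rw [Pi.sub_apply, (h α).mollifyDist_distApp hμ φ (ε α) (hf α), Pi.add_apply, τE.cutRep_eq]
  exact φ.commutator_formula (h α).smooth_a (h α).compact_a (h α).smooth_b (h α).compact_b
    (𝒜.contDiff_cut α) (hf α) (ε α).2 y

/-- By `IsWeakDeriv.mollifyDist_distApp` the distributional term of the commutator is `J_ε g`, so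
this is the definition of the commutator rearranged. -/
lemma FirstOrderOp.IsWeakDeriv.app_mollify (hμ : IsSmoothMeasure n μ) (τE : GoodTriv 𝒜 V E)
    (τF : GoodTriv 𝒜 W F) (φ : Kernel n) (ε : Params A) {f : ∀ x, E x} {g : ∀ x, F x}
    (hfg : D.IsWeakDeriv μ hE hF f g)
    (hg : ∀ α, LocallyIntegrable (localRep (𝒜.chart α) (τF.triv α) g) volume) :
    D.app (τE.mollify φ ε f) = commutator τE τF φ μ hE hF D ε f + τF.mollify φ ε g := by
  ext x
  rw [Pi.add_apply, commutator, eq_comm, sub_add, sub_eq_self, sub_eq_zero, GoodTriv.mollifyDist,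
    GoodTriv.mollify]
  refine finsum_congr fun α => ?_
  congr 1
  ext y
  exact hfg.mollifyDist_distApp hμ τF α φ (ε α).2 (hg α) y

end Global

end Dist

/-! ### Locally finite sums -/

/-- Minkowski's inequality for countable, pointwise finite sums. -/
lemma eLpNorm_finsum_le {X A : Type*} [MeasurableSpace X] [Countable A] {μ : Measure X}
    {p : ℝ≥0∞} (hp : 1 ≤ p) {f : A → X → ℝ} (hf : ∀ α, AEStronglyMeasurable (f α) μ)
    (hfin : ∀ x, (Function.support fun α => f α x).Finite) :
    eLpNorm (fun x => ∑ᶠ α, f α x) p μ ≤ ∑' α, eLpNorm (f α) p μ := by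
  -- Countability gives a sequence of finite sets exhausting the index set; the finite sums converge
  -- pointwise, so Fatou's lemma passes Minkowski's inequality to the limit.
  obtain ⟨I, hI⟩ := exists_seq_tendsto (atTop : Filter (Finset A))
  have hlim : ∀ x, Tendsto (fun k => (∑ α ∈ I k, f α) x) atTop (𝓝 (∑ᶠ α, f α x)) := by
    intro x
    refine tendsto_const_nhds.congr' ?_
    filter_upwards [hI.eventually_ge_atTop (hfin x).toFinset] with k hk
    rw [Finset.sum_apply]
    exact finsum_eq_sum_of_support_subset _ fun α hα => hk (by simpa using hα)
  refine (Lp.eLpNorm_lim_le_liminf_eLpNorm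
    (fun k => Finset.aestronglyMeasurable_sum _ fun α _ => hf α) _
    (Eventually.of_forall hlim)).trans ?_
  refine (liminf_le_liminf (v := fun _ => ∑' α, eLpNorm (f α) p μ)
    (Eventually.of_forall fun k => ?_)).trans (liminf_const _).le
  exact (eLpNorm_sum_le (fun α _ => hf α) hp).trans (ENNReal.sum_le_tsum _)

/-! ### Upper limits along families of parameters -/

section LimsupZero

variable {A : Type*} {G H : Params A → ℝ≥0∞}

lemma limsupZero_le {c : ℝ≥0∞} (h : ∃ εbar : Params A, ∀ ε ≤ εbar, G ε ≤ c) :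
    limsupZero G ≤ c := by
  obtain ⟨εbar, h⟩ := h
  exact (iInf_le _ εbar).trans (iSup₂_le h)

lemma limsupZero_eq_zero (h : ∀ δ : ℝ≥0∞, δ ≠ 0 → ∃ εbar : Params A, ∀ ε ≤ εbar, G ε ≤ δ) :
    limsupZero G = 0 := by
  by_contra h0
  obtain ⟨δ, hδ, hδ'⟩ := exists_between (pos_iff_ne_zero.2 h0)
  exact (hδ'.trans_le (limsupZero_le (h δ hδ.ne'))).false

lemma exists_of_limsupZero_eq_zero (h : limsupZero G = 0) {δ : ℝ≥0∞} (hδ : δ ≠ 0) :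
    ∃ εbar : Params A, ∀ ε ≤ εbar, G ε ≤ δ := by
  have h1 : limsupZero G < δ := by
    rw [h]
    exact pos_iff_ne_zero.2 hδ
  obtain ⟨εbar, h2⟩ := iInf_lt_iff.1 h1
  exact ⟨εbar, fun ε hε => (le_iSup₂ (f := fun ε (_ : ε ≤ εbar) => G ε) ε hε).trans h2.le⟩

/-- Thresholds for the individual parameters give a family of thresholds. -/
lemma exists_params {Q : A → ℝ → Prop}
    (h : ∀ α, ∃ t₀ : ℝ, 0 < t₀ ∧ ∀ t ∈ Ioc (0 : ℝ) 1, t ≤ t₀ → Q α t) :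
    ∃ εbar : Params A, ∀ ε ≤ εbar, ∀ α, Q α (ε α) := by
  choose t₀ ht₀ hQ using h
  refine ⟨fun α => ⟨min (t₀ α) 1, lt_min (ht₀ α) one_pos, min_le_right _ _⟩,
    fun ε hε α => hQ α _ (ε α).2 ?_⟩
  exact le_trans (Subtype.coe_le_coe.2 (hε α)) (min_le_left _ _)

end LimsupZero

/-! ### From estimates in charts to estimates on the manifold. -/

section Families

variable {n : ℕ} {M : Type*} [TopologicalSpace M] [ChartedSpace (Euc n) M]
  [IsManifold (𝓡 n) ∞ M] [T2Space M] [SigmaCompactSpace M] [MeasurableSpace M] [BorelSpace M]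
  {μ : Measure M}
variable {V : Type*} [NormedAddCommGroup V] [InnerProductSpace ℂ V] [FiniteDimensional ℂ V]
  {E : M → Type*} [∀ x, AddCommGroup (E x)] [∀ x, Module ℂ (E x)]
  [∀ x, TopologicalSpace (E x)] [TopologicalSpace (TotalSpace V E)] [FiberBundle V E]
  [VectorBundle ℂ V E] [VectorBundle ℝ V E] [ContMDiffVectorBundle ∞ V E (𝓡 n)]
  {e : OpenPartialHomeomorph M (Euc n)} {t : Trivialization V (π V E)}
variable {A : Type*} {𝒜 : GoodAtlas n M A}

lemma LocalFrame.aestronglyMeasurable_seminorm_fromLocal (hμ : IsSmoothMeasure n μ)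
    (h : LocalFrame e t) (P : FibreSeminorm V E) {w : Euc n → V}
    (hw : AEStronglyMeasurable w volume) :
    AEStronglyMeasurable (fun x => P.seminorm x (fromLocal e t w x)) μ := by
  have h1 : (fun x => P.seminorm x (fromLocal e t w x)) =
      e.source.indicator fun x => P.seminorm x (fromLocal e t w x) := by
    ext x
    by_cases hx : x ∈ e.source
    · rw [indicator_of_mem hx]
    · rw [indicator_of_notMem hx, fromLocal_of_notMem _ hx, map_zero]
  obtain ⟨ρ, -, -, hρ⟩ := hμ.exists_density h.mem h.target
  rw [h1, aestronglyMeasurable_indicator_iff e.open_source.measurableSet, hρ,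
    (measurableEmbedding_chart_symm h.target).aestronglyMeasurable_map_iff]
  refine AEStronglyMeasurable.mono_ac (withDensity_absolutelyContinuous _ _) ?_
  refine ((h.continuous_seminormAt P).comp_aestronglyMeasurable
    (continuous_id.aestronglyMeasurable.prodMk hw)).congr (Eventually.of_forall fun y => ?_)
  exact (h.seminorm_fromLocal P w y).symm

/-- The compact subset of a chart which contains the support of the cutoff function. -/
def GoodAtlas.core (𝒜 : GoodAtlas n M A) (α : A) (r : ℝ) : Set M :=
  (𝒜.chart α).symm '' Metric.closedBall 0 r

lemma GoodAtlas.isCompact_core (𝒜 : GoodAtlas n M A) (α : A) (r : ℝ) : IsCompact (𝒜.core α r) :=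
  (isCompact_closedBall _ _).image (isOpenEmbedding_chart_symm (𝒜.target_eq α)).continuous

lemma GoodAtlas.core_subset (𝒜 : GoodAtlas n M A) (α : A) (r : ℝ) :
    𝒜.core α r ⊆ (𝒜.chart α).source := by
  rintro _ ⟨y, -, rfl⟩
  exact chart_symm_mem (𝒜.target_eq α) y

lemma GoodAtlas.finite_core_inter (𝒜 : GoodAtlas n M A) (r : ℝ) {K : Set M} (hK : IsCompact K) :
    {α | (𝒜.core α r ∩ K).Nonempty}.Finite :=
  (𝒜.locallyFinite.finite_nonempty_inter_compact hK).subset fun α hα =>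
    hα.mono (inter_subset_inter_left _ (𝒜.core_subset α r))

/-- Locally finite sums of sections that are supported in the charts. -/
def GoodTriv.glue (τ : GoodTriv 𝒜 V E) (w : A → Euc n → V) (x : M) : E x :=
  ∑ᶠ α, fromLocal (𝒜.chart α) (τ.triv α) (w α) x

lemma GoodTriv.seminorm_glue_le (τ : GoodTriv 𝒜 V E) (P : FibreSeminorm V E) (w : A → Euc n → V)
    (x : M) : P.seminorm x (τ.glue w x) ≤
      ∑ᶠ α, P.seminorm x (fromLocal (𝒜.chart α) (τ.triv α) (w α) x) := by
  have hfin := τ.finite_support w x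
  rw [GoodTriv.glue, finsum_eq_sum_of_support_subset (s := hfin.toFinset) _ (by simp),
    finsum_eq_sum_of_support_subset (s := hfin.toFinset) _ fun α hα => by
      simp only [Finite.coe_toFinset, Function.mem_support] at hα ⊢
      exact fun h0 => hα (by rw [h0, map_zero])]
  exact Finset.le_sum_of_subadditive _ (map_zero _).le (map_add_le_add _) _ _

lemma GoodTriv.secNorm_glue_le (hμ : IsSmoothMeasure n μ) (τ : GoodTriv 𝒜 V E)
    (P : FibreSeminorm V E) {p : ℝ≥0∞} (hp : 1 ≤ p) {ζ : M → ℂ} (hζ : AEStronglyMeasurable ζ μ)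
    {w : A → Euc n → V} (hw : ∀ α, AEStronglyMeasurable (w α) volume) :
    secNorm P μ p ζ (τ.glue w) ≤
      ∑' α, secNorm P μ p ζ (fromLocal (𝒜.chart α) (τ.triv α) (w α)) := by
  have := 𝒜.countable
  have hsupp : ∀ x, (Function.support fun α =>
      ‖ζ x‖ * P.seminorm x (fromLocal (𝒜.chart α) (τ.triv α) (w α) x)).Finite := fun x =>
    (τ.finite_support w x).subset fun α hα h0 => hα (by simp only [h0, map_zero, mul_zero])
  refine le_trans ?_ (eLpNorm_finsum_le hp (fun α => hζ.norm.mul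
    ((τ.localFrame α).aestronglyMeasurable_seminorm_fromLocal hμ P (hw α))) hsupp)
  refine eLpNorm_mono_real fun x => ?_
  rw [Real.norm_of_nonneg (mul_nonneg (norm_nonneg _) (apply_nonneg _ _)), ← mul_finsum']
  · gcongr
    exact τ.seminorm_glue_le P w x
  · exact (τ.finite_support w x).subset fun α hα h0 => hα (by simp only [h0, map_zero])

/-- A chartwise estimate in a target bundle. -/
lemma GoodTriv.exists_secNorm_le (hμ : IsSmoothMeasure n μ) (τ : GoodTriv 𝒜 V E)
    (P : FibreSeminorm V E) {ζ : M → ℂ} (hζ : IsLinfLoc μ ζ) :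
    ∃ C : A → ℝ≥0∞, (∀ α, C α ≠ ⊤) ∧ (IsLinfComp μ ζ → {α | C α ≠ 0}.Finite) ∧
      ∀ p : ℝ≥0∞, 1 ≤ p → ∀ w : A → Euc n → V, (∀ α, AEStronglyMeasurable (w α) volume) →
        (∀ α, ∀ y ∉ Metric.closedBall (0 : Euc n) 2, w α y = 0) →
        secNorm P μ p ζ (τ.glue w) ≤ ∑' α, C α * eLpNorm (w α) p volume := by
  choose C hC hCC using fun α => (τ.localFrame α).secNorm_fromLocal_le hμ P
    (isCompact_closedBall (0 : Euc n) 2)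
  have hZ : ∀ α, eLpNorm ζ ⊤ (μ.restrict (𝒜.core α 2)) ≠ ⊤ := fun α =>
    (hζ.2 _ (𝒜.isCompact_core α 2)).ne
  refine ⟨fun α => C α * eLpNorm ζ ⊤ (μ.restrict (𝒜.core α 2)),
    fun α => ENNReal.mul_ne_top (hC α) (hZ α), ?_, fun p hp w hw hw0 => ?_⟩
  · rintro ⟨-, K, hK, hζK⟩
    -- A chart whose core misses `K` contributes a zero constant, because `ζ` vanishes almost
    -- everywhere on that core.
    refine (𝒜.finite_core_inter 2 hK).subset fun α hα => ?_
    by_contra hne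
    refine hα ?_
    have : ζ =ᵐ[μ.restrict (𝒜.core α 2)] 0 := by
      filter_upwards [ae_restrict_of_ae hζK,
        ae_restrict_mem (𝒜.isCompact_core α 2).measurableSet] with x hx hx'
      exact hx fun hxK => hne ⟨x, hx', hxK⟩
    simp only [eLpNorm_congr_ae this, eLpNorm_zero, mul_zero]
  · refine (τ.secNorm_glue_le hμ P hp hζ.1 hw).trans (ENNReal.tsum_le_tsum fun α => ?_)
    exact hCC α p hp ζ (hZ α) (w α) (hw0 α)

/-- Weights on the charts are dominated by a locally bounded function. -/
lemma GoodAtlas.exists_dominating (𝒜 : GoodAtlas n M A) (μ : Measure M) {c : A → ℝ≥0∞}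
    (hc : ∀ α, c α ≠ ⊤) :
    ∃ ξ : M → ℂ, IsLinfLoc μ ξ ∧ ({α | c α ≠ 0}.Finite → IsLinfComp μ ξ) ∧
      ∀ (N : FibreSeminorm V E) (p : ℝ≥0∞) (f : ∀ x, E x),
        ∑' α, c α * eLpNorm (fun x => N.seminorm x (f x)) p (μ.restrict (𝒜.core α 1)) ≤
          secNorm N μ p ξ f := by
  have := 𝒜.countable
  -- With positive weights `w α` of sum below 1, the multiplier is `∑_α (c α / w α)` over the cores
  -- containing the point. Each term of the sum is then at most `w α` times the right-hand side, for
  -- every `p` alike, and the weights add up to less than 1.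
  obtain ⟨w, hw0, hw1⟩ := ENNReal.exists_pos_sum_of_countable' one_ne_zero A
  have hwt : ∀ α, w α ≠ ⊤ := fun α => ((ENNReal.le_tsum α).trans_lt
    (hw1.trans ENNReal.one_lt_top)).ne
  set d : A → ℝ≥0∞ := fun α => c α / w α with hd
  have hdt : ∀ α, d α ≠ ⊤ := fun α => ENNReal.div_ne_top (hc α) (hw0 α).ne'
  set s : M → ℝ≥0∞ := fun x => ∑' α, (𝒜.core α 1).indicator (fun _ => d α) x with hs
  -- Only finitely many cores meet a compact set, so `s` is bounded on it.
  have hsum : ∀ K : Set M, ∀ hK : {α | (𝒜.core α 1 ∩ K).Nonempty}.Finite, ∀ x ∈ K,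
      s x ≤ ∑ α ∈ hK.toFinset, d α := by
    intro K hK x hx
    rw [hs]
    simp only
    rw [tsum_eq_sum (s := hK.toFinset)]
    · exact Finset.sum_le_sum fun α _ => indicator_le_self _ _ _
    · intro α hα
      refine indicator_of_notMem (fun hxα => hα ?_) _
      rw [Finite.mem_toFinset]
      exact ⟨x, hxα, hx⟩
  have hst : ∀ x, s x ≠ ⊤ := fun x =>
    ((hsum {x} (𝒜.finite_core_inter 1 isCompact_singleton) x rfl).trans_lt
      (ENNReal.sum_lt_top.2 fun α _ => (hdt α).lt_top)).ne
  have hsm : Measurable s := Measurable.tsum fun α =>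
    measurable_const.indicator (𝒜.isCompact_core α 1).measurableSet
  have hloc : IsLinfLoc μ fun x => ((s x).toReal : ℂ) := by
    refine ⟨(Complex.measurable_ofReal.comp hsm.ennreal_toReal).aestronglyMeasurable,
      fun K hK => ?_⟩
    have hfin := 𝒜.finite_core_inter 1 hK
    refine (eLpNormEssSup_le_of_ae_bound (C := (∑ α ∈ hfin.toFinset, d α).toReal) ?_).trans_lt
      ENNReal.ofReal_lt_top
    filter_upwards [ae_restrict_mem hK.measurableSet] with x hx
    rw [Complex.norm_real, Real.norm_of_nonneg ENNReal.toReal_nonneg]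
    exact ENNReal.toReal_mono (ENNReal.sum_lt_top.2 fun α _ => (hdt α).lt_top).ne
      (hsum K hfin x hx)
  refine ⟨fun x => ((s x).toReal : ℂ), hloc, fun hfin => ⟨hloc, ?_⟩, fun N p f => ?_⟩
  · refine ⟨⋃ α ∈ hfin.toFinset, 𝒜.core α 1,
      hfin.toFinset.isCompact_biUnion fun α _ => 𝒜.isCompact_core α 1,
      Eventually.of_forall fun x hx => ?_⟩
    have : s x = 0 := by
      refine ENNReal.tsum_eq_zero.2 fun α => ?_
      by_cases hα : c α = 0
      · simp [hd, hα]
      · refine indicator_of_notMem (fun hxα => hx ?_) _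
        exact mem_biUnion (by simpa using hα) hxα
    simp [this]
  · have h1 : ∀ α, c α * eLpNorm (fun x => N.seminorm x (f x)) p (μ.restrict (𝒜.core α 1)) ≤
        w α * secNorm N μ p (fun x => ((s x).toReal : ℂ)) f := by
      intro α
      have h2 : (d α).toNNReal * eLpNorm (fun x => N.seminorm x (f x)) p
          (μ.restrict (𝒜.core α 1)) ≤ secNorm N μ p (fun x => ((s x).toReal : ℂ)) f := by
        refine mul_eLpNorm_le_secNorm (𝒜.isCompact_core α 1).measurableSet (fun x hx => ?_) f
        rw [Complex.norm_real, Real.norm_of_nonneg ENNReal.toReal_nonneg]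
        refine ENNReal.toReal_mono (hst x) ?_
        refine le_trans ?_ (ENNReal.le_tsum α)
        rw [indicator_of_mem hx]
      rw [ENNReal.coe_toNNReal (hdt α)] at h2
      calc _ = w α * (d α * eLpNorm (fun x => N.seminorm x (f x)) p
            (μ.restrict (𝒜.core α 1))) := by
            rw [← mul_assoc, hd, ENNReal.mul_div_cancel (hw0 α).ne' (hwt α)]
        _ ≤ _ := by gcongr
    calc _ ≤ ∑' α, w α * secNorm N μ p (fun x => ((s x).toReal : ℂ)) f :=
          ENNReal.tsum_le_tsum h1
      _ = (∑' α, w α) * _ := ENNReal.tsum_mul_right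
      _ ≤ _ := mul_le_of_le_one_left' hw1.le

/-- Families of functions on `ℝ^n` which converge to zero. -/
structure IsSmallFamily (p : ℝ≥0∞) (w : ℝ → Euc n → V) : Prop where
  aesm : ∀ t ∈ Ioc (0 : ℝ) 1, AEStronglyMeasurable (w t) volume
  supp : ∀ t ∈ Ioc (0 : ℝ) 1, ∀ y ∉ Metric.closedBall (0 : Euc n) 2, w t y = 0
  small : ∀ δ : ℝ≥0∞, δ ≠ 0 → ∃ t₀ : ℝ, 0 < t₀ ∧ ∀ t ∈ Ioc (0 : ℝ) 1, t ≤ t₀ →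
    eLpNorm (w t) p volume ≤ δ

lemma IsSmallFamily.add {p : ℝ≥0∞} (hp : 1 ≤ p) {w w' : ℝ → Euc n → V} (h : IsSmallFamily p w)
    (h' : IsSmallFamily p w') : IsSmallFamily p (w + w') where
  aesm t ht := (h.aesm t ht).add (h'.aesm t ht)
  supp t ht y hy := by simp [h.supp t ht y hy, h'.supp t ht y hy]
  small δ hδ := by
    obtain ⟨t₀, h0, h1⟩ := h.small _ (ENNReal.half_pos hδ).ne'
    obtain ⟨t₁, h2, h3⟩ := h'.small _ (ENNReal.half_pos hδ).ne'
    refine ⟨min t₀ t₁, lt_min h0 h2, fun t ht htt => ?_⟩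
    calc _ ≤ eLpNorm (w t) p volume + eLpNorm (w' t) p volume :=
          eLpNorm_add_le (h.aesm t ht) (h'.aesm t ht) hp
      _ ≤ δ / 2 + δ / 2 := add_le_add (h1 t ht (htt.trans (min_le_left _ _)))
          (h3 t ht (htt.trans (min_le_right _ _)))
      _ = δ := ENNReal.add_halves δ

/-- Locally finite sums of families that converge to zero in the charts. -/
lemma GoodTriv.limsupZero_glue (hμ : IsSmoothMeasure n μ) (τ : GoodTriv 𝒜 V E)
    (P : FibreSeminorm V E) {p : ℝ≥0∞} (hp : 1 ≤ p) {ζ : M → ℂ} (hζ : IsLinfLoc μ ζ)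
    {w : A → ℝ → Euc n → V} (hw : ∀ α, IsSmallFamily p (w α)) :
    limsupZero (fun ε : Params A => secNorm P μ p ζ (τ.glue fun α => w α (ε α))) = 0 := by
  have := 𝒜.countable
  obtain ⟨C, hC, -, hCC⟩ := τ.exists_secNorm_le hμ P hζ
  refine limsupZero_eq_zero fun δ hδ => ?_
  -- Chart `α` is allotted the error `d α`, with total below `δ`; no uniformity over the charts is
  -- needed, since each has its own parameter and threshold.
  obtain ⟨d, hd0, hd1⟩ := ENNReal.exists_pos_sum_of_countable' hδ A
  have h1 : ∀ α, ∃ t₀ : ℝ, 0 < t₀ ∧ ∀ t ∈ Ioc (0 : ℝ) 1, t ≤ t₀ →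
      C α * eLpNorm (w α t) p volume ≤ d α := by
    intro α
    obtain ⟨s, hs, hs'⟩ := ENNReal.exists_nnreal_pos_mul_lt (hC α) (hd0 α).ne'
    obtain ⟨t₀, ht₀, h⟩ := (hw α).small s (by simpa using hs.ne')
    refine ⟨t₀, ht₀, fun t ht htt => ?_⟩
    calc _ ≤ C α * s := by gcongr; exact h t ht htt
      _ ≤ d α := by rw [mul_comm]; exact hs'.le
  obtain ⟨εbar, h⟩ := exists_params h1
  refine ⟨εbar, fun ε hε => ?_⟩
  refine (hCC p hp _ (fun α => (hw α).aesm _ (ε α).2) fun α => (hw α).supp _ (ε α).2).trans ?_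
  exact (ENNReal.tsum_le_tsum fun α => h ε hε α).trans hd1.le

end Families

/-! ### Integral operators applied to functions that are cut off -/

section CutOff

variable {n : ℕ} {V W X : Type*} [NormedAddCommGroup V] [NormedSpace ℂ V]
  [NormedAddCommGroup W] [NormedSpace ℂ W] [NormedAddCommGroup X] [NormedSpace ℂ X]
  {T : Euc n → V →L[ℂ] W}

lemma aestronglyMeasurable_complexCLM_apply (hT : Continuous T) {v : Euc n → V}
    (hv : AEStronglyMeasurable v volume) : AEStronglyMeasurable (fun y => T y (v y)) volume :=
  (ContinuousLinearMap.id ℂ (V →L[ℂ] W)).aestronglyMeasurable_comp₂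
    hT.aestronglyMeasurable hv

lemma eLpNorm_complexCLM_apply_le (hT : Continuous T)
    (hT0 : ∀ y ∉ Metric.closedBall (0 : Euc n) 1, T y = 0) :
    ∃ S : ℝ≥0∞, S ≠ ⊤ ∧ ∀ (p : ℝ≥0∞) (v : Euc n → V), eLpNorm (fun y => T y (v y)) p volume ≤
      S * eLpNorm v p (volume.restrict (Metric.closedBall 0 1)) := by
  obtain ⟨C, hC⟩ := (HasCompactSupport.intro (isCompact_closedBall (0 : Euc n) 1)
    hT0).exists_bound_of_continuous hT
  refine ⟨ENNReal.ofReal C, ENNReal.ofReal_ne_top, fun p v => ?_⟩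
  rw [← eLpNorm_restrict_eq_of_support_subset (s := Metric.closedBall (0 : Euc n) 1)
    fun y hy => by_contra fun h => hy (by simp [hT0 y h])]
  refine eLpNorm_le_mul_eLpNorm_of_ae_le_mul (Eventually.of_forall fun y => ?_) p
  refine ((T y).le_opNorm _).trans ?_
  gcongr
  exact hC y

namespace ApproxKernel

variable {K : ℝ → Euc n → Euc n → W →L[ℂ] X} {m : W →L[ℂ] X} {k : Euc n → ℝ}

lemma exists_eLpNorm_cutOff_le (H : ApproxKernel K m k) (hT : Continuous T)
    (hT0 : ∀ y ∉ Metric.closedBall (0 : Euc n) 1, T y = 0) :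
    ∃ L : ℝ≥0∞, L ≠ ⊤ ∧ ∀ p : ℝ≥0∞, 1 ≤ p → ∀ v : Euc n → V, AEStronglyMeasurable v volume →
      ∀ t ∈ Ioc (0 : ℝ) 1, eLpNorm (kerOp (K t) fun y => T y (v y)) p volume ≤
        L * eLpNorm v p (volume.restrict (Metric.closedBall 0 1)) := by
  obtain ⟨S, hS, h⟩ := eLpNorm_complexCLM_apply_le hT hT0
  refine ⟨ENNReal.ofReal (∫ y, k y) * S, by finiteness, fun p hp v hv t ht => ?_⟩
  refine (H.eLpNorm_kerOp_le ht (aestronglyMeasurable_complexCLM_apply hT hv) hp).trans ?_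
  rw [mul_assoc]
  gcongr
  exact h p v

lemma kerOp_cutOff_eq_zero (H : ApproxKernel K m k)
    (hT0 : ∀ y ∉ Metric.closedBall (0 : Euc n) 1, T y = 0) (v : Euc n → V) {t : ℝ}
    (ht : t ∈ Ioc (0 : ℝ) 1) {y : Euc n} (hy : y ∉ Metric.closedBall (0 : Euc n) 2) :
    kerOp (K t) (fun y => T y (v y)) y = 0 := by
  refine H.kerOp_eq_zero ht fun z hz => ?_
  rw [hT0 z fun hz1 => hy ?_, _root_.zero_apply]
  rw [mem_closedBall_zero_iff] at hz1 ⊢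
  have := norm_add_le (y - z) z
  rw [sub_add_cancel] at this
  linarith [ht.2]

end ApproxKernel

end CutOff

/-! ### Convergence to zero of the error after cutting off. -/

section SmallFamilies

variable {n : ℕ} {V W X : Type*} [NormedAddCommGroup V] [NormedSpace ℂ V]
  [NormedAddCommGroup W] [NormedSpace ℂ W] [NormedAddCommGroup X] [InnerProductSpace ℂ X]
  [FiniteDimensional ℂ X]
  {T : Euc n → V →L[ℂ] W} {K : ℝ → Euc n → Euc n → W →L[ℂ] X} {m : W →L[ℂ] X} {k : Euc n → ℝ}

/-- After multiplication by the continuous cutoff `T`, supported in the unit ball, `L^p` regularity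
of `v` on that ball gives a function in `L^p` of `ℝ^n`, and continuity of `v` gives a continuous
function of compact support. The second alternative places no restriction on `p`. -/
lemma ApproxKernel.isSmallFamily (H : ApproxKernel K m k) (hT : Continuous T)
    (hT0 : ∀ y ∉ Metric.closedBall (0 : Euc n) 1, T y = 0) {p : ℝ≥0∞} (hp : 1 ≤ p)
    {v : Euc n → V} (hvm : AEStronglyMeasurable v volume)
    (hv : (p ≠ ⊤ ∧ MemLp v p (volume.restrict (Metric.closedBall 0 1))) ∨ Continuous v) :
    IsSmallFamily p fun t y => kerOp (K t) (fun y => T y (v y)) y - m (T y (v y)) where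
  aesm t ht := (H.aestronglyMeasurable_kerOp ht
    (aestronglyMeasurable_complexCLM_apply hT hvm)).sub
      (m.continuous.comp_aestronglyMeasurable (aestronglyMeasurable_complexCLM_apply hT hvm))
  supp t ht y hy := by
    rw [H.kerOp_cutOff_eq_zero hT0 v ht hy,
      hT0 y fun h => hy (Metric.closedBall_subset_closedBall (by norm_num) h)]
    simp
  small δ hδ := by
    rcases hv with ⟨hpt, hv⟩ | hv
    · obtain ⟨S, hS, h⟩ := eLpNorm_complexCLM_apply_le hT hT0
      exact H.eLpNorm_approx hp hpt ⟨aestronglyMeasurable_complexCLM_apply hT hvm,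
        (h p v).trans_lt (ENNReal.mul_lt_top hS.lt_top hv.2)⟩ hδ
    · refine H.eLpNorm_approx_of_continuous (hT.clm_apply hv) ?_ p hδ
      exact HasCompactSupport.intro (isCompact_closedBall (0 : Euc n) 1)
        fun y hy => by simp [hT0 y hy]

end SmallFamilies

/-! ### Mollifiers and commutators as locally finite sums of integral operators -/

section Items

variable {n : ℕ} {M : Type*} [TopologicalSpace M] [ChartedSpace (Euc n) M]
  [IsManifold (𝓡 n) ∞ M] [T2Space M] [SigmaCompactSpace M] [MeasurableSpace M] [BorelSpace M]
  {μ : Measure M}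
variable {V : Type*} [NormedAddCommGroup V] [InnerProductSpace ℂ V] [FiniteDimensional ℂ V]
  {E : M → Type*} [∀ x, AddCommGroup (E x)] [∀ x, Module ℂ (E x)]
  [∀ x, TopologicalSpace (E x)] [TopologicalSpace (TotalSpace V E)] [FiberBundle V E]
  [VectorBundle ℂ V E] [VectorBundle ℝ V E] [ContMDiffVectorBundle ∞ V E (𝓡 n)]
variable {W : Type*} [NormedAddCommGroup W] [InnerProductSpace ℂ W] [FiniteDimensional ℂ W]
  {F : M → Type*} [∀ x, AddCommGroup (F x)] [∀ x, Module ℂ (F x)]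
  [∀ x, TopologicalSpace (F x)] [TopologicalSpace (TotalSpace W F)] [FiberBundle W F]
  [VectorBundle ℂ W F] [VectorBundle ℝ W F] [ContMDiffVectorBundle ∞ W F (𝓡 n)]
variable {A : Type*} {𝒜 : GoodAtlas n M A}

lemma GoodTriv.glue_sub (τ : GoodTriv 𝒜 V E) (w w' : A → Euc n → V) :
    τ.glue (w - w') = τ.glue w - τ.glue w' := by
  ext x
  rw [Pi.sub_apply, GoodTriv.glue, GoodTriv.glue, GoodTriv.glue,
    ← finsum_sub_distrib (τ.finite_support _ x) (τ.finite_support _ x)]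
  exact finsum_congr fun α => by rw [Pi.sub_apply, (τ.localFrame α).fromLocal_sub, Pi.sub_apply]

lemma GoodTriv.glue_add (τ : GoodTriv 𝒜 V E) (w w' : A → Euc n → V) :
    τ.glue (w + w') = τ.glue w + τ.glue w' := by
  rw [← sub_eq_iff_eq_add, ← τ.glue_sub, add_sub_cancel_right]

/-- Multiplication with the cutoff function. -/
def GoodAtlas.cutCLM (𝒜 : GoodAtlas n M A) (V : Type*) [NormedAddCommGroup V]
    [InnerProductSpace ℂ V] (α : A) (y : Euc n) : V →L[ℂ] V :=
  𝒜.cut α y • ContinuousLinearMap.id ℂ V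

lemma GoodAtlas.continuous_cutCLM (𝒜 : GoodAtlas n M A) (α : A) :
    Continuous (𝒜.cutCLM V α) :=
  (𝒜.contDiff_cut α).continuous.smul continuous_const

lemma GoodAtlas.notMem_tsupport_cut (𝒜 : GoodAtlas n M A) (α : A) {y : Euc n}
    (hy : y ∉ Metric.closedBall (0 : Euc n) 1) : y ∉ tsupport (𝒜.cut α) := fun h =>
  hy (Metric.ball_subset_closedBall (𝒜.tsupport_cut α h))

lemma GoodAtlas.cutCLM_eq_zero (𝒜 : GoodAtlas n M A) (α : A) {y : Euc n}
    (hy : y ∉ Metric.closedBall (0 : Euc n) 1) : 𝒜.cutCLM V α y = 0 := by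
  rw [cutCLM, image_eq_zero_of_notMem_tsupport (𝒜.notMem_tsupport_cut α hy), zero_smul]

lemma continuous_cutSymbol {a : A → Fin n → Euc n → V →L[ℂ] W}
    (ha : ∀ α j, ContDiff ℝ ∞ (a α j)) (α : A) : Continuous (cutSymbol 𝒜 a α) :=
  continuous_finsetSum _ fun j _ => (contDiff_pd (𝒜.contDiff_cut α) j).continuous.smul
    (ha α j).continuous

lemma cutSymbol_eq_zero (a : A → Fin n → Euc n → V →L[ℂ] W) (α : A) {y : Euc n}
    (hy : y ∉ Metric.closedBall (0 : Euc n) 1) : cutSymbol 𝒜 a α y = 0 :=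
  Finset.sum_eq_zero fun j _ => by rw [pd_eq_zero (𝒜.notMem_tsupport_cut α hy), zero_smul]

lemma GoodTriv.cutRep_eq_cutCLM (τ : GoodTriv 𝒜 V E) (α : A) (f : ∀ x, E x) :
    τ.cutRep α f = fun y => 𝒜.cutCLM V α y (localRep (𝒜.chart α) (τ.triv α) f y) := by
  rw [τ.cutRep_eq]
  rfl

lemma GoodTriv.mollify_eq_glue (τ : GoodTriv 𝒜 V E) (φ : Kernel n) (ε : Params A)
    (f : ∀ x, E x) : τ.mollify φ ε f = τ.glue fun α => kerOp (φ.mollKer V (ε α))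
      fun y => 𝒜.cutCLM V α y (localRep (𝒜.chart α) (τ.triv α) f y) := by
  ext x
  refine finsum_congr fun α => ?_
  rw [τ.cutRep_eq_cutCLM, φ.mollify_eq_kerOp]

lemma GoodTriv.fromLocal_cutRep (τ : GoodTriv 𝒜 V E) (α : A) (f : ∀ x, E x) (x : M) :
    fromLocal (𝒜.chart α) (τ.triv α) (τ.cutRep α f) x = ((𝒜.η α x : ℝ) : ℂ) • f x := by
  by_cases hx : x ∈ (𝒜.chart α).source
  · exact (τ.localFrame α).fromLocal_localRep _ hx
  · rw [LocalFrame.fromLocal_of_notMem _ hx, image_eq_zero_of_notMem_tsupport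
      fun h => hx (𝒜.tsupport_subset α h).1, Complex.ofReal_zero, zero_smul]

lemma GoodTriv.glue_cutCLM (τ : GoodTriv 𝒜 V E) (f : ∀ x, E x) :
    (τ.glue fun α y => 𝒜.cutCLM V α y (localRep (𝒜.chart α) (τ.triv α) f y)) = f := by
  ext x
  rw [← 𝒜.finsum_η_smul (f x)]
  exact finsum_congr fun α => by rw [← τ.fromLocal_cutRep, τ.cutRep_eq_cutCLM]

variable {D : FirstOrderOp n V E W F} {hE : HermitianMetric n V E} {hF : HermitianMetric n W F}

lemma commutator_eq_glue (hμ : IsSmoothMeasure n μ) (τE : GoodTriv 𝒜 V E) (τF : GoodTriv 𝒜 W F)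
    (φ : Kernel n) (ε : Params A) {a : A → Fin n → Euc n → V →L[ℂ] W} {b : A → Euc n → V →L[ℂ] W}
    (h : ∀ α, D.LocalCoeff τE τF α (a α) (b α)) {f : ∀ x, E x}
    (hf : ∀ α, LocallyIntegrable (localRep (𝒜.chart α) (τE.triv α) f) volume) :
    commutator τE τF φ μ hE hF D ε f = τF.glue fun α =>
      kerOp (φ.commKer (a α) (b α) (ε α))
        (fun y => 𝒜.cutCLM V α y (localRep (𝒜.chart α) (τE.triv α) f y)) +
      kerOp (φ.mollKer W (ε α))
        (fun y => cutSymbol 𝒜 a α y (localRep (𝒜.chart α) (τE.triv α) f y)) := by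
  ext x
  rw [commutator_eq_finsum hμ τE τF φ ε h hf]
  exact finsum_congr fun α => by rw [τE.cutRep_eq_cutCLM, φ.mollify_eq_kerOp]

/-- Operators that are bounded in the charts, uniformly in `p`, are dominated by a locally bounded
function. -/
lemma exists_equicontinuous (hμ : IsSmoothMeasure n μ) (τE : GoodTriv 𝒜 V E) (τF : GoodTriv 𝒜 W F)
    {N : FibreSeminorm V E} (hN : N.IsNorm) (P : FibreSeminorm W F) {ζ : M → ℂ}
    (hζ : IsLinfLoc μ ζ) {L : A → ℝ≥0∞} (hL : ∀ α, L α ≠ ⊤) :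
    ∃ ξ : M → ℂ, IsLinfLoc μ ξ ∧ (IsLinfComp μ ζ → IsLinfComp μ ξ) ∧
      ∀ p : ℝ≥0∞, 1 ≤ p → ∀ (f : ∀ x, E x) (w : A → Euc n → W),
        (∀ α, AEStronglyMeasurable (w α) volume) →
        (∀ α, ∀ y ∉ Metric.closedBall (0 : Euc n) 2, w α y = 0) →
        (∀ α, eLpNorm (w α) p volume ≤ L α * eLpNorm (localRep (𝒜.chart α) (τE.triv α) f) p
          (volume.restrict (Metric.closedBall 0 1))) →
        secNorm P μ p ζ (τF.glue w) ≤ secNorm N μ p ξ f := by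
  obtain ⟨C, hC, hCfin, hCC⟩ := τF.exists_secNorm_le hμ P hζ
  choose Y hY hYY using fun α => (τE.localFrame α).eLpNorm_localRep_le hμ hN
    (isCompact_closedBall (0 : Euc n) 1)
  obtain ⟨ξ, hξ, hξc, h⟩ := 𝒜.exists_dominating (V := V) (E := E) μ
    (c := fun α => C α * (L α * Y α))
    fun α => ENNReal.mul_ne_top (hC α) (ENNReal.mul_ne_top (hL α) (hY α))
  refine ⟨ξ, hξ, fun hζc => hξc ((hCfin hζc).subset fun α hα h0 => hα (by simp [h0])),
    fun p hp f w hw hw0 hwL => ?_⟩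
  refine (hCC p hp w hw hw0).trans (le_trans (ENNReal.tsum_le_tsum fun α => ?_) (h N p f))
  rw [mul_assoc, mul_assoc]
  gcongr
  refine (hwL α).trans ?_
  gcongr
  exact hYY α p hp f

/-- Equicontinuity of the mollifiers. -/
lemma GoodTriv.exists_secNorm_mollify_le (hμ : IsSmoothMeasure n μ) (τ : GoodTriv 𝒜 V E)
    (φ : Kernel n) {N : FibreSeminorm V E} (hN : N.IsNorm) {ζ : M → ℂ} (hζ : IsLinfLoc μ ζ)
    {p : ℝ≥0∞} (hp : 1 ≤ p) :
    ∃ ξ : M → ℂ, IsLinfLoc μ ξ ∧ (IsLinfComp μ ζ → IsLinfComp μ ξ) ∧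
      ∀ f : ∀ x, E x, IsLpLoc N μ p f → ∀ ε : Params A,
        secNorm N μ p ζ (τ.mollify φ ε f) ≤ secNorm N μ p ξ f := by
  have : CompleteSpace V := FiniteDimensional.complete ℂ V
  have H := φ.approxKernel_mollKer (V := V)
  choose L hL hLL using fun α => H.exists_eLpNorm_cutOff_le (𝒜.continuous_cutCLM (V := V) α)
    fun y hy => 𝒜.cutCLM_eq_zero α hy
  obtain ⟨ξ, hξ, hξc, h⟩ := exists_equicontinuous hμ τ τ hN N hζ hL
  refine ⟨ξ, hξ, hξc, fun f hf ε => ?_⟩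
  have hv := fun α => (τ.localFrame α).aestronglyMeasurable_localRep hμ hf.1
  rw [τ.mollify_eq_glue]
  exact h p hp f _ (fun α => H.aestronglyMeasurable_kerOp (ε α).2
      (aestronglyMeasurable_complexCLM_apply (𝒜.continuous_cutCLM α) (hv α)))
    (fun α y hy => H.kerOp_cutOff_eq_zero (fun y hy => 𝒜.cutCLM_eq_zero α hy) _ (ε α).2 hy)
    fun α => hLL α p hp _ (hv α) _ (ε α).2

/-- Equicontinuity of the commutators. -/
lemma exists_secNorm_commutator_le (hμ : IsSmoothMeasure n μ) (τE : GoodTriv 𝒜 V E)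
    (τF : GoodTriv 𝒜 W F) (φ : Kernel n) {N : FibreSeminorm V E} (hN : N.IsNorm)
    (P : FibreSeminorm W F) {ζ : M → ℂ} (hζ : IsLinfLoc μ ζ) {p : ℝ≥0∞} (hp : 1 ≤ p) :
    ∃ ξ : M → ℂ, IsLinfLoc μ ξ ∧ (IsLinfComp μ ζ → IsLinfComp μ ξ) ∧
      ∀ f : ∀ x, E x, IsLpLoc N μ p f → ∀ ε : Params A,
        secNorm P μ p ζ (commutator τE τF φ μ hE hF D ε f) ≤ secNorm N μ p ξ f := by
  have : CompleteSpace W := FiniteDimensional.complete ℂ W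
  choose a b hab using fun α => D.exists_localCoeff τE τF α
  choose k hk using fun α => φ.exists_approxKernel_commKer (a α) (b α) (hab α).smooth_a
    (hab α).compact_a (hab α).smooth_b (hab α).compact_b
  have H := φ.approxKernel_mollKer (V := W)
  have hs := fun α => continuous_cutSymbol (𝒜 := 𝒜) (fun α => (hab α).smooth_a) α
  have hs0 := fun α (y : Euc n) hy => cutSymbol_eq_zero (𝒜 := 𝒜) a α (y := y) hy
  choose L hL hLL using fun α => (hk α).exists_eLpNorm_cutOff_le (𝒜.continuous_cutCLM (V := V) α)
    fun y hy => 𝒜.cutCLM_eq_zero α hy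
  choose L' hL' hLL' using fun α => H.exists_eLpNorm_cutOff_le (hs α) (hs0 α)
  obtain ⟨ξ, hξ, hξc, h⟩ := exists_equicontinuous hμ τE τF hN P hζ (L := L + L')
    fun α => ENNReal.add_ne_top.2 ⟨hL α, hL' α⟩
  refine ⟨ξ, hξ, hξc, fun f hf ε => ?_⟩
  have hv := fun α => (τE.localFrame α).aestronglyMeasurable_localRep hμ hf.1
  have m1 := fun α => (hk α).aestronglyMeasurable_kerOp (ε α).2
      (aestronglyMeasurable_complexCLM_apply (𝒜.continuous_cutCLM α) (hv α))
  have m2 := fun α => H.aestronglyMeasurable_kerOp (ε α).2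
      (aestronglyMeasurable_complexCLM_apply (hs α) (hv α))
  rw [commutator_eq_glue hμ τE τF φ ε hab
    fun α => (τE.localFrame α).locallyIntegrable_localRep hμ hN hp hf]
  refine h p hp f _ (fun α => (m1 α).add (m2 α)) (fun α y hy => ?_) fun α => ?_
  · rw [Pi.add_apply, (hk α).kerOp_cutOff_eq_zero (fun y hy => 𝒜.cutCLM_eq_zero α hy) _ (ε α).2 hy,
      H.kerOp_cutOff_eq_zero (hs0 α) _ (ε α).2 hy, add_zero]
  · refine (eLpNorm_add_le (m1 α) (m2 α) hp).trans ?_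
    rw [Pi.add_apply, add_mul]
    exact add_le_add (hLL α p hp _ (hv α) _ (ε α).2) (hLL' α p hp _ (hv α) _ (ε α).2)

/-- The regularity that is needed for approximation in local expressions. -/
lemma LocalFrame.regular_localRep (hμ : IsSmoothMeasure n μ)
    {e : OpenPartialHomeomorph M (Euc n)} {t : Trivialization V (π V E)} (h : LocalFrame e t)
    {N : FibreSeminorm V E} (hN : N.IsNorm) {p : ℝ≥0∞} (hp : 1 ≤ p) {f : ∀ x, E x}
    (hf : (p < ⊤ ∧ IsLpLoc N μ p f) ∨ (p = ⊤ ∧ IsContSection V f)) :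
    (p ≠ ⊤ ∧ MemLp (localRep e t f) p (volume.restrict (Metric.closedBall 0 1))) ∨
      Continuous (localRep e t f) :=
  hf.imp (fun hf => ⟨hf.1.ne, h.memLp_localRep hμ hN hp hf.2 (isCompact_closedBall _ _)⟩)
    fun hf => h.continuous_localRep hf.2

lemma isLpLoc_of_regular (hμ : IsSmoothMeasure n μ) (𝒜 : GoodAtlas n M A)
    {N : FibreSeminorm V E} {p : ℝ≥0∞} {f : ∀ x, E x}
    (hf : (p < ⊤ ∧ IsLpLoc N μ p f) ∨ (p = ⊤ ∧ IsContSection V f)) : IsLpLoc N μ p f := by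
  have := ChartedSpace.secondCountable_of_sigmaCompact (Euc n) M
  have := hμ.isFiniteMeasureOnCompacts 𝒜
  exact hf.elim (fun hf => hf.2) fun hf => hf.2.isLpLoc N p

lemma GoodTriv.isSmallFamily_mollify (hμ : IsSmoothMeasure n μ) (τ : GoodTriv 𝒜 V E)
    (φ : Kernel n) {N : FibreSeminorm V E} (hN : N.IsNorm) {p : ℝ≥0∞} (hp : 1 ≤ p) {f : ∀ x, E x}
    (hf : (p < ⊤ ∧ IsLpLoc N μ p f) ∨ (p = ⊤ ∧ IsContSection V f)) (α : A) :
    IsSmallFamily p fun s y => kerOp (φ.mollKer V s)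
        (fun y => 𝒜.cutCLM V α y (localRep (𝒜.chart α) (τ.triv α) f y)) y -
      𝒜.cutCLM V α y (localRep (𝒜.chart α) (τ.triv α) f y) := by
  have : CompleteSpace V := FiniteDimensional.complete ℂ V
  exact φ.approxKernel_mollKer.isSmallFamily (𝒜.continuous_cutCLM α)
    (fun y hy => 𝒜.cutCLM_eq_zero α hy) hp
    ((τ.localFrame α).aestronglyMeasurable_localRep hμ (isLpLoc_of_regular hμ 𝒜 hf).1)
    ((τ.localFrame α).regular_localRep hμ hN hp hf)

lemma GoodTriv.mollify_sub_eq_glue (τ : GoodTriv 𝒜 V E) (φ : Kernel n) (ε : Params A)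
    (f : ∀ x, E x) : τ.mollify φ ε f - f = τ.glue fun α y => kerOp (φ.mollKer V (ε α))
        (fun y => 𝒜.cutCLM V α y (localRep (𝒜.chart α) (τ.triv α) f y)) y -
      𝒜.cutCLM V α y (localRep (𝒜.chart α) (τ.triv α) f y) := by
  nth_rewrite 2 [← τ.glue_cutCLM f]
  rw [τ.mollify_eq_glue, ← τ.glue_sub]
  rfl

/-- Approximation by the mollifiers. -/
lemma GoodTriv.limsupZero_mollify_sub (hμ : IsSmoothMeasure n μ) (τ : GoodTriv 𝒜 V E)
    (φ : Kernel n) {N : FibreSeminorm V E} (hN : N.IsNorm) (P : FibreSeminorm V E) {p : ℝ≥0∞}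
    (hp : 1 ≤ p) {f : ∀ x, E x}
    (hf : (p < ⊤ ∧ IsLpLoc N μ p f) ∨ (p = ⊤ ∧ IsContSection V f)) {ζ : M → ℂ}
    (hζ : IsLinfLoc μ ζ) :
    limsupZero (fun ε : Params A => secNorm P μ p ζ (τ.mollify φ ε f - f)) = 0 := by
  have h := τ.limsupZero_glue hμ P hp hζ (τ.isSmallFamily_mollify hμ φ hN hp hf)
  convert h using 3 with ε
  exact congrArg _ (τ.mollify_sub_eq_glue φ ε f)

/-- The commutators are sums of small families. -/
lemma exists_commutator_eq_glue (hμ : IsSmoothMeasure n μ) (τE : GoodTriv 𝒜 V E)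
    (τF : GoodTriv 𝒜 W F) (φ : Kernel n) {N : FibreSeminorm V E} (hN : N.IsNorm) {p : ℝ≥0∞}
    (hp : 1 ≤ p) {f : ∀ x, E x}
    (hf : (p < ⊤ ∧ IsLpLoc N μ p f) ∨ (p = ⊤ ∧ IsContSection V f)) :
    ∃ w : A → ℝ → Euc n → W, (∀ α, IsSmallFamily p (w α)) ∧ ∀ ε : Params A,
      commutator τE τF φ μ hE hF D ε f = τF.glue fun α => w α (ε α) := by
  have : CompleteSpace V := FiniteDimensional.complete ℂ V
  have : CompleteSpace W := FiniteDimensional.complete ℂ W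
  choose a b hab using fun α => D.exists_localCoeff τE τF α
  choose k hk using fun α => φ.exists_approxKernel_commKer (a α) (b α) (hab α).smooth_a
    (hab α).compact_a (hab α).smooth_b (hab α).compact_b
  have hfl := isLpLoc_of_regular hμ 𝒜 hf
  have hv := fun α => (τE.localFrame α).aestronglyMeasurable_localRep hμ hfl.1
  have hr := fun α => (τE.localFrame α).regular_localRep hμ hN hp hf
  have h1 := fun α => (hk α).isSmallFamily (𝒜.continuous_cutCLM (V := V) α)
    (fun y hy => 𝒜.cutCLM_eq_zero α hy) hp (hv α) (hr α)
  have h2 := fun α => (φ.approxKernel_mollKer (V := W)).isSmallFamily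
    (continuous_cutSymbol (𝒜 := 𝒜) (fun α => (hab α).smooth_a) α)
    (fun y hy => cutSymbol_eq_zero a α hy) hp (hv α) (hr α)
  refine ⟨_, fun α => (h1 α).add hp (h2 α), fun ε => ?_⟩
  -- The symbol terms do not tend to zero chart by chart. Subtracting their sum, which is zero,
  -- replaces `J_t(σ_α f)` by `J_t(σ_α f) - σ_α f`, which is small in each chart.
  have h3 : (τF.glue fun α y => cutSymbol 𝒜 a α y (localRep (𝒜.chart α) (τE.triv α) f y)) = 0 := by
    ext x
    exact FirstOrderOp.finsum_symbol_eq_zero τE τF hab f x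
  rw [commutator_eq_glue hμ τE τF φ ε hab
    fun α => (τE.localFrame α).locallyIntegrable_localRep hμ hN hp hfl]
  refine (sub_zero _).symm.trans ?_
  rw [← h3, ← τF.glue_sub]
  congr 1
  ext α y
  simp only [Pi.sub_apply, Pi.add_apply, ContinuousLinearMap.id_apply, _root_.zero_apply, sub_zero,
    add_sub_assoc]

lemma limsupZero_commutator (hμ : IsSmoothMeasure n μ) (τE : GoodTriv 𝒜 V E)
    (τF : GoodTriv 𝒜 W F) (φ : Kernel n) {N : FibreSeminorm V E} (hN : N.IsNorm)
    (P : FibreSeminorm W F) {p : ℝ≥0∞} (hp : 1 ≤ p) {f : ∀ x, E x}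
    (hf : (p < ⊤ ∧ IsLpLoc N μ p f) ∨ (p = ⊤ ∧ IsContSection V f)) {ζ : M → ℂ}
    (hζ : IsLinfLoc μ ζ) :
    limsupZero (fun ε : Params A =>
      secNorm P μ p ζ (commutator τE τF φ μ hE hF D ε f)) = 0 := by
  obtain ⟨w, hw, h⟩ := exists_commutator_eq_glue (D := D) (hE := hE) (hF := hF) hμ τE τF φ hN hp hf
  simp_rw [h]
  exact τF.limsupZero_glue hμ P hp hζ hw

/-- Approximation of weak derivatives by the derivatives of mollifications. -/
lemma limsupZero_app_mollify_sub (hμ : IsSmoothMeasure n μ) (τE : GoodTriv 𝒜 V E)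
    (τF : GoodTriv 𝒜 W F) (φ : Kernel n) {N : FibreSeminorm V E} (hN : N.IsNorm)
    {N' : FibreSeminorm W F} (hN' : N'.IsNorm) {p : ℝ≥0∞} (hp : 1 ≤ p)
    {f : ∀ x, E x} {g : ∀ x, F x} (hfg : D.IsWeakDeriv μ hE hF f g)
    (hf : (p < ⊤ ∧ IsLpLoc N μ p f) ∨ (p = ⊤ ∧ IsContSection V f))
    (hg : (p < ⊤ ∧ IsLpLoc N' μ p g) ∨ (p = ⊤ ∧ IsContSection W g)) {ζ : M → ℂ}
    (hζ : IsLinfLoc μ ζ) :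
    limsupZero (fun ε : Params A => secNorm N' μ p ζ (D.app (τE.mollify φ ε f) - g)) = 0 := by
  obtain ⟨w, hw, h⟩ := exists_commutator_eq_glue (D := D) (hE := hE) (hF := hF) hμ τE τF φ hN hp hf
  have hgl := isLpLoc_of_regular hμ 𝒜 hg
  -- The commutator and `J_ε g - g` are both glued from small families, so their sum is glued from
  -- the sums of these.
  have h1 : ∀ ε : Params A, D.app (τE.mollify φ ε f) - g = τF.glue fun α =>
      (w α + fun s y => kerOp (φ.mollKer W s)
        (fun y => 𝒜.cutCLM W α y (localRep (𝒜.chart α) (τF.triv α) g y)) y -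
      𝒜.cutCLM W α y (localRep (𝒜.chart α) (τF.triv α) g y)) (ε α) := by
    intro ε
    rw [hfg.app_mollify hμ τE τF φ ε
      fun α => (τF.localFrame α).locallyIntegrable_localRep hμ hN' hp hgl, add_sub_assoc,
      τF.mollify_sub_eq_glue, h, ← τF.glue_add]
    rfl
  simp_rw [h1]
  exact τF.limsupZero_glue hμ N' hp hζ fun α =>
    (hw α).add hp (τF.isSmallFamily_mollify hμ φ hN' hp hg α)

end Items


/-! ### Pointwise bounds -/

/-- The density `φ_t(y - ·)` defines a probability measure carried by the ball of radius `t` about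
`y`, so the mollification is a mean of values in `S`. -/
lemma Kernel.mollify_mem {n : ℕ} (φ : Kernel n) {V : Type*} [NormedAddCommGroup V]
    [NormedSpace ℂ V] [CompleteSpace V] {t : ℝ} (ht : t ∈ Ioc (0 : ℝ) 1) {g : Euc n → V}
    (hg : LocallyIntegrable g volume) {y : Euc n} {S : Set V} (hS : Convex ℝ S)
    (hSc : IsClosed S) (h : ∀ᵐ z, ‖y - z‖ ≤ t → g z ∈ S) : φ.mollify t g y ∈ S := by
  have hκ : Continuous fun z => φ.scaled t (y - z) := by
    have := (φ.contDiff_scaled t).continuous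
    fun_prop
  have hκm : Measurable fun z => ENNReal.ofReal (φ.scaled t (y - z)) := hκ.measurable.ennreal_ofReal
  have hi : Integrable fun z => φ.scaled t (y - z) • g z := by
    simpa [Kernel.mollKer] using φ.approxKernel_mollKer (V := V) |>.integrable_apply ht hg y
  have hreal : ∀ z, (ENNReal.ofReal (φ.scaled t (y - z))).toReal = φ.scaled t (y - z) := fun z =>
    ENNReal.toReal_ofReal (φ.scaled_nonneg ht.1 _)
  set ν := (volume : Measure (Euc n)).withDensity fun z => ENNReal.ofReal (φ.scaled t (y - z))
    with hν
  have h1 : ∫ z, φ.scaled t (y - z) = 1 := φ.integral_scaled_sub ht.1 y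
  have hi1 : Integrable fun z => φ.scaled t (y - z) := by
    by_contra hn
    rw [integral_undef hn] at h1
    exact zero_ne_one h1
  have : IsProbabilityMeasure ν := by
    refine ⟨?_⟩
    rw [hν, withDensity_apply _ MeasurableSet.univ, Measure.restrict_univ,
      ← ofReal_integral_eq_lintegral_ofReal hi1
        (Eventually.of_forall fun z => φ.scaled_nonneg ht.1 _), h1, ENNReal.ofReal_one]
  have h2 : φ.mollify t g y = ∫ z, g z ∂ν := by
    rw [hν, integral_withDensity_eq_integral_toReal_smul hκm
      (Eventually.of_forall fun _ => ENNReal.ofReal_lt_top)]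
    simp_rw [hreal]
    rfl
  rw [h2]
  refine hS.integral_mem hSc ?_ ?_
  · rw [hν, ae_withDensity_iff hκm]
    filter_upwards [h] with z hz hne
    refine hz (not_lt.1 fun hlt => hne ?_)
    rw [φ.scaled_eq_zero ht.1 hlt, ENNReal.ofReal_zero]
  · rw [hν, integrable_withDensity_iff_integrable_smul' hκm
      (Eventually.of_forall fun _ => ENNReal.ofReal_lt_top)]
    simpa only [hreal] using hi

section Pointwise

variable {n : ℕ} {M : Type*} [TopologicalSpace M] [ChartedSpace (Euc n) M]
  [IsManifold (𝓡 n) ∞ M] [T2Space M] [SigmaCompactSpace M] [MeasurableSpace M] [BorelSpace M]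
  {μ : Measure M}
variable {V : Type*} [NormedAddCommGroup V] [InnerProductSpace ℂ V] [FiniteDimensional ℂ V]
  {E : M → Type*} [∀ x, AddCommGroup (E x)] [∀ x, Module ℂ (E x)]
  [∀ x, TopologicalSpace (E x)] [TopologicalSpace (TotalSpace V E)] [FiberBundle V E]
  [VectorBundle ℂ V E] [VectorBundle ℝ V E] [ContMDiffVectorBundle ∞ V E (𝓡 n)]
variable {W : Type*} [NormedAddCommGroup W] [InnerProductSpace ℂ W] [FiniteDimensional ℂ W]
  {F : M → Type*} [∀ x, AddCommGroup (F x)] [∀ x, Module ℂ (F x)]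
  [∀ x, TopologicalSpace (F x)] [TopologicalSpace (TotalSpace W F)] [FiberBundle W F]
  [VectorBundle ℂ W F] [VectorBundle ℝ W F] [ContMDiffVectorBundle ∞ W F (𝓡 n)]
variable {A : Type*} {𝒜 : GoodAtlas n M A}

/-- The mollification at `y` averages `η(z) v(z)` over nearby `z`, and a sublevel set of the
seminorm at `y` is closed and convex. It remains to compare `η(z) P_y(v(z))` with `η(y) P_z(v(z))`,
and `P_z(v(z)) ≤ s`. Keeping the factor `η(y)` in the bound lets the estimates be summed over a
partition of unity without loss. -/
lemma LocalFrame.exists_seminorm_mollify_le {e : OpenPartialHomeomorph M (Euc n)}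
    {t : Trivialization V (π V E)} (h : LocalFrame e t) (P : FibreSeminorm V E) (φ : Kernel n)
    {η : Euc n → ℝ} (hη : Continuous η) (hη0 : ∀ y, 0 ≤ η y)
    (hηs : ∀ y ∉ Metric.closedBall (0 : Euc n) 1, η y = 0) {v : Euc n → V}
    (hv : LocallyIntegrable v volume) {R : ℝ}
    (hR : ∀ᵐ z, z ∈ Metric.closedBall (0 : Euc n) 1 → ‖v z‖ ≤ R) {C U : Set (Euc n)}
    (hC : IsClosed C) (hU : IsOpen U) (hCU : C ⊆ U) {s : ℝ} (hs : 0 ≤ s)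
    (hvs : ∀ᵐ z, z ∈ U → h.seminormAt P z (v z) ≤ s) {δ : ℝ} (hδ : 0 < δ) :
    ∃ t₀ : ℝ, 0 < t₀ ∧ ∀ t ∈ Ioc (0 : ℝ) 1, t ≤ t₀ → ∀ y ∈ C,
      h.seminormAt P y (φ.mollify t (fun z => η z • v z) y) ≤ η y * s + δ := by
  have : CompleteSpace V := FiniteDimensional.complete ℂ V
  have : ProperSpace V := FiniteDimensional.proper_rclike ℂ V
  have hK : IsCompact (C ∩ Metric.closedBall (0 : Euc n) 2) :=
    (isCompact_closedBall _ _).inter_left hC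
  obtain ⟨d₁, hd₁, hthick⟩ := hK.exists_cthickening_subset_open hU
    (inter_subset_left.trans hCU)
  -- `Q` vanishes when its first two arguments coincide, so its uniform continuity on a compact set
  -- bounds it by `δ` for nearby arguments.
  set Q : Euc n × Euc n × V → ℝ := fun q =>
    η q.2.1 * h.seminormAt P q.1 q.2.2 - η q.1 * h.seminormAt P q.2.1 q.2.2 with hQ
  have hQc : Continuous Q := by
    have h1 : Continuous fun q : Euc n × Euc n × V => h.seminormAt P q.1 q.2.2 :=
      (h.continuous_seminormAt P).comp
        (by fun_prop : Continuous fun q : Euc n × Euc n × V => (q.1, q.2.2))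
    have h2 : Continuous fun q : Euc n × Euc n × V => h.seminormAt P q.2.1 q.2.2 :=
      (h.continuous_seminormAt P).comp
        (by fun_prop : Continuous fun q : Euc n × Euc n × V => (q.2.1, q.2.2))
    have h3 : Continuous fun q : Euc n × Euc n × V => η q.2.1 := by fun_prop
    have h4 : Continuous fun q : Euc n × Euc n × V => η q.1 := by fun_prop
    exact (h3.mul h1).sub (h4.mul h2)
  have hcomp : IsCompact (Metric.closedBall (0 : Euc n) 2 ×ˢ Metric.closedBall (0 : Euc n) 2 ×ˢ
      Metric.closedBall (0 : V) R) :=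
    (isCompact_closedBall _ _).prod ((isCompact_closedBall _ _).prod (isCompact_closedBall _ _))
  obtain ⟨d₂, hd₂, huc⟩ := Metric.uniformContinuousOn_iff.1
    (hcomp.uniformContinuousOn_of_continuous hQc.continuousOn) δ hδ
  refine ⟨min d₁ (d₂ / 2), lt_min hd₁ (half_pos hd₂), fun t ht htt y hy => ?_⟩
  have hnn : 0 ≤ η y * s + δ := add_nonneg (mul_nonneg (hη0 y) hs) hδ.le
  -- Beyond radius 2 the mollification is zero, so only a compact part of `C` matters; that is why
  -- one `d₁` keeps the averaging ball inside `U`.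
  by_cases hy2 : y ∈ Metric.closedBall (0 : Euc n) 2
  swap
  · rw [φ.mollify_eq_zero ht fun z hz => ?_, map_zero]
    · exact hnn
    · rw [hηs z fun hz1 => hy2 ?_, zero_smul]
      rw [mem_closedBall_zero_iff] at hz1 ⊢
      have := norm_add_le (y - z) z
      rw [sub_add_cancel] at this
      linarith [ht.2]
  have hconv : Convex ℝ {u : V | h.seminormAt P y u ≤ η y * s + δ} := by
    have := (h.seminormAt P y).convex_closedBall 0 (η y * s + δ)
    rwa [Seminorm.closedBall_zero_eq] at this
  have hclosed : IsClosed {u : V | h.seminormAt P y u ≤ η y * s + δ} :=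
    isClosed_le ((h.continuous_seminormAt P).comp (Continuous.prodMk_right y)) continuous_const
  refine φ.mollify_mem ht (hv.continuous_smul hη) hconv hclosed ?_
  filter_upwards [hR, hvs] with z hz1 hz2 hyz
  change h.seminormAt P y (η z • v z) ≤ _
  have h1 : h.seminormAt P y (η z • v z) = η z * h.seminormAt P y (v z) := by
    rw [← Complex.coe_smul, map_smul_eq_mul, Complex.norm_real, Real.norm_of_nonneg (hη0 z)]
  rw [h1]
  by_cases hzb : z ∈ Metric.closedBall (0 : Euc n) 1
  swap
  · rw [hηs z hzb, zero_mul]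
    exact hnn
  have hz2b := Metric.closedBall_subset_closedBall (by norm_num : (1 : ℝ) ≤ 2) hzb
  have hvR : v z ∈ Metric.closedBall (0 : V) R := mem_closedBall_zero_iff.2 (hz1 hzb)
  have hzU : z ∈ U := hthick (Metric.mem_cthickening_of_dist_le z y d₁ _ ⟨hy, hy2⟩ (by
    rw [dist_comm, dist_eq_norm]
    exact hyz.trans (htt.trans (min_le_left _ _))))
  have h2 := huc (y, z, v z) ⟨hy2, hz2b, hvR⟩ (y, y, v z) ⟨hy2, hy2, hvR⟩ (by
    rw [Prod.dist_eq, Prod.dist_eq, dist_self, dist_self]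
    simp only [dist_nonneg, sup_of_le_left, sup_of_le_right]
    rw [dist_comm, dist_eq_norm]
    linarith [htt.trans (min_le_right _ _)])
  rw [Real.dist_eq] at h2
  simp only [hQ, sub_self, sub_zero] at h2
  have h3 := (abs_lt.1 h2).2
  have h4 : η y * h.seminormAt P z (v z) ≤ η y * s := mul_le_mul_of_nonneg_left (hz2 hzU) (hη0 y)
  linarith

/-- The upper bound for mollifications of locally bounded sections. -/
lemma GoodTriv.limsupZero_iSup_mollify_le (hμ : IsSmoothMeasure n μ) (τ : GoodTriv 𝒜 V E)
    (φ : Kernel n) {N : FibreSeminorm V E} (hN : N.IsNorm) {f : ∀ x, E x} (hf : IsLpLoc N μ ⊤ f)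
    (P : FibreSeminorm V E) {C : Set M} (hC : IsClosed C) :
    limsupZero (fun ε : Params A =>
        ⨆ x ∈ C, ENNReal.ofReal (P.seminorm x (τ.mollify φ ε f x))) ≤
      ⨅ (U : Set M) (_ : IsOpen U) (_ : C ⊆ U),
        essSup (fun x => ENNReal.ofReal (P.seminorm x (f x))) (μ.restrict U) := by
  have := 𝒜.countable
  refine le_iInf fun U => le_iInf fun hU => le_iInf fun hCU => ?_
  set S := essSup (fun x => ENNReal.ofReal (P.seminorm x (f x))) (μ.restrict U) with hS
  rcases eq_or_ne S ⊤ with hSt | hSt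
  · rw [hSt]
    exact le_top
  refine ENNReal.le_of_forall_pos_le_add fun δ hδ _ => limsupZero_le ?_
  -- The charts contribute `η_α(x) S + d α` at `x`; the functions `η_α` sum to 1 and the errors `d
  -- α` to less than `δ`, whence `S + δ`.
  obtain ⟨d, hd0, c, hdc, hcδ⟩ := NNReal.exists_pos_sum_of_countable hδ.ne' A
  have hae : ∀ᵐ x ∂μ, x ∈ U → P.seminorm x (f x) ≤ S.toReal := by
    rw [← ae_restrict_iff' hU.measurableSet]
    filter_upwards [ENNReal.ae_le_essSup (μ := μ.restrict U)
      fun x => ENNReal.ofReal (P.seminorm x (f x))] with x hx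
    exact (ENNReal.ofReal_le_iff_le_toReal hSt).1 hx
  have h1 : ∀ α, ∃ t₀ : ℝ, 0 < t₀ ∧ ∀ t ∈ Ioc (0 : ℝ) 1, t ≤ t₀ →
      ∀ y ∈ (𝒜.chart α).symm ⁻¹' C, (τ.localFrame α).seminormAt P y
        (φ.mollify t (τ.cutRep α f) y) ≤ 𝒜.cut α y * S.toReal + d α := by
    intro α
    have hα := τ.localFrame α
    have hm := hα.memLp_localRep hμ hN le_top hf (isCompact_closedBall (0 : Euc n) 1)
    rw [τ.cutRep_eq]
    refine hα.exists_seminorm_mollify_le P φ (𝒜.contDiff_cut α).continuous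
      (fun y => 𝒜.η.nonneg α _)
      (fun y hy => image_eq_zero_of_notMem_tsupport (𝒜.notMem_tsupport_cut α hy))
      (hα.locallyIntegrable_localRep hμ hN le_top hf)
      (R := (eLpNorm (localRep (𝒜.chart α) (τ.triv α) f) ⊤
        (volume.restrict (Metric.closedBall 0 1))).toReal) ?_
      (hC.preimage hα.continuous_symm) (hU.preimage hα.continuous_symm) (preimage_mono hCU)
      ENNReal.toReal_nonneg ?_ (by exact_mod_cast hd0 α)
    · rw [← ae_restrict_iff' Metric.isClosed_closedBall.measurableSet]
      filter_upwards [enorm_ae_le_eLpNormEssSup (localRep (𝒜.chart α) (τ.triv α) f)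
        (volume.restrict (Metric.closedBall 0 1))] with z hz
      rw [← toReal_enorm]
      exact ENNReal.toReal_mono hm.2.ne (by rwa [eLpNorm_exponent_top])
    · filter_upwards [hμ.ae_chart hα.mem hα.target (ae_restrict_of_ae hae)] with z hz hzU
      rw [hα.seminormAt_localRep]
      exact hz hzU
  obtain ⟨εbar, h⟩ := exists_params h1
  refine ⟨εbar, fun ε hε => iSup₂_le fun x hx => ?_⟩
  set I := (𝒜.finite_mem x).toFinset with hI
  have hsub : (Function.support fun α => P.seminorm x
      (fromLocal (𝒜.chart α) (τ.triv α) (φ.mollify (ε α) (τ.cutRep α f)) x)) ⊆ I := by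
    intro α hα
    rw [hI, Finite.coe_toFinset]
    by_contra hne
    exact hα (by simp only [LocalFrame.fromLocal_of_notMem _ hne, map_zero])
  have hη : ∑ α ∈ I, 𝒜.η α x = 1 := by
    rw [← 𝒜.η.sum_eq_one (mem_univ x)]
    refine (finsum_eq_sum_of_support_subset _ fun α hα => ?_).symm
    rw [hI, Finite.coe_toFinset]
    exact (𝒜.tsupport_subset α (subset_tsupport _ hα)).1
  have hd : ∑ α ∈ I, (d α : ℝ) ≤ δ := by
    have h2 : ∑ α ∈ I, d α ≤ δ := (sum_le_hasSum I (fun _ _ => zero_le) hdc).trans hcδ.le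
    exact_mod_cast h2
  have key : P.seminorm x (τ.mollify φ ε f x) ≤ S.toReal + δ := by
    calc _ ≤ ∑ α ∈ I, P.seminorm x
          (fromLocal (𝒜.chart α) (τ.triv α) (φ.mollify (ε α) (τ.cutRep α f)) x) := by
          rw [← finsum_eq_sum_of_support_subset _ hsub]
          exact τ.seminorm_glue_le P _ x
      _ ≤ ∑ α ∈ I, (𝒜.η α x * S.toReal + d α) := by
          refine Finset.sum_le_sum fun α hα => ?_
          rw [hI, Finite.mem_toFinset] at hα
          obtain ⟨y, rfl⟩ := (τ.localFrame α).exists_eq hα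
          rw [(τ.localFrame α).seminorm_fromLocal]
          exact h ε hε α y hx
      _ ≤ _ := by
          rw [Finset.sum_add_distrib, ← Finset.sum_mul, hη, one_mul]
          gcongr
  calc _ ≤ ENNReal.ofReal (S.toReal + δ) := ENNReal.ofReal_le_ofReal key
    _ = S + δ := by
        rw [ENNReal.ofReal_add ENNReal.toReal_nonneg δ.coe_nonneg, ENNReal.ofReal_toReal hSt,
          ENNReal.ofReal_coe_nnreal]

lemma limsupZero_le_of_le_add {G G' H : Params A → ℝ≥0∞} (h : ∀ ε, G ε ≤ G' ε + H ε)
    (hH : limsupZero H = 0) : limsupZero G ≤ limsupZero G' := by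
  refine ENNReal.le_of_forall_pos_le_add fun δ hδ _ => ?_
  obtain ⟨εbar, h1⟩ := exists_of_limsupZero_eq_zero hH (ENNReal.coe_ne_zero.2 hδ.ne')
  rw [limsupZero, limsupZero, ENNReal.iInf_add]
  -- Thresholds are directed downwards: the componentwise minimum serves both terms.
  refine le_iInf fun ε' => (iInf_le _ (ε' ⊓ εbar)).trans (iSup₂_le fun ε hε => ?_)
  refine (h ε).trans (add_le_add ?_ (h1 ε (hε.trans inf_le_right)))
  exact le_iSup₂ (f := fun ε (_ : ε ≤ ε') => G' ε) ε (hε.trans inf_le_left)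

lemma IsSmoothSection.continuous_seminorm {f : ∀ x, E x} (hf : IsSmoothSection n V f)
    (P : FibreSeminorm V E) : Continuous fun x => P.seminorm x (f x) :=
  P.continuous.comp hf.continuous

/-- The set where the bound fails is open by continuity and null by definition of the essential
supremum, hence empty. -/
lemma IsSmoothSection.seminorm_le_secNorm [μ.IsOpenPosMeasure] {f : ∀ x, E x}
    (hf : IsSmoothSection n V f) (P : FibreSeminorm V E) (x : M) :
    ENNReal.ofReal (P.seminorm x (f x)) ≤ secNorm P μ ⊤ (fun _ => 1) f := by
  by_contra hlt
  rw [not_le] at hlt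
  have hc : Continuous fun x => ENNReal.ofReal (P.seminorm x (f x)) :=
    ENNReal.continuous_ofReal.comp (hf.continuous_seminorm P)
  have ho : IsOpen {x | secNorm P μ ⊤ (fun _ => 1) f < ENNReal.ofReal (P.seminorm x (f x))} :=
    isOpen_lt continuous_const hc
  refine (ho.measure_pos μ ⟨x, hlt⟩).ne' (measure_eq_zero_iff_ae_notMem.2 ?_)
  filter_upwards [enorm_ae_le_eLpNormEssSup (fun x => ‖(1 : ℂ)‖ * P.seminorm x (f x)) μ] with y hy
  refine not_lt.2 (le_trans ?_ (hy.trans (eLpNorm_exponent_top).ge))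
  rw [norm_one, one_mul, ← ofReal_norm, Real.norm_of_nonneg (apply_nonneg _ _)]

variable {D : FirstOrderOp n V E W F} {hE : HermitianMetric n V E} {hF : HermitianMetric n W F}

/-- It is the difference of the smooth sections `D J_ε f` and `J_ε g`. Continuity allows its
pointwise supremum to be controlled by its essential supremum. -/
lemma FirstOrderOp.IsWeakDeriv.isSmoothSection_commutator (hμ : IsSmoothMeasure n μ)
    (τE : GoodTriv 𝒜 V E) (τF : GoodTriv 𝒜 W F) (φ : Kernel n) (ε : Params A) {f : ∀ x, E x}
    {g : ∀ x, F x} (hfg : D.IsWeakDeriv μ hE hF f g)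
    (hf : ∀ α, LocallyIntegrable (localRep (𝒜.chart α) (τE.triv α) f) volume)
    (hg : ∀ α, LocallyIntegrable (localRep (𝒜.chart α) (τF.triv α) g) volume) :
    IsSmoothSection n W (commutator τE τF φ μ hE hF D ε f) := by
  rw [← sub_eq_iff_eq_add.2 (hfg.app_mollify hμ τE τF φ ε hg)]
  exact (D.isSmoothSection_app (τE.isSmoothSection_mollify φ ε hf)).sub
    (τF.isSmoothSection_mollify φ ε hg)

/-- The upper bound for the derivatives of mollifications. -/
lemma FirstOrderOp.IsWeakDeriv.limsupZero_iSup_app_mollify_le (hμ : IsSmoothMeasure n μ)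
    (τE : GoodTriv 𝒜 V E) (τF : GoodTriv 𝒜 W F) (φ : Kernel n) {N : FibreSeminorm V E}
    (hN : N.IsNorm) {N' : FibreSeminorm W F} (hN' : N'.IsNorm) {f : ∀ x, E x} {g : ∀ x, F x}
    (hf : IsContSection V f) (hg : IsLpLoc N' μ ⊤ g) (hfg : D.IsWeakDeriv μ hE hF f g)
    (P : FibreSeminorm W F) {C : Set M} (hC : IsClosed C) :
    limsupZero (fun ε : Params A =>
        ⨆ x ∈ C, ENNReal.ofReal (P.seminorm x (D.app (τE.mollify φ ε f) x))) ≤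
      ⨅ (U : Set M) (_ : IsOpen U) (_ : C ⊆ U),
        essSup (fun x => ENNReal.ofReal (P.seminorm x (g x))) (μ.restrict U) := by
  have := hμ.isOpenPosMeasure 𝒜
  have hreg : ((⊤ : ℝ≥0∞) < ⊤ ∧ IsLpLoc N μ ⊤ f) ∨ ((⊤ : ℝ≥0∞) = ⊤ ∧ IsContSection V f) :=
    Or.inr ⟨rfl, hf⟩
  have hfl := fun α => (τE.localFrame α).locallyIntegrable_localRep hμ hN le_top
    (isLpLoc_of_regular hμ 𝒜 hreg)
  have hgl := fun α => (τF.localFrame α).locallyIntegrable_localRep hμ hN' le_top hg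
  -- The multiplier may be the constant 1, so the commutator vanishes uniformly on all of `M` and
  -- noncompact `C` cause no difficulty.
  have hone : IsLinfLoc μ fun _ : M => (1 : ℂ) := by
    refine ⟨aestronglyMeasurable_const, fun K _ => ?_⟩
    exact (eLpNormEssSup_le_of_ae_bound (C := 1) (Eventually.of_forall fun _ => by simp)).trans_lt
      ENNReal.ofReal_lt_top
  refine (limsupZero_le_of_le_add (fun ε => ?_) (limsupZero_commutator (D := D) (hE := hE)
    (hF := hF) hμ τE τF φ hN P le_top hreg hone)).trans
    (τF.limsupZero_iSup_mollify_le hμ φ hN' hg P hC)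
  refine iSup₂_le fun x hx => ?_
  rw [hfg.app_mollify hμ τE τF φ ε hgl, add_comm, Pi.add_apply]
  refine (ENNReal.ofReal_le_ofReal (map_add_le_add _ _ _)).trans (ENNReal.ofReal_add_le.trans ?_)
  refine add_le_add ?_
    ((hfg.isSmoothSection_commutator hμ τE τF φ ε hfl hgl).seminorm_le_secNorm P x)
  exact le_iSup₂ (f := fun x (_ : x ∈ C) => ENNReal.ofReal (P.seminorm x (τF.mollify φ ε g x))) x hx

end Pointwise


section Linearity

variable {n : ℕ} {M : Type*} [TopologicalSpace M] [ChartedSpace (Euc n) M]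
  [IsManifold (𝓡 n) ∞ M] [T2Space M] [SigmaCompactSpace M] [MeasurableSpace M] [BorelSpace M]
  {μ : Measure M}
variable {V : Type*} [NormedAddCommGroup V] [InnerProductSpace ℂ V] [FiniteDimensional ℂ V]
  {E : M → Type*} [∀ x, AddCommGroup (E x)] [∀ x, Module ℂ (E x)]
  [∀ x, TopologicalSpace (E x)] [TopologicalSpace (TotalSpace V E)] [FiberBundle V E]
  [VectorBundle ℂ V E] [VectorBundle ℝ V E] [ContMDiffVectorBundle ∞ V E (𝓡 n)]
variable {W : Type*} [NormedAddCommGroup W] [InnerProductSpace ℂ W] [FiniteDimensional ℂ W]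
  {F : M → Type*} [∀ x, AddCommGroup (F x)] [∀ x, Module ℂ (F x)]
  [∀ x, TopologicalSpace (F x)] [TopologicalSpace (TotalSpace W F)] [FiberBundle W F]
  [VectorBundle ℂ W F] [VectorBundle ℝ W F] [ContMDiffVectorBundle ∞ W F (𝓡 n)]
variable {A : Type*} {𝒜 : GoodAtlas n M A}

/-! ### Linearity and supports -/

lemma GoodTriv.ae_localRep (hμ : IsSmoothMeasure n μ) (τ : GoodTriv 𝒜 V E) (α : A)
    {Q : M → Prop} (h : ∀ᵐ x ∂μ, Q x) : ∀ᵐ y, Q ((𝒜.chart α).symm y) :=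
  hμ.ae_chart (τ.localFrame α).mem (τ.localFrame α).target (ae_restrict_of_ae h)

lemma GoodTriv.mollify_congr_ae (hμ : IsSmoothMeasure n μ) (τ : GoodTriv 𝒜 V E) (φ : Kernel n)
    (ε : Params A) {f g : ∀ x, E x} (h : ∀ᵐ x ∂μ, f x = g x) :
    τ.mollify φ ε f = τ.mollify φ ε g := by
  ext x
  refine finsum_congr fun α => ?_
  congr 1
  ext y
  refine integral_congr_ae ?_
  filter_upwards [τ.ae_localRep hμ α h] with z hz
  simp only [τ.cutRep_eq, localRep, hz]

lemma GoodTriv.mollify_add (τ : GoodTriv 𝒜 V E) (φ : Kernel n)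
    (ε : Params A) {f g : ∀ x, E x}
    (hf : ∀ α, LocallyIntegrable (localRep (𝒜.chart α) (τ.triv α) f) volume)
    (hg : ∀ α, LocallyIntegrable (localRep (𝒜.chart α) (τ.triv α) g) volume) :
    τ.mollify φ ε (f + g) = τ.mollify φ ε f + τ.mollify φ ε g := by
  have : CompleteSpace V := FiniteDimensional.complete ℂ V
  have hint : ∀ α (f : ∀ x, E x), LocallyIntegrable (localRep (𝒜.chart α) (τ.triv α) f) volume →
      ∀ y, Integrable fun z => φ.scaled (ε α) (y - z) • τ.cutRep α f z := by
    intro α f hf y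
    simpa [Kernel.mollKer] using φ.approxKernel_mollKer (V := V) |>.integrable_apply (ε α).2
      (τ.locallyIntegrable_cutRep hf) y
  refine Eq.trans ?_ (τ.glue_add (fun α => φ.mollify (ε α) (τ.cutRep α f))
    (fun α => φ.mollify (ε α) (τ.cutRep α g)))
  ext x
  refine finsum_congr fun α => ?_
  congr 1
  ext y
  refine Eq.trans ?_ (integral_add (hint α f (hf α) y) (hint α g (hg α) y))
  refine integral_congr_ae (Eventually.of_forall fun z => ?_)
  simp only [τ.cutRep_eq, (τ.localFrame α).localRep_add, Pi.add_apply, smul_add]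

lemma GoodTriv.mollify_smul (τ : GoodTriv 𝒜 V E) (φ : Kernel n)
    (ε : Params A) (c : ℂ) (f : ∀ x, E x) :
    τ.mollify φ ε (c • f) = c • τ.mollify φ ε f := by
  ext x
  rw [Pi.smul_apply, GoodTriv.mollify, GoodTriv.mollify, smul_finsum' c (τ.finite_support _ x)]
  refine finsum_congr fun α => ?_
  rw [← Pi.smul_apply, ← (τ.localFrame α).fromLocal_smul]
  congr 1
  ext y
  refine Eq.trans ?_ (integral_smul c _)
  refine integral_congr_ae (Eventually.of_forall fun z => ?_)
  simp only [τ.cutRep_eq, (τ.localFrame α).localRep_smul, Pi.smul_apply]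
  rw [smul_comm (𝒜.cut α z) c, smul_comm (φ.scaled (ε α) (y - z)) c]

/-- Mollification moves supports by an arbitrarily small amount. -/
lemma GoodTriv.exists_secSupport_mollify_subset (hμ : IsSmoothMeasure n μ) (τ : GoodTriv 𝒜 V E)
    (φ : Kernel n) {C U : Set M} (hC : IsClosed C) (hU : IsOpen U) (hCU : C ⊆ U) :
    ∃ εbar : Params A, ∀ f : ∀ x, E x, (∀ᵐ x ∂μ, x ∉ C → f x = 0) →
      ∀ ε ≤ εbar, secSupport (τ.mollify φ ε f) ⊆ U := by
  -- Only the part of `C` where the cutoff can be nonzero matters; being compact, it has a closed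
  -- neighbourhood of positive radius inside the open set.
  have hK : ∀ α, IsCompact ((𝒜.chart α).symm ⁻¹' C ∩ Metric.closedBall (0 : Euc n) 1) := fun α =>
    (isCompact_closedBall _ _).inter_left (hC.preimage (τ.localFrame α).continuous_symm)
  choose d hd hthick using fun α => (hK α).exists_cthickening_subset_open
    (hU.preimage (τ.localFrame α).continuous_symm)
    (inter_subset_left.trans (preimage_mono hCU))
  set K' : A → Set M := fun α => (𝒜.chart α).symm ''
    Metric.cthickening (d α) ((𝒜.chart α).symm ⁻¹' C ∩ Metric.closedBall (0 : Euc n) 1) with hK'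
  -- The support is a closure, so the set that contains the nonzero values must itself be closed;
  -- this uses local finiteness of the atlas.
  have hclosed : IsClosed (⋃ α, K' α) := by
    refine LocallyFinite.isClosed_iUnion (𝒜.locallyFinite.subset fun α => ?_) fun α => ?_
    · rintro _ ⟨y, -, rfl⟩
      exact (τ.localFrame α).mem_source y
    · exact ((hK α).cthickening.image (τ.localFrame α).continuous_symm).isClosed
  obtain ⟨εbar, hε⟩ := exists_params (Q := fun α t => t ≤ d α)
    fun α => ⟨d α, hd α, fun _ _ h => h⟩
  refine ⟨εbar, fun f hf ε hεε => ?_⟩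
  have hsub : (⋃ α, K' α) ⊆ U := by
    refine iUnion_subset fun α => ?_
    rintro _ ⟨y, hy, rfl⟩
    exact hthick α hy
  refine (closure_minimal (fun x hx => ?_) hclosed).trans hsub
  obtain ⟨α, hα⟩ : ∃ α, fromLocal (𝒜.chart α) (τ.triv α)
      (φ.mollify (ε α) (τ.cutRep α f)) x ≠ 0 := by
    by_contra! h
    exact hx (finsum_eq_zero_of_forall_eq_zero h)
  obtain ⟨y, hy, rfl⟩ := (τ.localFrame α).fromLocal_ne_zero hα
  refine mem_iUnion.2 ⟨α, y, by_contra fun hyK => hy ?_, rfl⟩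
  refine integral_eq_zero_of_ae ?_
  filter_upwards [τ.ae_localRep hμ α hf] with z hz
  by_cases hzK : z ∈ (𝒜.chart α).symm ⁻¹' C ∩ Metric.closedBall (0 : Euc n) 1
  · have h1 : (ε α : ℝ) < ‖y - z‖ := by
      rw [← dist_eq_norm]
      refine (hε ε hεε α).trans_lt (not_le.1 fun h => hyK ?_)
      exact Metric.mem_cthickening_of_dist_le y z _ _ hzK h
    rw [φ.scaled_eq_zero (ε α).2.1 h1, zero_smul]
    rfl
  · have h1 : τ.cutRep α f z = 0 := by
      by_cases hz1 : z ∈ Metric.closedBall (0 : Euc n) 1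
      · have h2 := hz fun h => hzK ⟨h, hz1⟩
        rw [τ.cutRep_eq]
        simp only
        rw [(τ.localFrame α).localRep_eq, h2, map_zero, smul_zero]
      · exact τ.cutRep_eq_zero α f fun h => hz1 (Metric.ball_subset_closedBall h)
    rw [h1, smul_zero]
    rfl

/-! ### Sums of multipliers -/

lemma IsLinfLoc.norm_add_norm {ξ ξ' : M → ℂ} (h : IsLinfLoc μ ξ) (h' : IsLinfLoc μ ξ') :
    IsLinfLoc μ fun x => ((‖ξ x‖ + ‖ξ' x‖ : ℝ) : ℂ) := by
  have hm := h.1.norm.add h'.1.norm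
  refine ⟨Complex.continuous_ofReal.comp_aestronglyMeasurable hm, fun K hK => ?_⟩
  have h1 := (show MemLp ξ ⊤ (μ.restrict K) from ⟨h.1.restrict, h.2 K hK⟩).norm.add
    (show MemLp ξ' ⊤ (μ.restrict K) from ⟨h'.1.restrict, h'.2 K hK⟩).norm
  exact h1.ofReal.2

lemma IsLinfComp.norm_add_norm {ξ ξ' : M → ℂ} (h : IsLinfComp μ ξ) (h' : IsLinfComp μ ξ') :
    IsLinfComp μ fun x => ((‖ξ x‖ + ‖ξ' x‖ : ℝ) : ℂ) := by
  obtain ⟨K, hK, hK0⟩ := h.2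
  obtain ⟨K', hK', hK0'⟩ := h'.2
  refine ⟨h.1.norm_add_norm h'.1, K ∪ K', hK.union hK', ?_⟩
  filter_upwards [hK0, hK0'] with x hx hx' hxK
  rw [mem_union, not_or] at hxK
  simp [hx hxK.1, hx' hxK.2]

lemma secNorm_mono {N : FibreSeminorm V E} {p : ℝ≥0∞} {ξ ξ' : M → ℂ}
    (h : ∀ x, ‖ξ x‖ ≤ ‖ξ' x‖) (f : ∀ x, E x) : secNorm N μ p ξ f ≤ secNorm N μ p ξ' f := by
  refine eLpNorm_mono_real fun x => ?_
  rw [Real.norm_of_nonneg (mul_nonneg (norm_nonneg _) (apply_nonneg _ _))]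
  gcongr
  exact h x

variable {D : FirstOrderOp n V E W F} {hE : HermitianMetric n V E} {hF : HermitianMetric n W F}

/-- Equicontinuity of the differentiated mollifiers. -/
lemma exists_secNorm_app_mollify_le (hμ : IsSmoothMeasure n μ) (τE : GoodTriv 𝒜 V E)
    (τF : GoodTriv 𝒜 W F) (φ : Kernel n) {N : FibreSeminorm V E} (hN : N.IsNorm)
    {N' : FibreSeminorm W F} (hN' : N'.IsNorm) {ζ : M → ℂ} (hζ : IsLinfLoc μ ζ) {p : ℝ≥0∞}
    (hp : 1 ≤ p) :
    ∃ ξ : M → ℂ, IsLinfLoc μ ξ ∧ (IsLinfComp μ ζ → IsLinfComp μ ξ) ∧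
      ∀ (f : ∀ x, E x) (g : ∀ x, F x), IsLpLoc N μ p f → IsLpLoc N' μ p g →
        D.IsWeakDeriv μ hE hF f g → ∀ ε : Params A,
          secNorm N' μ p ζ (D.app (τE.mollify φ ε f)) ≤
            secNorm N μ p ξ f + secNorm N' μ p ξ g := by
  obtain ⟨ξ, hξ, hξc, h1⟩ := exists_secNorm_commutator_le (D := D) (hE := hE) (hF := hF)
    hμ τE τF φ hN N' hζ hp
  obtain ⟨ξ', hξ', hξc', h2⟩ := τF.exists_secNorm_mollify_le hμ φ hN' hζ hp
  refine ⟨_, hξ.norm_add_norm hξ', fun hc => (hξc hc).norm_add_norm (hξc' hc),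
    fun f g hf hg hfg ε => ?_⟩
  have hfl := fun α => (τE.localFrame α).locallyIntegrable_localRep hμ hN hp hf
  have hgl := fun α => (τF.localFrame α).locallyIntegrable_localRep hμ hN' hp hg
  have m1 := hfg.isSmoothSection_commutator hμ τE τF φ ε hfl hgl
  have m2 := τF.isSmoothSection_mollify φ ε hgl
  have := ChartedSpace.secondCountable_of_sigmaCompact (Euc n) M
  have hnorm : ∀ x, ‖((‖ξ x‖ + ‖ξ' x‖ : ℝ) : ℂ)‖ = ‖ξ x‖ + ‖ξ' x‖ := fun x => by
    rw [Complex.norm_real, Real.norm_of_nonneg (by positivity)]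
  calc secNorm N' μ p ζ (D.app (τE.mollify φ ε f))
      ≤ secNorm N' μ p ζ (commutator τE τF φ μ hE hF D ε f) +
          secNorm N' μ p ζ (τF.mollify φ ε g) := by
        rw [hfg.app_mollify hμ τE τF φ ε hgl]
        refine le_trans (eLpNorm_mono_real fun x => ?_) (eLpNorm_add_le
          (hζ.1.norm.mul (m1.continuous_seminorm N').aestronglyMeasurable)
          (hζ.1.norm.mul (m2.continuous_seminorm N').aestronglyMeasurable) hp)
        rw [Real.norm_of_nonneg (mul_nonneg (norm_nonneg _) (apply_nonneg _ _)), Pi.add_apply,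
          Pi.add_apply, ← mul_add]
        gcongr
        exact map_add_le_add _ _ _
    _ ≤ secNorm N μ p ξ f + secNorm N' μ p ξ' g := add_le_add (h1 f hf ε) (h2 g hg ε)
    _ ≤ _ := by
        refine add_le_add (secNorm_mono (fun x => ?_) f) (secNorm_mono (fun x => ?_) g)
        · rw [hnorm]
          exact le_add_of_nonneg_right (norm_nonneg _)
        · rw [hnorm]
          exact le_add_of_nonneg_left (norm_nonneg _)

end Linearity

end Friedrichs

end

theorem mainTheorem10
    {n : ℕ} {M : Type*} [TopologicalSpace M] [T2Space M] [SigmaCompactSpace M]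
    [ChartedSpace (Friedrichs.Euc n) M] [IsManifold (𝓡 n) ∞ M]
    [MeasurableSpace M] [BorelSpace M]
    (μ : Measure M) (hμ : Friedrichs.IsSmoothMeasure n μ)
    {V : Type*} [NormedAddCommGroup V] [InnerProductSpace ℂ V] [FiniteDimensional ℂ V]
    {E : M → Type*} [∀ x, AddCommGroup (E x)] [∀ x, Module ℂ (E x)]
    [∀ x, TopologicalSpace (E x)] [TopologicalSpace (TotalSpace V E)] [FiberBundle V E]
    [VectorBundle ℂ V E] [VectorBundle ℝ V E] [ContMDiffVectorBundle ∞ V E (𝓡 n)]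
    {W : Type*} [NormedAddCommGroup W] [InnerProductSpace ℂ W] [FiniteDimensional ℂ W]
    {F : M → Type*} [∀ x, AddCommGroup (F x)] [∀ x, Module ℂ (F x)]
    [∀ x, TopologicalSpace (F x)] [TopologicalSpace (TotalSpace W F)] [FiberBundle W F]
    [VectorBundle ℂ W F] [VectorBundle ℝ W F] [ContMDiffVectorBundle ∞ W F (𝓡 n)]
    (NE : Friedrichs.FibreSeminorm V E) (hNE : NE.IsNorm)
    (NF : Friedrichs.FibreSeminorm W F) (hNF : NF.IsNorm)
    (hE : Friedrichs.HermitianMetric n V E) (hF : Friedrichs.HermitianMetric n W F)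
    {A : Type*} (𝒜 : Friedrichs.GoodAtlas n M A)
    (τE : Friedrichs.GoodTriv 𝒜 V E) (τF : Friedrichs.GoodTriv 𝒜 W F)
    (φ : Friedrichs.Kernel n)
    (D : Friedrichs.FirstOrderOp n V E W F)
    (p : ℝ≥0∞) (hp : 1 ≤ p) :
    -- `J_ε` is a well-defined linear operator on (classes of) sections in `L^1_loc`
    (∀ ε : Friedrichs.Params A,
      (∀ f g : ∀ x, E x, Friedrichs.IsLpLoc NE μ 1 f → Friedrichs.IsLpLoc NE μ 1 g →
        (∀ᵐ x ∂μ, f x = g x) → τE.mollify φ ε f = τE.mollify φ ε g) ∧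
      (∀ f g : ∀ x, E x, Friedrichs.IsLpLoc NE μ 1 f → Friedrichs.IsLpLoc NE μ 1 g →
        τE.mollify φ ε (f + g) = τE.mollify φ ε f + τE.mollify φ ε g) ∧
      (∀ (c : ℂ) (f : ∀ x, E x), Friedrichs.IsLpLoc NE μ 1 f →
        τE.mollify φ ε (c • f) = c • τE.mollify φ ε f)) ∧
    -- (i) smoothing
    (∀ (f : ∀ x, E x) (ε : Friedrichs.Params A), Friedrichs.IsLpLoc NE μ 1 f →
      Friedrichs.IsSmoothSection n V (τE.mollify φ ε f)) ∧
    -- (ii) supports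
    (∀ C U : Set M, IsClosed C → IsOpen U → C ⊆ U →
      ∃ εbar : Friedrichs.Params A, ∀ f : ∀ x, E x, Friedrichs.IsLpLoc NE μ 1 f →
        (∀ᵐ x ∂μ, x ∉ C → f x = 0) →
        ∀ ε ≤ εbar, Friedrichs.secSupport (τE.mollify φ ε f) ⊆ U) ∧
    -- (iii) equicontinuity
    (∀ ζ : M → ℂ, Friedrichs.IsLinfLoc μ ζ →
      (∃ ξ : M → ℂ, Friedrichs.IsLinfLoc μ ξ ∧
        ∀ f : ∀ x, E x, Friedrichs.IsLpLoc NE μ p f → ∀ ε : Friedrichs.Params A,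
          Friedrichs.secNorm NE μ p ζ (τE.mollify φ ε f) ≤ Friedrichs.secNorm NE μ p ξ f) ∧
      (Friedrichs.IsLinfComp μ ζ → ∃ ξ : M → ℂ, Friedrichs.IsLinfComp μ ξ ∧
        ∀ f : ∀ x, E x, Friedrichs.IsLpLoc NE μ p f → ∀ ε : Friedrichs.Params A,
          Friedrichs.secNorm NE μ p ζ (τE.mollify φ ε f) ≤ Friedrichs.secNorm NE μ p ξ f)) ∧
    -- (iv) approximation
    (∀ f : ∀ x, E x,
      (p < ⊤ ∧ Friedrichs.IsLpLoc NE μ p f) ∨ (p = ⊤ ∧ Friedrichs.IsContSection V f) →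
      ∀ ζ : M → ℂ, Friedrichs.IsLinfLoc μ ζ →
        Friedrichs.limsupZero (fun ε : Friedrichs.Params A =>
          Friedrichs.secNorm NE μ p ζ (τE.mollify φ ε f - f)) = 0) ∧
    -- (v) upper bound
    (∀ f : ∀ x, E x, Friedrichs.IsLpLoc NE μ ⊤ f →
      ∀ (P : Friedrichs.FibreSeminorm V E) (C : Set M), IsClosed C →
        Friedrichs.limsupZero (fun ε : Friedrichs.Params A =>
          ⨆ x ∈ C, ENNReal.ofReal (P.seminorm x (τE.mollify φ ε f x))) ≤
        ⨅ (U : Set M) (_ : IsOpen U) (_ : C ⊆ U),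
          essSup (fun x => ENNReal.ofReal (P.seminorm x (f x))) (μ.restrict U)) ∧
    -- (vi) equicontinuity of the commutators
    (∀ ζ : M → ℂ, Friedrichs.IsLinfLoc μ ζ →
      (∃ ξ : M → ℂ, Friedrichs.IsLinfLoc μ ξ ∧
        ∀ f : ∀ x, E x, Friedrichs.IsLpLoc NE μ p f → ∀ ε : Friedrichs.Params A,
          Friedrichs.secNorm NF μ p ζ (Friedrichs.commutator τE τF φ μ hE hF D ε f) ≤
            Friedrichs.secNorm NE μ p ξ f) ∧
      (Friedrichs.IsLinfComp μ ζ → ∃ ξ : M → ℂ, Friedrichs.IsLinfComp μ ξ ∧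
        ∀ f : ∀ x, E x, Friedrichs.IsLpLoc NE μ p f → ∀ ε : Friedrichs.Params A,
          Friedrichs.secNorm NF μ p ζ (Friedrichs.commutator τE τF φ μ hE hF D ε f) ≤
            Friedrichs.secNorm NE μ p ξ f)) ∧
    -- (vii) vanishing of the commutators
    (∀ f : ∀ x, E x,
      (p < ⊤ ∧ Friedrichs.IsLpLoc NE μ p f) ∨ (p = ⊤ ∧ Friedrichs.IsContSection V f) →
      ∀ ζ : M → ℂ, Friedrichs.IsLinfLoc μ ζ →
        Friedrichs.limsupZero (fun ε : Friedrichs.Params A =>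
          Friedrichs.secNorm NF μ p ζ (Friedrichs.commutator τE τF φ μ hE hF D ε f)) = 0) ∧
    -- (viii) equicontinuity on `W^p_{D,loc}`
    (∀ ζ : M → ℂ, Friedrichs.IsLinfLoc μ ζ →
      (∃ ξ : M → ℂ, Friedrichs.IsLinfLoc μ ξ ∧
        ∀ (f : ∀ x, E x) (g : ∀ x, F x), Friedrichs.IsLpLoc NE μ p f →
          Friedrichs.IsLpLoc NF μ p g → D.IsWeakDeriv μ hE hF f g →
          ∀ ε : Friedrichs.Params A,
            Friedrichs.secNorm NF μ p ζ (D.app (τE.mollify φ ε f)) ≤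
              Friedrichs.secNorm NE μ p ξ f + Friedrichs.secNorm NF μ p ξ g) ∧
      (Friedrichs.IsLinfComp μ ζ → ∃ ξ : M → ℂ, Friedrichs.IsLinfComp μ ξ ∧
        ∀ (f : ∀ x, E x) (g : ∀ x, F x), Friedrichs.IsLpLoc NE μ p f →
          Friedrichs.IsLpLoc NF μ p g → D.IsWeakDeriv μ hE hF f g →
          ∀ ε : Friedrichs.Params A,
            Friedrichs.secNorm NF μ p ζ (D.app (τE.mollify φ ε f)) ≤
              Friedrichs.secNorm NE μ p ξ f + Friedrichs.secNorm NF μ p ξ g)) ∧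
    -- (ix) approximation on `W^p_{D,loc}`
    (∀ (f : ∀ x, E x) (g : ∀ x, F x), D.IsWeakDeriv μ hE hF f g →
      (p < ⊤ ∧ Friedrichs.IsLpLoc NE μ p f ∧ Friedrichs.IsLpLoc NF μ p g) ∨
        (p = ⊤ ∧ Friedrichs.IsContSection V f ∧ Friedrichs.IsContSection W g) →
      ∀ ζ : M → ℂ, Friedrichs.IsLinfLoc μ ζ →
        Friedrichs.limsupZero (fun ε : Friedrichs.Params A =>
          Friedrichs.secNorm NF μ p ζ (D.app (τE.mollify φ ε f) - g)) = 0) ∧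
    -- (x) upper bound on the derivatives
    (∀ (f : ∀ x, E x) (g : ∀ x, F x), Friedrichs.IsContSection V f →
      Friedrichs.IsLpLoc NF μ ⊤ g → D.IsWeakDeriv μ hE hF f g →
      ∀ (P : Friedrichs.FibreSeminorm W F) (C : Set M), IsClosed C →
        Friedrichs.limsupZero (fun ε : Friedrichs.Params A =>
          ⨆ x ∈ C, ENNReal.ofReal (P.seminorm x (D.app (τE.mollify φ ε f) x))) ≤
        ⨅ (U : Set M) (_ : IsOpen U) (_ : C ⊆ U),
          essSup (fun x => ENNReal.ofReal (P.seminorm x (g x))) (μ.restrict U)) := by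
  have hloc : ∀ q : ℝ≥0∞, 1 ≤ q → ∀ f : ∀ x, E x, Friedrichs.IsLpLoc NE μ q f →
      ∀ α, LocallyIntegrable (Friedrichs.localRep (𝒜.chart α) (τE.triv α) f) volume :=
    fun q hq f hf α => (τE.localFrame α).locallyIntegrable_localRep hμ hNE hq hf
  refine ⟨fun ε => ⟨fun f g _ _ h => τE.mollify_congr_ae hμ φ ε h,
    fun f g hf hg => τE.mollify_add φ ε (hloc 1 le_rfl f hf) (hloc 1 le_rfl g hg),
    fun c f _ => τE.mollify_smul φ ε c f⟩,
    fun f ε hf => τE.isSmoothSection_mollify φ ε (hloc 1 le_rfl f hf),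
    fun C U hC hU hCU => ?_, fun ζ hζ => ?_,
    fun f hf ζ hζ => τE.limsupZero_mollify_sub hμ φ hNE NE hp hf hζ,
    fun f hf P C hC => τE.limsupZero_iSup_mollify_le hμ φ hNE hf P hC, fun ζ hζ => ?_,
    fun f hf ζ hζ => Friedrichs.limsupZero_commutator hμ τE τF φ hNE NF hp hf hζ,
    fun ζ hζ => ?_, fun f g hfg hreg ζ hζ => ?_,
    fun f g hf hg hfg P C hC =>
      hfg.limsupZero_iSup_app_mollify_le hμ τE τF φ hNE hNF hf hg P hC⟩
  · obtain ⟨εbar, h⟩ := τE.exists_secSupport_mollify_subset hμ φ hC hU hCU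
    exact ⟨εbar, fun f _ hf ε hε => h f hf ε hε⟩
  · obtain ⟨ξ, hξ, hξc, h⟩ := τE.exists_secNorm_mollify_le hμ φ hNE hζ hp
    exact ⟨⟨ξ, hξ, h⟩, fun hc => ⟨ξ, hξc hc, h⟩⟩
  · obtain ⟨ξ, hξ, hξc, h⟩ := Friedrichs.exists_secNorm_commutator_le (D := D) (hE := hE)
      (hF := hF) hμ τE τF φ hNE NF hζ hp
    exact ⟨⟨ξ, hξ, h⟩, fun hc => ⟨ξ, hξc hc, h⟩⟩
  · obtain ⟨ξ, hξ, hξc, h⟩ := Friedrichs.exists_secNorm_app_mollify_le (D := D) (hE := hE)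
      (hF := hF) hμ τE τF φ hNE hNF hζ hp
    exact ⟨⟨ξ, hξ, h⟩, fun hc => ⟨ξ, hξc hc, h⟩⟩
  · refine Friedrichs.limsupZero_app_mollify_sub hμ τE τF φ hNE hNF hp hfg ?_ ?_ hζ
    · exact hreg.imp (fun h => ⟨h.1, h.2.1⟩) fun h => ⟨h.1, h.2.1⟩
    · exact hreg.imp (fun h => ⟨h.1, h.2.2⟩) fun h => ⟨h.1, h.2.2⟩
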